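/- Let $\alpha,\gamma\in\mathbb{R}$ with $\max(-\alpha,0)<\gamma<\tfrac12$. Let $J_\nu,Y_\nu$ be the Bessel functions of the first and second kind, $I_\nu,K_\nu$ the modified Bessel functions, $B$ the beta function, and $$\mathcal{W}_\alpha(x,\tau)=\frac{\operatorname{Im}\left[J_{\alpha+i\tau}(\sqrt x)\,Y_{\alpha-i\tau}(\sqrt x)\right]}{\sinh(\pi\tau)},\qquad x>0,\ \tau\in\mathbb{R},$$ where the value at $\tau=0$ is the limit as $\tau\to0$ (which exists). Let $L_{1-\gamma,1}(\mathbb{R}_+)$ be the space of measurable $f:\mathbb{R}_+\to\mathbb{C}$ with $\|f\|_{1-\gamma,1}=\int_0^\infty|f(x)|\,x^{-\gamma}\,dx<\infty$, and let $C_b(\mathbb{R};[\cosh(\pi\tau)]^{-1})$ be the space of functions $F:\mathbb{R}\to\mathbb{C}$ for which $F(\tau)/\cosh(\pi\tau)$ is bounded and continuous on $\mathbb{R}$, with norm $\sup_{\tau\in\mathbb{R}}|F(\tau)|/\cosh(\pi\tau)$. Then the index transform $$(F_\alpha f)(\tau)=\int_0^\infty \mathcal{W}_\alpha(x,\tau)f(x)\,dx$$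 converges absolutely for all $f\in L_{1-\gamma,1}(\mathbb{R}_+)$ and $\tau\in\mathbb{R}$, and it is a bounded linear operator $F_\alpha:L_{1-\gamma,1}(\mathbb{R}_+)\to C_b(\mathbb{R};[\cosh(\pi\tau)]^{-1})$ with $$\sup_{\tau\in\mathbb{R}}\frac{|(F_\alpha f)(\tau)|}{\cosh(\pi\tau)}\le C_\gamma\,\|f\|_{1-\gamma,1},\qquad C_\gamma=\frac{2^{2\gamma-1}}{\pi^2}\,B(\gamma,\gamma)\int_{\gamma-i\infty}^{\gamma+i\infty}\frac{|\Gamma(s+\alpha)|}{|\sin(2\pi s)\,\Gamma(1+\alpha-s)|}\,|ds|<\infty.$$ Moreover, for all $f\in L_{1-\gamma,1}(\mathbb{R}_+)$ and $\tau\in\mathbb{R}$, $$(F_\alpha f)(\tau)=\frac1{\pi^2}\int_0^\infty K_{i\tau}(\sqrt x)\left[I_{i\tau}(\sqrt x)+I_{-i\tau}(\sqrt x)\right]\varphi_\alpha(x)\,dx,$$ where $$\varphi_\alpha(x)=\frac1{2\pi i}\int_{1-\gamma-i\infty}^{1-\gamma+i\infty}\frac{\Gamma(1-s+\alpha)\,\Gamma(s)^2}{\Gamma(s+\alpha)}\,f^*(s)\,x^{-s}\,ds,\quad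 x>0,\qquad f^*(s)=\int_0^\infty f(x)\,x^{s-1}\,dx,$$ and the integrals that define $(F_\alpha f)(\tau)$ through $\varphi_\alpha$ and that define $\varphi_\alpha(x)$ converge absolutely. -/

import Mathlib

open Set Filter Topology MeasureTheory

noncomputable section

namespace WeberIndex

/-- Bessel function of the first kind of complex order `ν`, through its power series (principal
branch of the power). Mathlib's conventions `Γ(-n) = 0` and `a / 0 = 0` give `1 / Γ(-n) = 0`, as in
the usual reading of this series. -/
def besselJ (ν z : ℂ) : ℂ :=
  ∑' k : ℕ, (-1) ^ k / ((k.factorial : ℂ) * Complex.Gamma (k + ν + 1))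
    * ((z / 2) ^ ν * (z / 2) ^ (2 * k))

/-- Modified Bessel function of the first kind of complex order `ν`. -/
def besselI (ν z : ℂ) : ℂ :=
  ∑' k : ℕ, 1 / ((k.factorial : ℂ) * Complex.Gamma (k + ν + 1))
    * ((z / 2) ^ ν * (z / 2) ^ (2 * k))

/-- The quotient that defines the Bessel function of the second kind off the integers. -/
def besselYAux (ν z : ℂ) : ℂ :=
  (besselJ ν z * Complex.cos (ν * Real.pi) - besselJ (-ν) z) / Complex.sin (ν * Real.pi)

open Classical in
/-- Bessel function of the second kind; at integer orders it is the limit in the order. -/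
def besselY (ν z : ℂ) : ℂ :=
  if ∃ n : ℤ, ν = n then limUnder (𝓝[≠] ν) (fun μ => besselYAux μ z) else besselYAux ν z

/-- The quotient that defines the modified Bessel function of the second kind off the integers. -/
def besselKAux (ν z : ℂ) : ℂ :=
  (Real.pi / 2) * (besselI (-ν) z - besselI ν z) / Complex.sin (ν * Real.pi)

open Classical in
/-- Modified Bessel function of the second kind (Macdonald function); at integer orders it is the
limit in the order. -/
def besselK (ν z : ℂ) : ℂ :=
  if ∃ n : ℤ, ν = n then limUnder (𝓝[≠] ν) (fun μ => besselKAux μ z) else besselKAux ν z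

/-- The quotient `Im [J_{α+iτ}(√x) Y_{α-iτ}(√x)] / sinh (πτ)`. -/
def weberQuotient (α x τ : ℝ) : ℝ :=
  (besselJ (α + Complex.I * τ) (Real.sqrt x) * besselY (α - Complex.I * τ) (Real.sqrt x)).im
    / Real.sinh (Real.pi * τ)

/-- The Weber type kernel `W_α(x, τ)`. At `τ = 0`, where the quotient has the form `0 / 0`, it is
the limit as `τ → 0`. -/
def weberKernel (α x τ : ℝ) : ℝ :=
  if τ = 0 then limUnder (𝓝[≠] (0 : ℝ)) (fun t => weberQuotient α x t) else weberQuotient α x τ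

/-- The index transform `(F_α f)(τ) = ∫₀^∞ W_α(x, τ) f(x) dx`. -/
def weberTransform (α : ℝ) (f : ℝ → ℂ) (τ : ℝ) : ℂ :=
  ∫ x in Ioi (0 : ℝ), (weberKernel α x τ : ℂ) * f x

/-- The space `L_{ν,1}(ℝ₊)` of (measurable) functions with `∫₀^∞ |f(x)| x^{ν-1} dx < ∞`. -/
def weightedL1 (ν : ℝ) : Submodule ℂ (ℝ → ℂ) where
  carrier := {f | IntegrableOn (fun x : ℝ => ((x ^ (ν - 1) : ℝ) : ℂ) * f x) (Ioi 0)}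
  add_mem' := by
    intro f g hf hg
    have h := Integrable.add hf hg
    refine h.congr (Eventually.of_forall fun x => ?_)
    simp [mul_add]
  zero_mem' := by simp
  smul_mem' := by
    intro c f hf
    have h := Integrable.const_mul hf c
    refine h.congr (Eventually.of_forall fun x => ?_)
    simp only [Pi.smul_apply, smul_eq_mul]
    ring

/-- The norm of `L_{ν,1}(ℝ₊)`. -/
def weightedL1Norm (ν : ℝ) (f : ℝ → ℂ) : ℝ :=
  ∫ x in Ioi (0 : ℝ), ‖f x‖ * x ^ (ν - 1)

/-- The space `C_b(ℝ; [cosh (πτ)]⁻¹)` of functions `F` such that `F(τ) / cosh (πτ)` is bounded and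
continuous on `ℝ`. -/
def weightedCb : Submodule ℂ (ℝ → ℂ) where
  carrier := {F | Continuous (fun τ : ℝ => F τ / (Real.cosh (Real.pi * τ) : ℂ)) ∧
    ∃ M : ℝ, ∀ τ : ℝ, ‖F τ‖ / Real.cosh (Real.pi * τ) ≤ M}
  add_mem' := by
    rintro F G ⟨hF, M, hM⟩ ⟨hG, N, hN⟩
    refine ⟨?_, M + N, fun τ => ?_⟩
    · refine (hF.add hG).congr fun τ => ?_
      simp [add_div]
    · refine le_trans ?_ (add_le_add (hM τ) (hN τ))
      rw [← add_div]
      exact div_le_div_of_nonneg_right (norm_add_le _ _) (Real.cosh_pos _).le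
  zero_mem' := ⟨by simpa using continuous_const, 0, by simp⟩
  smul_mem' := by
    rintro c F ⟨hF, M, hM⟩
    refine ⟨?_, ‖c‖ * M, fun τ => ?_⟩
    · refine ((continuous_const (y := c)).mul hF).congr fun τ => ?_
      simp [mul_div_assoc]
    · simpa only [Pi.smul_apply, norm_smul, mul_div_assoc] using
        mul_le_mul_of_nonneg_left (hM τ) (norm_nonneg c)

/-- The norm of `C_b(ℝ; [cosh (πτ)]⁻¹)`. -/
def weightedCbNorm (F : ℝ → ℂ) : ℝ :=
  ⨆ τ : ℝ, ‖F τ‖ / Real.cosh (Real.pi * τ)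

/-- The function `|Γ(s+α)| / |sin (2πs) Γ(1+α-s)|` of `s`. -/
def normIntegrand (α : ℝ) (s : ℂ) : ℝ :=
  ‖Complex.Gamma (s + α)‖
    / ‖Complex.sin (2 * Real.pi * s) * Complex.Gamma (1 + α - s)‖

/-- The constant `C_γ`. -/
def normConst (α γ : ℝ) : ℝ :=
  2 ^ (2 * γ - 1) / Real.pi ^ 2 * ProbabilityTheory.beta γ γ
    * ∫ t : ℝ, normIntegrand α (γ + t * Complex.I)

/-- The function `Γ(1-s+α) Γ(s)² / Γ(s+α) · f^*(s)`, with `f^*` the Mellin transform of `f`. -/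
def phiMellin (α : ℝ) (f : ℝ → ℂ) (s : ℂ) : ℂ :=
  Complex.Gamma (1 - s + α) * Complex.Gamma s ^ 2 / Complex.Gamma (s + α) * mellin f s

/-- The function `φ_α(x) = (2πi)⁻¹ ∫ Γ(1-s+α) Γ(s)² / Γ(s+α) f^*(s) x^{-s} ds`, the integral being
over the line `Re s = 1 - γ`. -/
def phi (α γ : ℝ) (f : ℝ → ℂ) (x : ℝ) : ℂ :=
  mellinInv (1 - γ) (phiMellin α f) x

/-- The kernel `K_{iτ}(√x) [I_{iτ}(√x) + I_{-iτ}(√x)]`. -/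
def KIKernel (x τ : ℝ) : ℂ :=
  besselK (Complex.I * τ) (Real.sqrt x)
    * (besselI (Complex.I * τ) (Real.sqrt x) + besselI (-(Complex.I * τ)) (Real.sqrt x))

end WeberIndex

end

/-!
The theorem rests on two Mellin–Barnes representations on the line `re s = γ`: the kernel
`K_{iτ}(√x) [I_{iτ}(√x) + I_{-iτ}(√x)]` is the inverse Mellin transform of
`kiMellin τ s = cosh (πτ) π^{-1/2} Γ(1/2 - s) Γ(s + iτ) Γ(s - iτ) / Γ(1 - s)`, and `W_α(x, τ)` is
that of `weberMellin α τ s = π⁻² kiMellin τ s · Γ(1 - s)² Γ(s + α) / Γ(1 + α - s)`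
(`KIKernel_eq_mellinInv`, `weberKernel_eq_mellinInv`).

For `τ ≠ 0` they are proved by moving the line of integration to the left
(`integral_vertical_line_sub_eq_sum_residues`, `integral_vertical_eq_sum_residue_series`). The
poles `±iτ - n` and `-α - n` are simple, and by the functional equation of `Γ` the integrals over
the lines `re s = c - N` tend to zero, for `c` in the strip such that these lines avoid the poles.
The residues along each chain of poles are the coefficients of a product of two Bessel series,
which the Chu–Vandermonde identity computes (`hasSum_besselSeries_mul`); the sums recombine into
the definitions of `K_ν` and `Y_ν`. The growth of `Γ` on vertical strips that this needs is
derived from the exact value of `|Γ(1 + it)|`, the monotonicity in `σ` of `|Γ(σ + it)| / Γ(σ)` and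
the functional equation (`gammaBand`). At `τ = 0` the representations follow by continuity in `τ`;
for `W_α` this gives the existence of the limit that defines it there, and for `K_0` the limit
exists because `I_ν` is entire in `ν`.

The bound comes from `Γ(s + iτ) Γ(s - iτ) = Γ(2s) B(s + iτ, s - iτ)` and
`|B(s + iτ, s - iτ)| ≤ B(γ, γ)` on the line `re s = γ`: what remains of `weberMellin` after
division by `cosh (πτ)` no longer depends on `τ`, and by duplication and reflection it is the
integrand of `C_γ` up to a constant (`norm_weberMellin_le`). So
`|W_α(x, τ)| ≤ cosh (πτ) C_γ x^{-γ}`, which gives absolute convergence, the norm estimate, and, by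
dominated convergence, continuity in `τ`.

For the representation through `φ_α`, Fubini's theorem (`integral_mul_mellinInv`) turns both sides
into integrals over the line `re s = γ`: the left-hand side into that of
`weberMellin α τ s · f^*(1 - s)`, the right-hand side into that of `phiMellin α f (1 - s)` times
the Mellin transform of the modified Bessel kernel, which is `kiMellin τ s` by Mellin inversion
(`mellin_mellinInv`). The two integrands agree up to the factor `π²` (`weberMellin_mul_mellin`).
-/

namespace WeberIndex

/-! ### Contour integrals in vertical strips -/

section ContourShift

open Complex

lemma integral_div_sq_add_sq {u : ℝ} (hu : u ≠ 0) :
    Integrable (fun y : ℝ => u / (u ^ 2 + y ^ 2)) ∧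
      ∫ y : ℝ, u / (u ^ 2 + y ^ 2) = Real.pi * (|u| / u) := by
  have h : (fun y : ℝ => u / (u ^ 2 + y ^ 2)) = fun y => u⁻¹ * (1 + (y / u) ^ 2)⁻¹ := by
    funext y
    have : u ^ 2 + y ^ 2 ≠ 0 := by positivity
    have : 1 + (y / u) ^ 2 ≠ 0 := by positivity
    field_simp
  constructor
  · rw [h]
    exact (integrable_inv_one_add_sq.comp_div hu).const_mul _
  · rw [h, integral_const_mul, Measure.integral_comp_div (fun y : ℝ => (1 + y ^ 2)⁻¹),
      integral_univ_inv_one_add_sq, smul_eq_mul]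
    ring

lemma norm_add_mul_I_ge {δ u : ℝ} (hδ : 0 ≤ δ) (hδ1 : δ ≤ 1) (hδu : δ ≤ |u|) (y : ℝ) :
    δ * Real.sqrt (1 + y ^ 2) ≤ ‖(u : ℂ) + y * I‖ := by
  rw [Complex.norm_add_mul_I]
  apply Real.le_sqrt_of_sq_le
  rw [mul_pow, Real.sq_sqrt (by positivity)]
  have h1 : δ ^ 2 ≤ u ^ 2 := by rw [← sq_abs u]; gcongr
  have h2 : δ ^ 2 ≤ 1 := by nlinarith
  nlinarith [sq_nonneg y, mul_nonneg (sub_nonneg.2 h2) (sq_nonneg y)]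

lemma ofReal_add_mul_I_ne_zero {u : ℝ} (hu : u ≠ 0) (y : ℝ) : (u : ℂ) + y * I ≠ 0 := fun h => by
  apply hu; simpa using congrArg re h

lemma integrable_inv_sub_inv {u v : ℝ} (hu : u ≠ 0) (hv : v ≠ 0) :
    Integrable (fun y : ℝ => ((u : ℂ) + y * I)⁻¹ - ((v : ℂ) + y * I)⁻¹) := by
  obtain ⟨δ, hδ, h1, h2, h3⟩ : ∃ δ : ℝ, 0 < δ ∧ δ ≤ 1 ∧ δ ≤ |u| ∧ δ ≤ |v| :=
    ⟨min 1 (min |u| |v|), by positivity, min_le_left _ _,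
      (min_le_right _ _).trans (min_le_left _ _), (min_le_right _ _).trans (min_le_right _ _)⟩
  refine (integrable_inv_one_add_sq.const_mul (|v - u| / δ ^ 2)).mono' ?_ ?_
  · refine Continuous.aestronglyMeasurable ?_
    exact (Continuous.inv₀ (by fun_prop) (ofReal_add_mul_I_ne_zero hu)).sub
      (Continuous.inv₀ (by fun_prop) (ofReal_add_mul_I_ne_zero hv))
  · refine Eventually.of_forall fun y => ?_
    rw [inv_sub_inv (ofReal_add_mul_I_ne_zero hu y) (ofReal_add_mul_I_ne_zero hv y), norm_div,
      norm_mul]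
    have e : ‖((v : ℂ) + y * I) - (u + y * I)‖ = |v - u| := by
      rw [show ((v : ℂ) + y * I) - (u + y * I) = ((v - u : ℝ) : ℂ) by push_cast; ring,
        Complex.norm_real, Real.norm_eq_abs]
    rw [e, div_mul_eq_mul_div, ← div_eq_mul_inv, div_div]
    have g : δ ^ 2 * (1 + y ^ 2) ≤ ‖(u : ℂ) + y * I‖ * ‖(v : ℂ) + y * I‖ := by
      have := mul_le_mul (norm_add_mul_I_ge hδ.le h1 h2 y) (norm_add_mul_I_ge hδ.le h1 h3 y)
        (by positivity) (by positivity)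
      have e2 := Real.sq_sqrt (show 0 ≤ 1 + y ^ 2 by positivity)
      nlinarith
    rw [mul_comm (1 + y ^ 2)]
    gcongr

/-- The imaginary part is odd and drops out; the real part leaves `π` times the difference of the
signs of `u` and `v`. -/
lemma integral_inv_sub_inv {u v : ℝ} (hu : u ≠ 0) (hv : v ≠ 0) :
    ∫ y : ℝ, (((u : ℂ) + y * I)⁻¹ - ((v : ℂ) + y * I)⁻¹) =
      Real.pi * ((|u| / u - |v| / v : ℝ) : ℂ) := by
  set f : ℝ → ℂ := fun y => ((u : ℂ) + y * I)⁻¹ - ((v : ℂ) + y * I)⁻¹ with hf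
  have hi : Integrable f := integrable_inv_sub_inv hu hv
  have key : ∀ y, f y + f (-y) =
      ((2 * (u / (u ^ 2 + y ^ 2) - v / (v ^ 2 + y ^ 2)) : ℝ) : ℂ) := by
    have aux : ∀ {w : ℝ}, w ≠ 0 → ∀ y : ℝ, ((w : ℂ) + y * I)⁻¹ + ((w : ℂ) + (-y : ℝ) * I)⁻¹ =
        ((2 * (w / (w ^ 2 + y ^ 2)) : ℝ) : ℂ) := by
      intro w hw y
      have h1 := ofReal_add_mul_I_ne_zero hw y
      have e2 : (w : ℂ) + (-y : ℝ) * I = w - y * I := by push_cast; ring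
      have h2 := ofReal_add_mul_I_ne_zero hw (-y)
      rw [e2] at h2 ⊢
      have h3 : ((w : ℂ) ^ 2 + (y : ℂ) ^ 2) = ((w : ℂ) + y * I) * (w - y * I) := by
        ring_nf; rw [I_sq]; ring
      push_cast
      rw [h3]
      field_simp
      ring
    intro y
    simp only [hf]
    have := aux hu y
    have := aux hv y
    push_cast at *
    linear_combination aux hu y - aux hv y
  have e : (2 : ℂ) * ∫ y, f y = ∫ y, (f y + f (-y)) := by
    rw [integral_add hi hi.comp_neg, integral_neg_eq_self f volume]; ring
  have h2 : ∫ y, (f y + f (-y)) = 2 * (Real.pi * ((|u| / u - |v| / v : ℝ) : ℂ)) := by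
    simp_rw [key]
    rw [integral_complex_ofReal, integral_const_mul,
      integral_sub (integral_div_sq_add_sq hu).1 (integral_div_sq_add_sq hv).1,
      (integral_div_sq_add_sq hu).2, (integral_div_sq_add_sq hv).2]
    push_cast; ring
  exact mul_left_cancel₀ two_ne_zero (e.trans h2)

/-- Uniform decay of `H` at both ends of the vertical strip `a ≤ re s ≤ b`. -/
def DecaysInStrip (a b : ℝ) (H : ℂ → ℂ) : Prop :=
  ∀ ε > 0, ∃ T : ℝ, ∀ s : ℂ, a ≤ s.re → s.re ≤ b → T ≤ |s.im| → ‖H s‖ ≤ ε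

/-- Cauchy's theorem for a vertical strip. -/
theorem integral_vertical_line_eq {a b : ℝ} (hab : a ≤ b) {H : ℂ → ℂ}
    (hd : ∀ s : ℂ, a ≤ s.re → s.re ≤ b → DifferentiableAt ℂ H s) (hdec : DecaysInStrip a b H)
    (ha : Integrable (fun t : ℝ => H (a + t * I))) (hb : Integrable (fun t : ℝ => H (b + t * I))) :
    ∫ t : ℝ, H (b + t * I) = ∫ t : ℝ, H (a + t * I) := by
  have lim : ∀ c : ℝ, Integrable (fun t : ℝ => H (c + t * I)) →
      Tendsto (fun T : ℝ => ∫ t in (-T)..T, H (c + t * I)) atTop (𝓝 (∫ t : ℝ, H (c + t * I))) :=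
    fun c hc => intervalIntegral_tendsto_integral hc tendsto_neg_atTop_atBot tendsto_id
  have rect : ∀ T : ℝ, ‖(∫ t in (-T)..T, H (b + t * I)) - ∫ t in (-T)..T, H (a + t * I)‖ ≤
      ‖∫ x in a..b, H (x + T * I)‖ + ‖∫ x in a..b, H (x + (-T : ℝ) * I)‖ := by
    intro T
    have := integral_boundary_rect_eq_zero_of_differentiableOn H (a + (-T : ℝ) * I) (b + T * I)
      (by
        intro s hs
        rw [mem_reProdIm] at hs
        simp only [add_re, ofReal_re, mul_re, I_re, mul_zero, ofReal_im, I_im, mul_one, sub_self,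
          add_zero, uIcc_of_le hab] at hs
        exact (hd s hs.1.1 hs.1.2).differentiableWithinAt)
    simp only [add_re, ofReal_re, mul_re, I_re, mul_zero, ofReal_im, I_im, mul_one, sub_self,
      add_zero, add_im, mul_im, zero_add, smul_eq_mul] at this
    have e : I * ((∫ t in (-T)..T, H (b + t * I)) - ∫ t in (-T)..T, H (a + t * I)) =
        (∫ x in a..b, H (x + T * I)) - ∫ x in a..b, H (x + (-T : ℝ) * I) := by
      linear_combination this
    calc _ = ‖I * ((∫ t in (-T)..T, H (b + t * I)) - ∫ t in (-T)..T, H (a + t * I))‖ := by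
          rw [norm_mul, norm_I, one_mul]
      _ ≤ _ := by rw [e]; exact norm_sub_le _ _
  have small : Tendsto (fun T : ℝ => (∫ t in (-T)..T, H (b + t * I)) -
      ∫ t in (-T)..T, H (a + t * I)) atTop (𝓝 0) := by
    rw [Metric.tendsto_atTop]
    intro ε hε
    obtain ⟨T, hT⟩ := hdec (ε / (4 * (b - a + 1))) (by have := sub_nonneg.2 hab; positivity)
    refine ⟨max T 0, fun R hR => ?_⟩
    rw [dist_zero_right]
    refine (rect R).trans_lt ?_
    have hR0 : 0 ≤ R := (le_max_right _ _).trans hR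
    have hRT : T ≤ R := (le_max_left _ _).trans hR
    have hor : ∀ r : ℝ, |r| = R → ‖∫ x in a..b, H (x + r * I)‖ ≤ ε / 4 := by
      intro r hr
      have h1 := intervalIntegral.norm_integral_le_of_norm_le_const
        (C := ε / (4 * (b - a + 1))) (f := fun x : ℝ => H (x + r * I)) (a := a) (b := b)
        (fun x hx => by
          rw [uIoc_of_le hab] at hx
          exact hT _ (by simpa using hx.1.le) (by simpa using hx.2) (by simpa [hr] using hRT))
      refine h1.trans ?_
      have := sub_nonneg.2 hab
      rw [abs_of_nonneg this, div_mul_eq_mul_div, div_le_div_iff₀ (by positivity) (by positivity)]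
      nlinarith
    have h1 := hor R (abs_of_nonneg hR0)
    have h2 := hor (-R) (by rw [abs_neg, abs_of_nonneg hR0])
    linarith
  have := tendsto_nhds_unique ((lim b hb).sub (lim a ha)) small
  exact sub_eq_zero.1 this

/-- A function with a simple pole of residue one at `p`, integrable on vertical lines; its second
pole lies to the right of every strip of width less than `d` that contains `p`. -/
noncomputable def poleKernel (d : ℝ) (p s : ℂ) : ℂ := (s - p)⁻¹ - (s - p - d)⁻¹

lemma poleKernel_vertical (d : ℝ) (p : ℂ) (c t : ℝ) :
    poleKernel d p (c + t * I) =
      (((c - p.re : ℝ) : ℂ) + ((t - p.im : ℝ) : ℂ) * I)⁻¹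
        - (((c - p.re - d : ℝ) : ℂ) + ((t - p.im : ℝ) : ℂ) * I)⁻¹ := by
  have : (c : ℂ) + t * I - p = ((c - p.re : ℝ) : ℂ) + ((t - p.im : ℝ) : ℂ) * I := by
    apply Complex.ext <;> simp
  rw [poleKernel, this]
  congr 2
  push_cast; ring

lemma integrable_poleKernel {d : ℝ} {p : ℂ} {c : ℝ} (h1 : c - p.re ≠ 0) (h2 : c - p.re - d ≠ 0) :
    Integrable (fun t : ℝ => poleKernel d p (c + t * I)) := by
  simp_rw [poleKernel_vertical]
  exact (integrable_inv_sub_inv h1 h2).comp_sub_right p.im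

lemma integral_poleKernel {d : ℝ} {p : ℂ} {c : ℝ} (h1 : c - p.re ≠ 0) (h2 : c - p.re - d ≠ 0) :
    ∫ t : ℝ, poleKernel d p (c + t * I) =
      Real.pi * ((|c - p.re| / (c - p.re) - |c - p.re - d| / (c - p.re - d) : ℝ) : ℂ) := by
  simp_rw [poleKernel_vertical]
  rw [integral_sub_right_eq_self (fun t : ℝ => (((c - p.re : ℝ) : ℂ) + (t : ℂ) * I)⁻¹
        - (((c - p.re - d : ℝ) : ℂ) + (t : ℂ) * I)⁻¹) p.im]
  exact integral_inv_sub_inv h1 h2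

lemma decaysInStrip_poleKernel (a b d : ℝ) (p : ℂ) : DecaysInStrip a b (poleKernel d p) := by
  intro ε hε
  refine ⟨|p.im| + 2 / ε, fun s _ _ hs => ?_⟩
  have him : 2 / ε ≤ |(s - p).im| := by
    rw [sub_im]; have := abs_sub_abs_le_abs_sub s.im p.im; linarith
  have hpos : 0 < 2 / ε := by positivity
  have b1 : ‖(s - p)⁻¹‖ ≤ ε / 2 := by
    rw [norm_inv, inv_le_comm₀ (hpos.trans_le (him.trans (abs_im_le_norm _))) (by positivity)]
    simpa using him.trans (abs_im_le_norm _)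
  have b2 : ‖(s - p - d)⁻¹‖ ≤ ε / 2 := by
    have him' : 2 / ε ≤ |(s - p - d).im| := by simpa using him
    rw [norm_inv, inv_le_comm₀ (hpos.trans_le (him'.trans (abs_im_le_norm _))) (by positivity)]
    simpa using him'.trans (abs_im_le_norm _)
  exact (norm_sub_le _ _).trans (by linarith)

lemma DecaysInStrip.sub {a b : ℝ} {G H : ℂ → ℂ} (hG : DecaysInStrip a b G)
    (hH : DecaysInStrip a b H) : DecaysInStrip a b (fun s => G s - H s) := by
  intro ε hε
  obtain ⟨T, hT⟩ := hG (ε / 2) (by positivity)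
  obtain ⟨R, hR⟩ := hH (ε / 2) (by positivity)
  refine ⟨max T R, fun s h1 h2 h3 => (norm_sub_le _ _).trans ?_⟩
  have := hT s h1 h2 ((le_max_left _ _).trans h3)
  have := hR s h1 h2 ((le_max_right _ _).trans h3)
  linarith

lemma DecaysInStrip.const_mul {a b : ℝ} {G : ℂ → ℂ} (hG : DecaysInStrip a b G) (r : ℂ) :
    DecaysInStrip a b (fun s => r * G s) := by
  intro ε hε
  obtain ⟨T, hT⟩ := hG (ε / (‖r‖ + 1)) (by positivity)
  refine ⟨T, fun s h1 h2 h3 => ?_⟩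
  rw [norm_mul]
  have := hT s h1 h2 h3
  calc ‖r‖ * ‖G s‖ ≤ (‖r‖ + 1) * (ε / (‖r‖ + 1)) := by gcongr; linarith
    _ = ε := by field_simp

/-- The residue theorem for a vertical strip, for functions with finitely many simple poles. The
residue at the pole `p` is the limit `r p` of `(s - p) G(s)`; as `ds = i dt` on vertical lines, the
factor is `2π` instead of `2πi`. -/
theorem integral_vertical_line_sub_eq_sum_residues {a b : ℝ} (hab : a ≤ b) (S : Finset ℂ)
    (r : ℂ → ℂ) {G : ℂ → ℂ} (hS : ∀ p ∈ S, a < p.re ∧ p.re < b)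
    (hd : ∀ s : ℂ, a ≤ s.re → s.re ≤ b → s ∉ S → DifferentiableAt ℂ G s)
    (hr : ∀ p ∈ S, Tendsto (fun s => (s - p) * G s) (𝓝[≠] p) (𝓝 (r p)))
    (hdec : DecaysInStrip a b G)
    (ha : Integrable (fun t : ℝ => G (a + t * I))) (hb : Integrable (fun t : ℝ => G (b + t * I))) :
    (∫ t : ℝ, G (b + t * I)) - ∫ t : ℝ, G (a + t * I) = 2 * Real.pi * ∑ p ∈ S, r p := by
  classical
  induction S using Finset.induction_on generalizing G with
  | empty =>
    simp only [Finset.sum_empty, mul_zero, sub_eq_zero]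
    exact integral_vertical_line_eq hab (fun s h1 h2 => hd s h1 h2 (by simp)) hdec ha hb
  | insert p S hp ih =>
    have hpS := hS p (Finset.mem_insert_self _ _)
    set d : ℝ := b - a + 1 with hd_def
    -- subtracting the polar part at `p` leaves a removable singularity there
    set H : ℂ → ℂ := fun s => G s - r p * poleKernel d p s with hH
    set H' : ℂ → ℂ := Function.update H p (limUnder (𝓝[≠] p) H) with hH'
    have hker : ∀ s : ℂ, a ≤ s.re → s.re ≤ b → s ≠ p → DifferentiableAt ℂ (poleKernel d p) s := by
      intro s h1 h2 h3
      refine DifferentiableAt.sub (DifferentiableAt.inv (by fun_prop) (sub_ne_zero.2 h3))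
        (DifferentiableAt.inv (by fun_prop) fun h => ?_)
      have := congrArg re h
      simp at this
      linarith [hpS.1, hpS.2]
    have eqv : ∀ c : ℝ, c ≠ p.re → (fun t : ℝ => H' (c + t * I)) =
        fun t : ℝ => G (c + t * I) - r p * poleKernel d p (c + t * I) := by
      intro c hc
      funext t
      refine Function.update_of_ne (fun h => hc ?_) _ _
      simpa using congrArg re h
    have hHdec : DecaysInStrip a b H := hdec.sub ((decaysInStrip_poleKernel a b d p).const_mul _)
    have hdiff : ∀ s : ℂ, a ≤ s.re → s.re ≤ b → s ∉ insert p S → DifferentiableAt ℂ H s := by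
      intro s h1 h2 h3
      exact (hd s h1 h2 h3).sub ((hker s h1 h2 (fun h => h3 (by simp [h]))).const_mul _)
    have hlim : Tendsto (fun s => (s - p) * H s) (𝓝[≠] p) (𝓝 0) := by
      have h1 := hr p (Finset.mem_insert_self _ _)
      have h2 : Tendsto (fun s => r p * (1 - (s - p) * (s - p - d)⁻¹)) (𝓝[≠] p)
          (𝓝 (r p * (1 - (p - p) * (p - p - d)⁻¹))) := by
        refine tendsto_nhdsWithin_of_tendsto_nhds (ContinuousAt.tendsto ?_)
        have : (p - p - d : ℂ) ≠ 0 := by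
          intro h
          have := congrArg re h
          simp at this
          linarith
        have := (show ContinuousAt (fun s : ℂ => s - p - d) p by fun_prop).inv₀ this
        fun_prop
      have h3 := h1.sub h2
      simp only [sub_self, zero_mul, sub_zero, mul_one] at h3
      refine h3.congr' ?_
      filter_upwards [self_mem_nhdsWithin] with s hs
      have : s - p ≠ 0 := sub_ne_zero.2 hs
      simp only [hH, poleKernel]
      field_simp
    have hdiff' : ∀ s : ℂ, a ≤ s.re → s.re ≤ b → s ∉ S → DifferentiableAt ℂ H' s := by
      intro s h1 h2 h3
      by_cases hsp : s = p
      · subst hsp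
        have hU : {z : ℂ | a < z.re ∧ z.re < b ∧ z ∉ S} ∈ 𝓝 s := by
          refine IsOpen.mem_nhds ?_ ⟨hpS.1, hpS.2, h3⟩
          exact (isOpen_lt continuous_const continuous_re).inter
            ((isOpen_lt continuous_re continuous_const).inter S.finite_toSet.isClosed.isOpen_compl)
        refine (Complex.differentiableOn_update_limUnder_of_isLittleO hU ?_ ?_).differentiableAt hU
        · rintro z ⟨⟨z1, z2, z3⟩, z4⟩
          exact (hdiff z z1.le z2.le (by simp_all)).differentiableWithinAt
        · rw [Asymptotics.isLittleO_iff_tendsto']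
          · have h4 : Tendsto (fun z => (z - s) * H s) (𝓝[≠] s) (𝓝 ((s - s) * H s)) :=
              tendsto_nhdsWithin_of_tendsto_nhds (ContinuousAt.tendsto (by fun_prop))
            have h5 := hlim.sub h4
            simp only [sub_self, zero_mul] at h5
            refine h5.congr fun z => ?_
            rw [div_inv_eq_mul]; ring
          · filter_upwards [self_mem_nhdsWithin] with z hz h0
            exact absurd (inv_eq_zero.1 h0) (sub_ne_zero.2 hz)
      · refine (hdiff s h1 h2 (by simp [hsp, h3])).congr_of_eventuallyEq ?_
        filter_upwards [isOpen_ne.mem_nhds hsp] with z hz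
        exact Function.update_of_ne hz _ _
    have hdec' : DecaysInStrip a b H' := by
      intro ε hε
      obtain ⟨T, hT⟩ := hHdec ε hε
      refine ⟨max T (|p.im| + 1), fun s h1 h2 h3 => ?_⟩
      have : s ≠ p := by
        rintro rfl
        have := (le_max_right _ _).trans h3
        linarith
      rw [hH', Function.update_of_ne this]
      exact hT s h1 h2 ((le_max_left _ _).trans h3)
    have ka := integrable_poleKernel (d := d) (p := p) (c := a) (by linarith [hpS.1])
      (by linarith [hpS.1])
    have kb := integrable_poleKernel (d := d) (p := p) (c := b) (by linarith [hpS.2])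
      (by linarith [hpS.1])
    have ih' := ih (G := H') (fun q hq => hS q (Finset.mem_insert_of_mem hq)) hdiff'
      (fun q hq => by
        have hqp : q ≠ p := by rintro rfl; exact hp hq
        have h1 := hr q (Finset.mem_insert_of_mem hq)
        have h2 : Tendsto (fun s => (s - q) * (r p * poleKernel d p s)) (𝓝[≠] q)
            (𝓝 ((q - q) * (r p * poleKernel d p q))) := by
          refine tendsto_nhdsWithin_of_tendsto_nhds (ContinuousAt.tendsto ?_)
          have hq' := hS q (Finset.mem_insert_of_mem hq)
          have := (hker q hq'.1.le hq'.2.le hqp).continuousAt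
          fun_prop
        have h3 := h1.sub h2
        simp only [sub_self, zero_mul, sub_zero] at h3
        refine h3.congr' ?_
        filter_upwards [nhdsWithin_le_nhds (isOpen_ne.mem_nhds hqp)] with s hs
        rw [hH', Function.update_of_ne hs]
        ring)
      hdec'
      (by rw [eqv a hpS.1.ne]; exact ha.sub (ka.const_mul _))
      (by rw [eqv b hpS.2.ne']; exact hb.sub (kb.const_mul _))
    rw [eqv a hpS.1.ne, eqv b hpS.2.ne', integral_sub ha (ka.const_mul _),
      integral_sub hb (kb.const_mul _), integral_const_mul, integral_const_mul,
      integral_poleKernel (by linarith [hpS.1]) (by linarith [hpS.1]),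
      integral_poleKernel (by linarith [hpS.2]) (by linarith [hpS.1])] at ih'
    rw [Finset.sum_insert hp]
    have e1 : |a - p.re| / (a - p.re) = -1 := by
      rw [abs_of_neg (by linarith [hpS.1]), neg_div, div_self (by linarith [hpS.1])]
    have e2 : |b - p.re| / (b - p.re) = 1 := by
      rw [abs_of_pos (by linarith [hpS.2]), div_self (by linarith [hpS.2])]
    have e3 : |a - p.re - d| / (a - p.re - d) = -1 := by
      rw [abs_of_neg (by linarith [hpS.1]), neg_div, div_self (by linarith [hpS.1])]
    have e4 : |b - p.re - d| / (b - p.re - d) = -1 := by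
      rw [abs_of_neg (by linarith [hpS.1]), neg_div, div_self (by linarith [hpS.1])]
    rw [e1, e2, e3, e4] at ih'
    push_cast at ih'
    linear_combination ih'

end ContourShift

/-! ### Growth of the Gamma function on vertical strips -/

section GammaGrowth

open Complex

lemma norm_betaIntegral_le {u v : ℂ} (hu : 0 < u.re) (hv : 0 < v.re) :
    ‖betaIntegral u v‖ ≤ ProbabilityTheory.beta u.re v.re := by
  have hnorm : ∀ x ∈ Ioo (0 : ℝ) 1, ‖(x : ℂ) ^ (u - 1) * (1 - (x : ℂ)) ^ (v - 1)‖ =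
      x ^ (u.re - 1) * (1 - x) ^ (v.re - 1) := by
    intro x hx
    have h1 : (0 : ℝ) < 1 - x := by linarith [hx.2]
    rw [norm_mul, ← ofReal_one, ← ofReal_sub, norm_cpow_eq_rpow_re_of_pos hx.1,
      norm_cpow_eq_rpow_re_of_pos h1]
    simp
  have hreal : ∀ x ∈ Ioo (0 : ℝ) 1,
      (x : ℂ) ^ ((u.re : ℂ) - 1) * (1 - (x : ℂ)) ^ ((v.re : ℂ) - 1) =
      ((x ^ (u.re - 1) * (1 - x) ^ (v.re - 1) : ℝ) : ℂ) := by
    intro x hx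
    have h1 : (0 : ℝ) ≤ 1 - x := by linarith [hx.2]
    rw [ofReal_mul, ofReal_cpow hx.1.le, ofReal_cpow h1]
    push_cast; rfl
  rw [ProbabilityTheory.beta_eq_betaIntegralReal _ _ hu hv]
  unfold betaIntegral
  refine (intervalIntegral.norm_integral_le_integral_norm zero_le_one).trans (le_of_eq ?_)
  simp only [intervalIntegral.integral_of_le zero_le_one, integral_Ioc_eq_integral_Ioo]
  rw [setIntegral_congr_fun measurableSet_Ioo hnorm, setIntegral_congr_fun measurableSet_Ioo hreal,
    integral_complex_ofReal, ofReal_re]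

/-- On the right half-plane `‖Γ(σ + it)‖ / Γ(σ)` increases with `σ`. -/
lemma norm_Gamma_mul_Gamma_le {a b : ℝ} (ha : 0 < a) (hab : a ≤ b) (t : ℝ) :
    ‖Gamma (a + t * I)‖ * Real.Gamma b ≤ Real.Gamma a * ‖Gamma (b + t * I)‖ := by
  rcases hab.eq_or_lt with rfl | hab
  · rw [mul_comm]
  have hba : 0 < b - a := sub_pos.2 hab
  have h := Gamma_mul_Gamma_eq_betaIntegral (s := a + t * I) (t := ((b - a : ℝ) : ℂ))
    (by simpa using ha) (by simpa using hba)
  rw [show (a : ℂ) + t * I + ((b - a : ℝ) : ℂ) = b + t * I by push_cast; ring, Gamma_ofReal] at h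
  have hB := norm_betaIntegral_le (u := a + t * I) (v := ((b - a : ℝ) : ℂ))
    (by simpa using ha) (by simpa using hba)
  have hre : ((a : ℂ) + t * I).re = a := by simp
  rw [hre, ofReal_re, ProbabilityTheory.beta, add_sub_cancel] at hB
  have hg := Real.Gamma_pos_of_pos hba
  have hgb := Real.Gamma_pos_of_pos (ha.trans hab)
  have hn := congrArg norm h
  rw [norm_mul, norm_mul, norm_real, Real.norm_of_nonneg hg.le] at hn
  rw [le_div_iff₀ hgb] at hB
  refine le_of_mul_le_mul_right ?_ hg
  calc ‖Gamma (a + t * I)‖ * Real.Gamma b * Real.Gamma (b - a)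
      = ‖Gamma (b + t * I)‖ * (‖betaIntegral (a + t * I) ((b - a : ℝ) : ℂ)‖ * Real.Gamma b) := by
        linear_combination Real.Gamma b * hn
    _ ≤ ‖Gamma (b + t * I)‖ * (Real.Gamma a * Real.Gamma (b - a)) := by gcongr
    _ = _ := by ring

lemma sq_norm_Gamma_one_add (t : ℝ) (ht : t ≠ 0) :
    ‖Gamma (1 + t * I)‖ ^ 2 = Real.pi * |t| / Real.sinh (Real.pi * |t|) := by
  have h0 : (t : ℂ) * I ≠ 0 := mul_ne_zero (ofReal_ne_zero.2 ht) I_ne_zero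
  have hc : Gamma (1 - t * I) = (starRingEnd ℂ) (Gamma (1 + t * I)) := by
    rw [← Gamma_conj]; simp [sub_eq_add_neg]
  have h1 : ‖Gamma (1 + t * I)‖ ^ 2 = ‖(t * I) * (Gamma (t * I) * Gamma (1 - t * I))‖ := by
    rw [← mul_assoc, ← Gamma_add_one _ h0, hc, norm_mul, norm_conj, add_comm, sq]
  rw [h1, Gamma_mul_Gamma_one_sub, ← mul_assoc, sin_mul_I, ← ofReal_mul, ← ofReal_sinh]
  simp only [norm_mul, norm_div, norm_real, norm_I, mul_one, Real.norm_eq_abs,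
    abs_of_pos Real.pi_pos, Real.abs_sinh, abs_mul]
  ring

/-- Exact exponential decay of `Γ` on the line `re s = 1`, from the explicit value of
`‖Γ(1 + it)‖²` given by the reflection formula. -/
lemma norm_Gamma_one_add_le {t : ℝ} (ht : 1 ≤ |t|) :
    ‖Gamma (1 + t * I)‖ ≤ 4 * |t| * Real.exp (-(Real.pi / 2) * |t|) ∧
      Real.exp (-(Real.pi / 2) * |t|) ≤ ‖Gamma (1 + t * I)‖ := by
  have h := sq_norm_Gamma_one_add t (by rintro rfl; norm_num at ht)
  set u := |t|
  have hpi := Real.pi_gt_three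
  have hpi4 := Real.pi_lt_four
  have hE : Real.exp (-(Real.pi / 2) * u) ^ 2 = (Real.exp (Real.pi * u))⁻¹ := by
    rw [← Real.exp_nat_mul, ← Real.exp_neg]; congr 1; push_cast; ring
  have hpos := Real.exp_pos (Real.pi * u)
  have hs : Real.sinh (Real.pi * u) = (Real.exp (Real.pi * u) - Real.exp (-(Real.pi * u))) / 2 :=
    Real.sinh_eq _
  have hlarge : 2 ≤ Real.exp (Real.pi * u) := by
    have := Real.add_one_le_exp (Real.pi * u); nlinarith
  have hneg : Real.exp (-(Real.pi * u)) ≤ Real.exp (Real.pi * u) / 2 := by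
    have : Real.exp (-(Real.pi * u)) ≤ 1 := Real.exp_le_one_iff.2 (by nlinarith)
    linarith
  have hneg0 := Real.exp_pos (-(Real.pi * u))
  constructor
  · refine le_of_sq_le_sq ?_ (by positivity)
    rw [h, mul_pow, hE, ← div_eq_mul_inv]
    calc Real.pi * u / Real.sinh (Real.pi * u) ≤ Real.pi * u / (Real.exp (Real.pi * u) / 4) := by
          gcongr; linarith
      _ = (4 * Real.pi * u) / Real.exp (Real.pi * u) := by field_simp
      _ ≤ _ := by gcongr; nlinarith
  · refine le_of_sq_le_sq ?_ (by positivity)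
    rw [h, hE, le_div_iff₀ (by linarith), inv_mul_le_iff₀ hpos]
    have h1 : 1 ≤ Real.pi * u := by nlinarith
    have := le_mul_of_one_le_right hpos.le h1
    linarith

/-- `Γ` is of exact exponential type `-π/2` in the strip `A ≤ re s ≤ B`, up to powers. -/
def GammaBand (A B : ℝ) : Prop :=
  ∃ C : ℝ, ∃ M : ℕ, 0 ≤ C ∧ ∀ s : ℂ, A ≤ s.re → s.re ≤ B → 1 ≤ |s.im| →
    ‖Gamma s‖ ≤ C * |s.im| ^ M * Real.exp (-(Real.pi / 2) * |s.im|) ∧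
    ‖(Gamma s)⁻¹‖ ≤ C * |s.im| ^ M * Real.exp (Real.pi / 2 * |s.im|)

/-- By monotonicity of `‖Γ(σ + it)‖ / Γ(σ)` in `σ`, the lines `re s = 1` and `re s = 2` control the
strip between them. -/
lemma gammaBand_one_two : GammaBand 1 2 := by
  have hcont : ContinuousOn Real.Gamma (Icc 1 2) := fun x hx =>
    (Real.differentiableAt_Gamma fun m => by
      have := hx.1; have : (0 : ℝ) ≤ m := m.cast_nonneg; linarith).continuousAt.continuousWithinAt
  obtain ⟨p, hp, hpm⟩ := isCompact_Icc.exists_isMinOn (nonempty_Icc.2 one_le_two) hcont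
  obtain ⟨q, hq, hqm⟩ := isCompact_Icc.exists_isMaxOn (nonempty_Icc.2 one_le_two) hcont
  have hp0 : 0 < Real.Gamma p := Real.Gamma_pos_of_pos (by linarith [hp.1])
  have hq0 : 0 < Real.Gamma q := Real.Gamma_pos_of_pos (by linarith [hq.1])
  refine ⟨8 * Real.Gamma q + (Real.Gamma p)⁻¹, 2, by positivity, fun s h1 h2 h3 => ?_⟩
  have hs : s = s.re + s.im * I := (re_add_im s).symm
  have hmax : Real.Gamma s.re ≤ Real.Gamma q := hqm ⟨h1, h2⟩
  have hmin : Real.Gamma p ≤ Real.Gamma s.re := hpm ⟨h1, h2⟩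
  obtain ⟨hu, hl⟩ := norm_Gamma_one_add_le h3
  have m1 := norm_Gamma_mul_Gamma_le (by linarith : 0 < s.re) h2 s.im
  have m2 := norm_Gamma_mul_Gamma_le one_pos h1 s.im
  rw [← hs, Real.Gamma_two, mul_one] at m1
  rw [← hs, Real.Gamma_one, one_mul, ofReal_one] at m2
  have h0 : (1 : ℂ) + s.im * I ≠ 0 := by
    intro h; have := congrArg re h; simp at this
  have two : ‖Gamma ((2 : ℝ) + s.im * I)‖ ≤ 2 * |s.im| * ‖Gamma (1 + s.im * I)‖ := by
    rw [show (((2 : ℝ) : ℂ) + s.im * I) = (1 + s.im * I) + 1 by push_cast; ring,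
      Gamma_add_one _ h0, norm_mul]
    gcongr
    refine (norm_add_le _ _).trans ?_
    simp only [norm_one, norm_mul, norm_real, Real.norm_eq_abs, norm_I, mul_one]
    linarith
  have hg0 : 0 < Real.Gamma s.re := hp0.trans_le hmin
  have hexp := Real.exp_pos (-(Real.pi / 2) * |s.im|)
  constructor
  · calc ‖Gamma s‖ ≤ Real.Gamma q * (2 * |s.im| *
          (4 * |s.im| * Real.exp (-(Real.pi / 2) * |s.im|))) := by
          refine m1.trans (mul_le_mul hmax (two.trans ?_) (norm_nonneg _) hq0.le)
          gcongr
      _ = (8 * Real.Gamma q) * |s.im| ^ 2 * Real.exp (-(Real.pi / 2) * |s.im|) := by ring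
      _ ≤ _ := by gcongr; linarith [inv_pos.2 hp0]
  · have low : Real.Gamma p * Real.exp (-(Real.pi / 2) * |s.im|) ≤ ‖Gamma s‖ := by
      calc _ ≤ Real.Gamma s.re * ‖Gamma (1 + s.im * I)‖ := by gcongr
        _ ≤ _ := by rw [mul_comm]; exact m2
    rw [norm_inv]
    calc ‖Gamma s‖⁻¹ ≤ (Real.Gamma p * Real.exp (-(Real.pi / 2) * |s.im|))⁻¹ := by gcongr
      _ = (Real.Gamma p)⁻¹ * 1 * Real.exp (Real.pi / 2 * |s.im|) := by
        rw [mul_inv, ← Real.exp_neg, mul_one]; congr 2; ring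
      _ ≤ _ := by
        gcongr
        · linarith
        · exact one_le_pow₀ h3

/-- The functional equation `Γ(s + 1) = s Γ(s)` widens the strip by one unit on both sides. -/
lemma GammaBand.enlarge {A B : ℝ} (hAB : A + 1 ≤ B) (h : GammaBand A B) :
    GammaBand (A - 1) (B + 1) := by
  obtain ⟨C, M, hC, h⟩ := h
  set K : ℝ := |A| + |B| + 3 with hK
  have hA := abs_nonneg A
  have hB := abs_nonneg B
  refine ⟨C * K + C, M + 1, by positivity, fun s h1 h2 h3 => ?_⟩
  have hsK : ∀ z : ℂ, A - 1 ≤ z.re → z.re ≤ B + 1 → 1 ≤ |z.im| → ‖z‖ ≤ K * |z.im| := by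
    intro z z1 z2 z3
    have : |z.re| ≤ |A| + |B| + 1 := by
      rw [abs_le]; constructor <;> linarith [neg_abs_le A, le_abs_self B]
    have := norm_le_abs_re_add_abs_im z
    nlinarith
  have hpow : |s.im| ^ M ≤ |s.im| ^ (M + 1) := pow_le_pow_right₀ h3 (Nat.le_succ M)
  have e1 := Real.exp_pos (-(Real.pi / 2) * |s.im|)
  have e2 := Real.exp_pos (Real.pi / 2 * |s.im|)
  have hu : 0 < |s.im| := by linarith
  have hCK : 0 ≤ C * K := by positivity
  have easy : ∀ x y : ℝ, 0 < y → x ≤ C * |s.im| ^ M * y →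
      x ≤ (C * K + C) * |s.im| ^ (M + 1) * y := by
    intro x y hy hx
    refine hx.trans ?_
    gcongr
    linarith
  have hard : ∀ x y : ℝ, 0 < y → x ≤ K * |s.im| * (C * |s.im| ^ M * y) →
      x ≤ (C * K + C) * |s.im| ^ (M + 1) * y := by
    intro x y hy hx
    refine hx.trans ?_
    calc K * |s.im| * (C * |s.im| ^ M * y) = (C * K) * |s.im| ^ (M + 1) * y := by ring
      _ ≤ _ := by gcongr; linarith
  rcases lt_or_ge s.re A with hlt | hge
  · have hs0 : s ≠ 0 := by rintro rfl; norm_num at h3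
    obtain ⟨b1, b2⟩ := h (s + 1) (by simp; linarith) (by simp; linarith) (by simpa using h3)
    simp only [add_im, one_im, add_zero] at b1 b2
    rw [Gamma_add_one s hs0] at b1 b2
    have hs1 : 1 ≤ ‖s‖ := h3.trans (abs_im_le_norm s)
    constructor
    · refine easy _ _ e1 (le_trans ?_ b1)
      rw [norm_mul]
      exact le_mul_of_one_le_left (norm_nonneg _) hs1
    · refine hard _ _ e2 ?_
      rw [show (Gamma s)⁻¹ = s * (s * Gamma s)⁻¹ by rw [mul_inv, mul_inv_cancel_left₀ hs0],
        norm_mul]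
      exact mul_le_mul (hsK s h1 h2 h3) b2 (norm_nonneg _) (by positivity)
  · rcases le_or_gt s.re B with hle | hgt
    · obtain ⟨b1, b2⟩ := h s hge hle h3
      exact ⟨easy _ _ e1 b1, easy _ _ e2 b2⟩
    · have him : (s - 1).im = s.im := by simp
      have h3' : 1 ≤ |(s - 1).im| := by rwa [him]
      have hs0 : s - 1 ≠ 0 := by intro h0; rw [h0] at h3'; norm_num at h3'
      obtain ⟨b1, b2⟩ := h (s - 1) (by simp; linarith) (by simp; linarith) h3'
      rw [him] at b1 b2
      have hG : Gamma s = (s - 1) * Gamma (s - 1) := by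
        rw [← Gamma_add_one _ hs0, sub_add_cancel]
      have hs1 : 1 ≤ ‖s - 1‖ := h3'.trans (abs_im_le_norm _)
      have hsK' := hsK (s - 1) (by simp; linarith) (by simp; linarith) h3'
      rw [him] at hsK'
      rw [hG]
      constructor
      · refine hard _ _ e1 ?_
        rw [norm_mul]
        exact mul_le_mul hsK' b1 (norm_nonneg _) (by positivity)
      · refine easy _ _ e2 (le_trans ?_ b2)
        rw [norm_inv, norm_inv, norm_mul]
        refine inv_anti₀ ?_ (le_mul_of_one_le_left (norm_nonneg _) hs1)
        exact norm_pos_iff.2 (Gamma_ne_zero fun m hm => by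
          rw [hm] at h3'; simp at h3'; norm_num at h3')

lemma gammaBand (A B : ℝ) : GammaBand A B := by
  have key : ∀ n : ℕ, GammaBand (1 - n) (2 + n) := by
    intro n
    induction n with
    | zero => simpa using gammaBand_one_two
    | succ n ih =>
      have := ih.enlarge (by have : (0 : ℝ) ≤ n := n.cast_nonneg; linarith)
      convert this using 1 <;> (push_cast; ring)
  obtain ⟨n, hn⟩ := exists_nat_ge (|A| + |B| + 1)
  obtain ⟨C, M, hC, h⟩ := key n
  refine ⟨C, M, hC, fun s h1 h2 h3 => h s ?_ ?_ h3⟩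
  · linarith [neg_abs_le A, abs_nonneg B]
  · linarith [le_abs_self B, abs_nonneg A]

/-- `f` grows in every vertical strip at most like a power of `|im s|` times `exp (e |im s|)`. -/
def StripGrowth (e : ℝ) (f : ℂ → ℂ) : Prop :=
  ∀ A B : ℝ, ∃ C : ℝ, ∃ M : ℕ, ∃ T : ℝ, 0 ≤ C ∧ 1 ≤ T ∧
    ∀ s : ℂ, A ≤ s.re → s.re ≤ B → T ≤ |s.im| →
      ‖f s‖ ≤ C * |s.im| ^ M * Real.exp (e * |s.im|)

lemma stripGrowth_Gamma : StripGrowth (-(Real.pi / 2)) Gamma := fun A B =>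
  let ⟨C, M, hC, h⟩ := gammaBand A B
  ⟨C, M, 1, hC, le_rfl, fun s h1 h2 h3 => (h s h1 h2 h3).1⟩

lemma stripGrowth_Gamma_inv : StripGrowth (Real.pi / 2) fun s => (Gamma s)⁻¹ := fun A B =>
  let ⟨C, M, hC, h⟩ := gammaBand A B
  ⟨C, M, 1, hC, le_rfl, fun s h1 h2 h3 => (h s h1 h2 h3).2⟩

lemma StripGrowth.mul {e e' : ℝ} {f g : ℂ → ℂ} (hf : StripGrowth e f) (hg : StripGrowth e' g) :
    StripGrowth (e + e') fun s => f s * g s := by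
  intro A B
  obtain ⟨C, M, T, hC, hT, h⟩ := hf A B
  obtain ⟨C', M', T', hC', hT', h'⟩ := hg A B
  refine ⟨C * C', M + M', max T T', by positivity, hT.trans (le_max_left _ _),
    fun s h1 h2 h3 => ?_⟩
  rw [norm_mul]
  have a1 := h s h1 h2 ((le_max_left _ _).trans h3)
  have a2 := h' s h1 h2 ((le_max_right _ _).trans h3)
  calc _ ≤ (C * |s.im| ^ M * Real.exp (e * |s.im|)) * (C' * |s.im| ^ M' * Real.exp (e' * |s.im|)) :=
        mul_le_mul a1 a2 (norm_nonneg _) (by positivity)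
    _ = _ := by rw [add_mul, Real.exp_add]; ring

lemma StripGrowth.comp_add {e : ℝ} {f : ℂ → ℂ} (hf : StripGrowth e f) (w : ℂ) :
    StripGrowth e fun s => f (s + w) := by
  intro A B
  obtain ⟨C, M, T, hC, hT, h⟩ := hf (A + w.re) (B + w.re)
  refine ⟨C * 2 ^ M * Real.exp (|e| * |w.im|), M, T + |w.im|, by positivity,
    by linarith [abs_nonneg w.im], fun s h1 h2 h3 => ?_⟩
  have a1 : |s.im| - |w.im| ≤ |(s + w).im| := by
    rw [add_im]
    have := abs_sub_abs_le_abs_sub s.im (-w.im)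
    rwa [abs_neg, sub_neg_eq_add] at this
  have a2 : |(s + w).im| ≤ |s.im| + |w.im| := by rw [add_im]; exact abs_add_le _ _
  refine (h (s + w) (by simpa using h1) (by simpa using h2) (by linarith)).trans ?_
  have b1 : |(s + w).im| ≤ 2 * |s.im| := by linarith
  have b2 : e * |(s + w).im| ≤ |e| * |w.im| + e * |s.im| := by
    have : e * (|(s + w).im| - |s.im|) ≤ |e| * |w.im| := by
      refine (le_abs_self _).trans ?_
      rw [abs_mul]
      refine mul_le_mul_of_nonneg_left ?_ (abs_nonneg e)
      rw [abs_le]; constructor <;> linarith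
    linarith
  calc C * |(s + w).im| ^ M * Real.exp (e * |(s + w).im|)
      ≤ C * (2 * |s.im|) ^ M * Real.exp (|e| * |w.im| + e * |s.im|) := by gcongr
    _ = _ := by rw [Real.exp_add, mul_pow]; ring

lemma StripGrowth.comp_sub {e : ℝ} {f : ℂ → ℂ} (hf : StripGrowth e f) (w : ℂ) :
    StripGrowth e fun s => f (w - s) := by
  intro A B
  obtain ⟨C, M, T, hC, hT, h⟩ := hf.comp_add w (-B) (-A)
  refine ⟨C, M, T, hC, hT, fun s h1 h2 h3 => ?_⟩
  have := h (-s) (by simpa using h2) (by simpa using h1) (by simpa using h3)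
  simpa only [neg_add_eq_sub, neg_im, abs_neg] using this

lemma stripGrowth_const (c : ℂ) : StripGrowth 0 fun _ => c := fun _ _ =>
  ⟨‖c‖, 0, 1, norm_nonneg _, le_rfl, fun s _ _ _ => by simp⟩

lemma stripGrowth_cpow {x : ℝ} (hx : 0 < x) : StripGrowth 0 fun s => (x : ℂ) ^ (-s) := by
  intro A B
  refine ⟨x ^ (-A) + x ^ (-B), 0, 1, by positivity, le_rfl, fun s h1 h2 _ => ?_⟩
  rw [norm_cpow_eq_rpow_re_of_pos hx, neg_re]
  have p1 := Real.rpow_pos_of_pos hx (-A)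
  have p2 := Real.rpow_pos_of_pos hx (-B)
  simp only [pow_zero, mul_one, zero_mul, Real.exp_zero]
  rcases le_total 1 x with h | h
  · have := Real.rpow_le_rpow_of_exponent_le h (neg_le_neg h1); linarith
  · have := Real.rpow_le_rpow_of_exponent_ge hx h (neg_le_neg h2); linarith

/-- Negative exponential type beats every power: there is a bound by `(1 + t²)⁻¹`. -/
lemma StripGrowth.exists_le_inv_one_add_sq {e : ℝ} (he : e < 0) {f : ℂ → ℂ} (hf : StripGrowth e f)
    (A B : ℝ) : ∃ C T : ℝ, 0 ≤ C ∧ ∀ s : ℂ, A ≤ s.re → s.re ≤ B → T ≤ |s.im| →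
      ‖f s‖ ≤ C * (1 + s.im ^ 2)⁻¹ := by
  obtain ⟨C, M, T, hC, hT, h⟩ := hf A B
  have lim : Tendsto (fun u : ℝ => (1 + u ^ 2) * (u ^ M * Real.exp (e * u))) atTop (𝓝 0) := by
    have l := fun n : ℕ => tendsto_rpow_mul_exp_neg_mul_atTop_nhds_zero n (-e) (neg_pos.2 he)
    simp only [neg_neg, Real.rpow_natCast] at l
    have := (l M).add (l (M + 2))
    rw [add_zero] at this
    refine this.congr fun u => by ring
  obtain ⟨R, hR⟩ := (lim.eventually (ge_mem_nhds zero_lt_one)).exists_forall_of_atTop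
  refine ⟨C, max T R, hC, fun s h1 h2 h3 => ?_⟩
  refine (h s h1 h2 ((le_max_left _ _).trans h3)).trans ?_
  rw [mul_assoc]
  gcongr
  have := hR |s.im| ((le_max_right _ _).trans h3)
  rw [sq_abs] at this
  rw [← one_div, le_div_iff₀ (by positivity), mul_comm]
  exact this

lemma StripGrowth.decaysInStrip {e : ℝ} (he : e < 0) {f : ℂ → ℂ} (hf : StripGrowth e f)
    (a b : ℝ) : DecaysInStrip a b f := by
  intro ε hε
  obtain ⟨C, T, hC, h⟩ := hf.exists_le_inv_one_add_sq he a b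
  refine ⟨max T (1 + C / ε), fun s h1 h2 h3 => ?_⟩
  refine (h s h1 h2 ((le_max_left _ _).trans h3)).trans ?_
  have h4 : 1 + C / ε ≤ |s.im| := (le_max_right _ _).trans h3
  have h5 : 0 ≤ C / ε := by positivity
  rw [← div_eq_mul_inv, div_le_iff₀ (by positivity), ← sq_abs]
  have h6 : C ≤ ε * |s.im| := by
    have : C / ε ≤ |s.im| := by linarith
    rwa [div_le_iff₀ hε, mul_comm] at this
  nlinarith

lemma StripGrowth.integrable_vertical {e : ℝ} (he : e < 0) {f : ℂ → ℂ} (hf : StripGrowth e f)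
    {c : ℝ} (hc : Continuous fun t : ℝ => f (c + t * I)) :
    Integrable fun t : ℝ => f (c + t * I) := by
  obtain ⟨C, T, hC, h⟩ := hf.exists_le_inv_one_add_sq he c c
  refine hc.locallyIntegrable.integrable_of_isBigO_cocompact (g := fun t : ℝ => (1 + t ^ 2)⁻¹) ?_
    (integrable_inv_one_add_sq.integrableAtFilter _)
  refine Asymptotics.IsBigO.of_bound C ?_
  have : ∀ᶠ t : ℝ in cocompact ℝ, T ≤ ‖t‖ := tendsto_norm_cocompact_atTop.eventually_ge_atTop T
  filter_upwards [this] with t ht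
  rw [Real.norm_of_nonneg (by positivity : 0 ≤ (1 + t ^ 2)⁻¹)]
  simpa using h (c + t * I) (by simp) (by simp) (by simpa using ht)

end GammaGrowth

/-! ### Mellin transforms -/

section MellinTools

open Complex

lemma cpow_neg_vertical {x : ℝ} (hx : 0 < x) (σ t : ℝ) :
    (x : ℂ) ^ (-((σ : ℂ) + t * I)) = ((x ^ (-σ) : ℝ) : ℂ) * exp ((-(t * Real.log x) : ℝ) * I) := by
  rw [ofReal_cpow hx.le, neg_add, cpow_add _ _ (ofReal_ne_zero.2 hx.ne'), ofReal_neg]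
  congr 1
  rw [cpow_def_of_ne_zero (ofReal_ne_zero.2 hx.ne'), ← ofReal_log hx.le]
  congr 1
  push_cast; ring

lemma mellinInv_eq_rpow_mul {Ψ : ℂ → ℂ} {σ x : ℝ} (hx : 0 < x) :
    mellinInv σ Ψ x = ((1 / (2 * Real.pi) * x ^ (-σ) : ℝ) : ℂ) *
      ∫ t : ℝ, exp ((-(t * Real.log x) : ℝ) * I) * Ψ (σ + t * I) := by
  simp_rw [mellinInv, cpow_neg_vertical hx, smul_eq_mul, mul_assoc]
  rw [integral_const_mul]
  simp only [real_smul]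
  push_cast; ring

lemma norm_mellinInv_le (Ψ : ℂ → ℂ) (σ : ℝ) {x : ℝ} (hx : 0 < x) :
    ‖mellinInv σ Ψ x‖ ≤ 1 / (2 * Real.pi) * (∫ t : ℝ, ‖Ψ (σ + t * I)‖) * x ^ (-σ) := by
  have hpi := Real.pi_pos
  rw [mellinInv_eq_rpow_mul hx, norm_mul, norm_real, Real.norm_of_nonneg (by positivity),
    mul_right_comm]
  gcongr
  refine (norm_integral_le_integral_norm _).trans (le_of_eq ?_)
  simp_rw [norm_mul, norm_exp_ofReal_mul_I, one_mul]

lemma continuousOn_mellinInv {Ψ : ℂ → ℂ} {σ : ℝ}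
    (hΨ : Integrable fun t : ℝ => Ψ (σ + t * I)) : ContinuousOn (mellinInv σ Ψ) (Ioi 0) := by
  have h1 : Continuous fun L : ℝ => ∫ t : ℝ, exp ((-(t * L) : ℝ) * I) * Ψ (σ + t * I) := by
    refine continuous_of_dominated (bound := fun t => ‖Ψ (σ + t * I)‖) (fun L => ?_) (fun L => ?_)
      hΨ.norm (Eventually.of_forall fun t => by fun_prop)
    · exact (Continuous.aestronglyMeasurable (by fun_prop)).mul hΨ.aestronglyMeasurable
    · refine Eventually.of_forall fun t => ?_
      rw [norm_mul, norm_exp_ofReal_mul_I, one_mul]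
  have h2 : ContinuousOn (fun x : ℝ => ((1 / (2 * Real.pi) * x ^ (-σ) : ℝ) : ℂ) *
      ∫ t : ℝ, exp ((-(t * Real.log x) : ℝ) * I) * Ψ (σ + t * I)) (Ioi 0) := by
    refine ContinuousOn.mul ?_ ?_
    · refine continuous_ofReal.comp_continuousOn (continuousOn_const.mul ?_)
      exact continuousOn_id.rpow_const fun x hx => Or.inl (ne_of_gt hx)
    · exact h1.comp_continuousOn (Real.continuousOn_log.mono fun x hx => ne_of_gt hx)
  exact h2.congr fun x hx => mellinInv_eq_rpow_mul hx

/-- Parseval's formula in the form that only needs Fubini's theorem. -/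
theorem integral_mul_mellinInv {h : ℝ → ℂ} {Ψ : ℂ → ℂ} {σ : ℝ}
    (hh : IntegrableOn (fun x : ℝ => ((x ^ (-σ) : ℝ) : ℂ) * h x) (Ioi 0))
    (hΨ : Integrable fun t : ℝ => Ψ (σ + t * I)) :
    IntegrableOn (fun x : ℝ => h x * mellinInv σ Ψ x) (Ioi 0) ∧
      ∫ x in Ioi (0 : ℝ), h x * mellinInv σ Ψ x =
        (1 / (2 * Real.pi) : ℝ) * ∫ t : ℝ, Ψ (σ + t * I) * mellin h (1 - (σ + t * I)) := by
  set F : ℝ × ℝ → ℂ := fun p => exp ((-(p.2 * Real.log p.1) : ℝ) * I) *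
    ((((p.1 ^ (-σ) : ℝ) : ℂ) * h p.1) * Ψ (σ + p.2 * I)) with hF
  have hFi : Integrable F ((volume.restrict (Ioi 0)).prod volume) := by
    refine (Integrable.mul_prod hh hΨ).bdd_mul (c := 1) ?_ ?_
    · refine Measurable.aestronglyMeasurable ?_
      have : Measurable fun p : ℝ × ℝ => -(p.2 * Real.log p.1) := by fun_prop
      fun_prop
    · exact Eventually.of_forall fun p => (norm_exp_ofReal_mul_I _).le
  have h1 : ∀ x ∈ Ioi (0 : ℝ), h x * mellinInv σ Ψ x =
      ((1 / (2 * Real.pi) : ℝ) : ℂ) * ∫ t : ℝ, F (x, t) := by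
    intro x hx
    rw [mellinInv_eq_rpow_mul hx, ofReal_mul]
    have : ∫ t : ℝ, F (x, t) = ((x ^ (-σ) : ℝ) : ℂ) * h x *
        ∫ t : ℝ, exp ((-(t * Real.log x) : ℝ) * I) * Ψ (σ + t * I) := by
      rw [← integral_const_mul]
      congr 1
      funext t
      simp only [hF]
      ring
    rw [this]
    ring
  constructor
  · exact (hFi.integral_prod_left.const_mul _).congr
      ((ae_restrict_iff' measurableSet_Ioi).2 (Eventually.of_forall fun x hx => (h1 x hx).symm))
  · rw [setIntegral_congr_fun measurableSet_Ioi h1, integral_const_mul, integral_integral_swap hFi]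
    congr 2
    funext t
    rw [mellin, ← integral_const_mul]
    refine setIntegral_congr_fun measurableSet_Ioi fun x hx => ?_
    have e : (1 : ℂ) - (σ + t * I) - 1 = -(σ + t * I) := by ring
    simp only [hF]
    rw [e, cpow_neg_vertical hx, smul_eq_mul]
    ring

open scoped FourierTransform in
/-- The Mellin transform inverts the inverse Mellin transform. -/
theorem mellin_mellinInv {Ψ : ℂ → ℂ} {σ : ℝ} (hc : Continuous fun t : ℝ => Ψ (σ + t * I))
    (hΨ : Integrable fun t : ℝ => Ψ (σ + t * I)) (hconv : MellinConvergent (mellinInv σ Ψ) σ)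
    (t : ℝ) : mellin (mellinInv σ Ψ) (σ + t * I) = Ψ (σ + t * I) := by
  set g : ℝ → ℂ := fun y => Ψ (σ + 2 * Real.pi * y * I) with hg
  have hgΨ : g = fun y : ℝ => Ψ (σ + ((y * (2 * Real.pi) : ℝ) : ℂ) * I) := by
    funext y; simp only [hg]; congr 2; push_cast; ring
  have hgc : Continuous g := by
    rw [hgΨ]; exact hc.comp (continuous_id.mul continuous_const)
  have hgi : Integrable g := by
    rw [hgΨ]; exact hΨ.comp_mul_right' (by positivity)
  have hinv : ∀ u : ℝ, (Real.exp (-σ * u) : ℝ) • mellinInv σ Ψ (Real.exp (-u)) = 𝓕⁻ g u := by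
    intro u
    rw [mellinInv_eq_fourierInv σ Ψ (Real.exp_pos _), Real.log_exp, neg_neg, smul_eq_mul,
      real_smul, ← mul_assoc, ← ofReal_neg, ← ofReal_cpow (Real.exp_pos _).le, ← Real.exp_mul,
      ← ofReal_mul, ← Real.exp_add]
    rw [show -σ * u + -u * -σ = 0 by ring, Real.exp_zero, ofReal_one, one_mul]
  have hgi' : Integrable (𝓕⁻ g) := by
    have hmaps : (fun u : ℝ => Real.exp (-u)) '' univ = Ioi 0 := by
      rw [image_univ]
      ext y
      refine ⟨fun ⟨u, hu⟩ => hu ▸ Real.exp_pos _, fun hy => ⟨-Real.log y, ?_⟩⟩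
      simp [Real.exp_log hy]
    have hd : ∀ u ∈ (univ : Set ℝ), HasDerivWithinAt (fun u : ℝ => Real.exp (-u))
        (-Real.exp (-u)) univ u := fun u _ => by
      have := (hasDerivAt_neg u).exp.hasDerivWithinAt (s := univ)
      rwa [mul_neg_one] at this
    rw [MellinConvergent, ← hmaps, integrableOn_image_iff_integrableOn_abs_deriv_smul
      MeasurableSet.univ hd (fun a _ b _ hab => neg_injective (Real.exp_injective hab)),
      integrableOn_univ] at hconv
    refine hconv.congr (Eventually.of_forall fun u => ?_)
    rw [← hinv u]
    simp only [smul_eq_mul, real_smul, abs_neg, abs_of_pos (Real.exp_pos _)]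
    rw [← mul_assoc, ← ofReal_one, ← ofReal_sub, ← ofReal_cpow (Real.exp_pos _).le, ← Real.exp_mul,
      ← ofReal_mul, ← Real.exp_add]
    congr 3; ring
  have hF : Integrable (𝓕 g) := by
    have := hgi'.comp_neg
    refine this.congr (Eventually.of_forall fun u => ?_)
    simp only [Real.fourierInv_eq_fourier_neg, neg_neg]
  rw [mellin_eq_fourier]
  have hre : ((σ : ℂ) + t * I).re = σ := by simp
  have him : ((σ : ℂ) + t * I).im = t := by simp
  rw [hre, him]
  simp_rw [hinv]
  rw [hgc.fourier_fourierInv_eq hgi hF]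
  simp only [hg]
  congr 2
  push_cast
  field_simp

/-- An inverse Mellin transform does not depend on the line of integration inside a strip of
holomorphy. -/
theorem mellinInv_eq_of_strip {Ψ : ℂ → ℂ} {a b e : ℝ} (he : e < 0) (hg : StripGrowth e Ψ)
    (hd : ∀ s : ℂ, a < s.re → s.re < b → DifferentiableAt ℂ Ψ s) {σ₁ σ₂ : ℝ} (h1 : a < σ₁)
    (h12 : σ₁ ≤ σ₂) (h2 : σ₂ < b) {x : ℝ} (hx : 0 < x) :
    mellinInv σ₁ Ψ x = mellinInv σ₂ Ψ x := by
  have hx0 : (x : ℂ) ≠ 0 := ofReal_ne_zero.2 hx.ne'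
  have hg' : StripGrowth e fun s => (x : ℂ) ^ (-s) * Ψ s := by
    simpa using (stripGrowth_cpow hx).mul hg
  have hd' : ∀ s : ℂ, a < s.re → s.re < b →
      DifferentiableAt ℂ (fun s => (x : ℂ) ^ (-s) * Ψ s) s := fun s h3 h4 =>
    (DifferentiableAt.const_cpow (by fun_prop) (Or.inl hx0)).mul (hd s h3 h4)
  have hcont : ∀ c : ℝ, a < c → c < b →
      Continuous fun t : ℝ => (x : ℂ) ^ (-((c : ℂ) + t * I)) * Ψ (c + t * I) := by
    intro c hc hc'
    refine continuous_iff_continuousAt.2 fun t => ?_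
    exact ContinuousAt.comp (f := fun t : ℝ => (c : ℂ) + t * I)
      (g := fun s : ℂ => (x : ℂ) ^ (-s) * Ψ s)
      (hd' _ (by simpa using hc) (by simpa using hc')).continuousAt (by fun_prop)
  have := integral_vertical_line_eq h12 (H := fun s => (x : ℂ) ^ (-s) * Ψ s)
    (fun s h3 h4 => hd' s (h1.trans_le h3) (h4.trans_lt h2)) (hg'.decaysInStrip he _ _)
    (hg'.integrable_vertical he (hcont _ h1 (h12.trans_lt h2)))
    (hg'.integrable_vertical he (hcont _ (h1.trans_le h12) h2))
  simp only [mellinInv, smul_eq_mul]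
  rw [this]

lemma continuous_vertical {Ψ : ℂ → ℂ} {a b : ℝ}
    (hd : ∀ s : ℂ, a < s.re → s.re < b → DifferentiableAt ℂ Ψ s) {σ : ℝ} (h1 : a < σ)
    (h2 : σ < b) : Continuous fun t : ℝ => Ψ (σ + t * I) :=
  continuous_iff_continuousAt.2 fun t =>
    ContinuousAt.comp (f := fun t : ℝ => (σ : ℂ) + t * I) (g := Ψ)
      (hd _ (by simpa using h1) (by simpa using h2)).continuousAt (by fun_prop)

/-- For a function of negative exponential type in a strip, the Mellin transform of its inverse
Mellin transform converges: moving the line of integration to the right and to the left gives the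
decay at infinity and at zero. -/
theorem mellinConvergent_mellinInv {Ψ : ℂ → ℂ} {a b e : ℝ} (he : e < 0) (hg : StripGrowth e Ψ)
    (hd : ∀ s : ℂ, a < s.re → s.re < b → DifferentiableAt ℂ Ψ s) {σ : ℝ} (h1 : a < σ)
    (h2 : σ < b) : MellinConvergent (mellinInv σ Ψ) σ := by
  obtain ⟨σ₁, ha1, h1'⟩ := exists_between h1
  obtain ⟨σ₂, h2', hb2⟩ := exists_between h2
  refine mellinConvergent_of_isBigO_rpow (a := σ₂) (b := σ₁) ?_ ?_ (by simpa using h2') ?_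
    (by simpa using h1')
  · exact (continuousOn_mellinInv (hg.integrable_vertical he
      (continuous_vertical hd h1 h2))).locallyIntegrableOn measurableSet_Ioi
  · refine Asymptotics.IsBigO.of_bound (1 / (2 * Real.pi) * ∫ t : ℝ, ‖Ψ (σ₂ + t * I)‖) ?_
    filter_upwards [Ioi_mem_atTop 0] with x hx
    rw [mellinInv_eq_of_strip he hg hd h1 h2'.le hb2 hx,
      Real.norm_of_nonneg (Real.rpow_nonneg (le_of_lt hx) _)]
    exact norm_mellinInv_le _ _ hx
  · refine Asymptotics.IsBigO.of_bound (1 / (2 * Real.pi) * ∫ t : ℝ, ‖Ψ (σ₁ + t * I)‖) ?_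
    filter_upwards [self_mem_nhdsWithin] with x hx
    rw [← mellinInv_eq_of_strip he hg hd ha1 h1'.le h2 hx,
      Real.norm_of_nonneg (Real.rpow_nonneg (le_of_lt hx) _)]
    exact norm_mellinInv_le _ _ hx

end MellinTools

/-! ### Products of Bessel series -/

section BesselSeries

open Complex

/-- The common form of the Bessel series: `ε = -1` gives `J_ν`, `ε = 1` gives `I_ν`. -/
noncomputable def besselSeries (ε ν z : ℂ) : ℂ :=
  ∑' k : ℕ, ε ^ k / ((k.factorial : ℂ) * Gamma (k + ν + 1)) * ((z / 2) ^ ν * (z / 2) ^ (2 * k))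

lemma besselJ_eq (ν z : ℂ) : besselJ ν z = besselSeries (-1) ν z := rfl

lemma besselI_eq (ν z : ℂ) : besselI ν z = besselSeries 1 ν z := by
  simp [besselI, besselSeries]

/-- `1 / Γ(k + ν + 1)` is bounded uniformly in `k` and in `ν` in a ball. -/
lemma exists_norm_inv_Gamma_le (R : ℝ) :
    ∃ C : ℝ, 0 ≤ C ∧ ∀ ν : ℂ, ‖ν‖ ≤ R → ∀ k : ℕ, ‖(Gamma (k + ν + 1))⁻¹‖ ≤ C := by
  have hb : ∀ k : ℕ, ∃ C : ℝ, ∀ ν ∈ Metric.closedBall (0 : ℂ) R, ‖(Gamma (k + ν + 1))⁻¹‖ ≤ C := by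
    intro k
    refine (isCompact_closedBall (0 : ℂ) R).exists_bound_of_continuousOn (Continuous.continuousOn ?_)
    exact differentiable_one_div_Gamma.continuous.comp (by fun_prop)
  choose B hB using hb
  obtain ⟨m, hm⟩ := exists_nat_ge R
  have hC : ∀ k ≤ m, B k ≤ ∑ j ∈ Finset.range (m + 1), |B j| := fun k hk =>
    (le_abs_self _).trans (Finset.single_le_sum (f := fun j => |B j|) (fun _ _ => abs_nonneg _)
      (Finset.mem_range.2 (Nat.lt_succ_of_le hk)))
  refine ⟨∑ j ∈ Finset.range (m + 1), |B j|, Finset.sum_nonneg fun _ _ => abs_nonneg _,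
    fun ν hν k => ?_⟩
  have hν' : ν ∈ Metric.closedBall (0 : ℂ) R := by simpa using hν
  rcases le_total k m with hk | hk
  · exact (hB k ν hν').trans (hC k hk)
  · induction k, hk using Nat.le_induction with
    | base => exact (hB m ν hν').trans (hC m le_rfl)
    | succ k hk ih =>
      refine le_trans ?_ ih
      rw [one_div_Gamma_eq_self_mul_one_div_Gamma_add_one ((k : ℂ) + ν + 1), norm_mul]
      push_cast
      rw [show (k : ℂ) + 1 + ν + 1 = k + ν + 1 + 1 by ring]
      refine le_mul_of_one_le_left (norm_nonneg _) ?_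
      have hk' : (m : ℝ) ≤ k := by exact_mod_cast hk
      have h1 : (k : ℝ) + 1 ≤ ‖(k : ℂ) + ν + 1‖ + ‖ν‖ := by
        calc (k : ℝ) + 1 = ‖((k : ℂ) + ν + 1) - ν‖ := by
              rw [show ((k : ℂ) + ν + 1) - ν = ((k + 1 : ℝ) : ℂ) by push_cast; ring, norm_real,
                Real.norm_of_nonneg (by positivity)]
          _ ≤ _ := norm_sub_le _ _
      linarith

/-- The coefficient function of the Bessel series, without the factor `(z/2)^ν`. -/
noncomputable def besselCoeff (ε z : ℂ) (k : ℕ) (ν : ℂ) : ℂ :=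
  ε ^ k / ((k.factorial : ℂ) * Gamma (k + ν + 1)) * (z / 2) ^ (2 * k)

lemma exists_norm_besselCoeff_le (ε z : ℂ) (R : ℝ) : ∃ u : ℕ → ℝ, Summable u ∧
    ∀ k : ℕ, ∀ ν : ℂ, ‖ν‖ ≤ R → ‖besselCoeff ε z k ν‖ ≤ u k := by
  obtain ⟨C, hC, h⟩ := exists_norm_inv_Gamma_le R
  refine ⟨fun k => C * ((‖ε‖ * ‖z / 2‖ ^ 2) ^ k / k.factorial),
    (Real.summable_pow_div_factorial _).mul_left C, fun k ν hν => ?_⟩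
  have := h ν hν k
  rw [besselCoeff, norm_mul, norm_div, norm_mul, norm_pow, norm_pow, norm_natCast, pow_mul]
  simp only [mul_pow]
  rw [norm_inv] at this
  calc ‖ε‖ ^ k / (k.factorial * ‖Gamma (k + ν + 1)‖) * (‖z / 2‖ ^ 2) ^ k
      = ‖Gamma (k + ν + 1)‖⁻¹ * (‖ε‖ ^ k * (‖z / 2‖ ^ 2) ^ k / k.factorial) := by
        rw [div_mul_eq_div_div]; ring
    _ ≤ _ := by gcongr

lemma summable_norm_besselTerm (ε ν z : ℂ) : Summable fun k : ℕ =>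
    ‖ε ^ k / ((k.factorial : ℂ) * Gamma (k + ν + 1)) * ((z / 2) ^ ν * (z / 2) ^ (2 * k))‖ := by
  obtain ⟨u, hu, h⟩ := exists_norm_besselCoeff_le ε z ‖ν‖
  refine Summable.of_nonneg_of_le (fun _ => norm_nonneg _) (fun k => ?_)
    (hu.mul_left ‖(z / 2) ^ ν‖)
  have := h k ν le_rfl
  rw [mul_left_comm, norm_mul]
  gcongr
  exact this

lemma besselSeries_eq_cpow_mul (ε ν z : ℂ) :
    besselSeries ε ν z = (z / 2) ^ ν * ∑' k : ℕ, besselCoeff ε z k ν := by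
  rw [← tsum_mul_left]
  exact tsum_congr fun k => by rw [besselCoeff]; ring

lemma differentiable_besselSeries (ε : ℂ) {z : ℂ} (hz : z ≠ 0) :
    Differentiable ℂ fun ν => besselSeries ε ν z := by
  simp_rw [besselSeries_eq_cpow_mul]
  have hz2 : z / 2 ≠ 0 := div_ne_zero hz two_ne_zero
  refine Differentiable.mul (fun ν => DifferentiableAt.const_cpow differentiableAt_id (Or.inl hz2))
    fun ν => ?_
  obtain ⟨u, hu, h⟩ := exists_norm_besselCoeff_le ε z (‖ν‖ + 1)
  have hU : Metric.ball (0 : ℂ) (‖ν‖ + 1) ∈ 𝓝 ν := Metric.isOpen_ball.mem_nhds (by simp)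
  refine (differentiableOn_tsum_of_summable_norm hu (fun k => ?_) Metric.isOpen_ball
    (fun k w hw => h k w (by simpa using (Metric.mem_ball.1 hw).le))).differentiableAt hU
  have hG : Differentiable ℂ fun w : ℂ => (Gamma (k + w + 1))⁻¹ :=
    differentiable_one_div_Gamma.comp (by fun_prop)
  have : besselCoeff ε z k = fun w : ℂ =>
      ε ^ k / (k.factorial : ℂ) * (z / 2) ^ (2 * k) * (Gamma (k + w + 1))⁻¹ := by
    funext w; rw [besselCoeff, div_mul_eq_div_div]; ring
  rw [this]
  exact (hG.const_mul _).differentiableOn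

/-- Shifts of `1 / Γ` through falling factorials; there is no exception at the poles of `Γ`, where
`Γ` has the value `0` in Mathlib. -/
lemma inv_Gamma_sub_nat (r : ℂ) (l : ℕ) :
    (Gamma (r + 1 - l))⁻¹ = (descPochhammer ℤ l).smeval r * (Gamma (r + 1))⁻¹ := by
  induction l with
  | zero => simp
  | succ l ih =>
    rw [descPochhammer_succ_right, Polynomial.smeval_mul, mul_right_comm, ← ih,
      one_div_Gamma_eq_self_mul_one_div_Gamma_add_one]
    push_cast
    rw [show r + 1 - (l + 1) + 1 = r + 1 - l by ring, mul_comm]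
    congr 1
    simp [Polynomial.smeval_sub, Polynomial.smeval_natCast]

/-- The coefficients of a product of two Bessel series, by the Chu–Vandermonde identity. -/
lemma sum_antidiagonal_inv_Gamma (μ ν : ℂ) (n : ℕ) (h : Gamma (μ + ν + 2 * n + 1) ≠ 0) :
    ∑ kl ∈ Finset.HasAntidiagonal.antidiagonal n,
      ((kl.1.factorial : ℂ) * Gamma (kl.1 + μ + 1))⁻¹ *
        ((kl.2.factorial : ℂ) * Gamma (kl.2 + ν + 1))⁻¹ =
    Gamma (μ + ν + 2 * n + 1) / ((n.factorial : ℂ) * Gamma (n + μ + 1) * Gamma (n + ν + 1)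
      * Gamma (μ + ν + n + 1)) := by
  have hV := Ring.descPochhammer_smeval_add (R := ℂ) n (Commute.all (ν + n) (μ + n))
  have hD := inv_Gamma_sub_nat (μ + ν + 2 * n) n
  rw [show μ + ν + 2 * (n : ℂ) + 1 - n = μ + ν + n + 1 by ring] at hD
  rw [show ν + (n : ℂ) + (μ + n) = μ + ν + 2 * n by ring] at hV
  have hD' : Gamma (μ + ν + 2 * n + 1) * (Gamma (μ + ν + n + 1))⁻¹ =
      (descPochhammer ℤ n).smeval (μ + ν + 2 * n) := by
    rw [hD]; field_simp
  calc _ = ∑ kl ∈ Finset.HasAntidiagonal.antidiagonal n,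
        ((n.factorial : ℂ)⁻¹ * (Gamma (n + μ + 1))⁻¹ * (Gamma (n + ν + 1))⁻¹) *
          (n.choose kl.1 * ((descPochhammer ℤ kl.1).smeval (ν + n) *
          (descPochhammer ℤ kl.2).smeval (μ + n))) := by
        refine Finset.sum_congr rfl fun kl hkl => ?_
        obtain ⟨k, l⟩ := kl
        rw [Finset.HasAntidiagonal.mem_antidiagonal] at hkl
        simp only at hkl ⊢
        have e1 := inv_Gamma_sub_nat (μ + n) l
        have e2 := inv_Gamma_sub_nat (ν + n) k
        have hn : (n : ℂ) = k + l := by rw [← hkl]; push_cast; ring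
        rw [show μ + n + 1 - (l : ℂ) = k + μ + 1 by rw [hn]; ring,
          show μ + n + 1 = n + μ + 1 by ring] at e1
        rw [show ν + n + 1 - (k : ℂ) = l + ν + 1 by rw [hn]; ring,
          show ν + n + 1 = n + ν + 1 by ring] at e2
        have hch : (n.choose k : ℂ) * k.factorial * l.factorial = n.factorial := by
          rw [← hkl, Nat.choose_symm_add]
          exact_mod_cast Nat.add_choose_mul_factorial_mul_factorial k l
        have f1 : (k.factorial : ℂ) ≠ 0 := by exact_mod_cast k.factorial_ne_zero
        have f2 : (l.factorial : ℂ) ≠ 0 := by exact_mod_cast l.factorial_ne_zero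
        have f3 : (n.factorial : ℂ) ≠ 0 := by exact_mod_cast n.factorial_ne_zero
        rw [mul_inv, mul_inv, e1, e2]
        field_simp
        rw [← hch]
        ring
    _ = _ := by
        rw [← Finset.mul_sum, ← hV, ← hD', div_eq_mul_inv, mul_inv, mul_inv, mul_inv]
        ring

/-- The product of two Bessel series as a single series. -/
theorem hasSum_besselSeries_mul (ε μ ν z : ℂ)
    (h : ∀ n : ℕ, Gamma (μ + ν + 2 * n + 1) ≠ 0) :
    HasSum (fun n : ℕ => ε ^ n * Gamma (μ + ν + 2 * n + 1) / ((n.factorial : ℂ) *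
      Gamma (n + μ + 1) * Gamma (n + ν + 1) * Gamma (μ + ν + n + 1)) *
      ((z / 2) ^ μ * (z / 2) ^ ν * (z / 2) ^ (2 * n)))
      (besselSeries ε μ z * besselSeries ε ν z) := by
  have h1 := summable_norm_besselTerm ε μ z
  have h2 := summable_norm_besselTerm ε ν z
  have hs := (summable_norm_sum_mul_antidiagonal_of_summable_norm h1 h2).of_norm
  rw [besselSeries, besselSeries, tsum_mul_tsum_eq_tsum_sum_antidiagonal_of_summable_norm h1 h2]
  refine (congrArg (fun f => HasSum f _) (funext fun n => ?_)).mpr hs.hasSum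
  rw [mul_div_assoc, ← sum_antidiagonal_inv_Gamma μ ν n (h n), Finset.mul_sum, Finset.sum_mul]
  refine Finset.sum_congr rfl fun kl hkl => ?_
  rw [Finset.HasAntidiagonal.mem_antidiagonal] at hkl
  rw [← hkl, pow_add, mul_add, pow_add]
  ring

lemma conj_besselJ (ν : ℂ) {z : ℝ} (hz : 0 < z) :
    (starRingEnd ℂ) (besselJ ν z) = besselJ ((starRingEnd ℂ) ν) z := by
  rw [besselJ, besselJ, conj_tsum]
  refine tsum_congr fun k => ?_
  have hz2 : ((z : ℂ) / 2) = ((z / 2 : ℝ) : ℂ) := by push_cast; rfl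
  have hc : (starRingEnd ℂ) (((z : ℂ) / 2) ^ ν) = ((z : ℂ) / 2) ^ ((starRingEnd ℂ) ν) := by
    rw [hz2, cpow_conj _ _ (by rw [arg_ofReal_of_nonneg (by positivity)]; exact Real.pi_ne_zero.symm),
      conj_ofReal]
  rw [map_mul, map_mul, map_div₀, map_mul, hc, ← Gamma_conj, map_pow, map_pow, hz2, conj_ofReal]
  simp

end BesselSeries

/-! ### Integrals as series of residues -/

section ResidueSeries

open Complex

/-- Closing the contour to the left: if the integrals over the lines `re s = c - N` tend to zero,
the integral over `re s = c` is the sum of the series of residues at the simple poles `q i - n`. -/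
theorem integral_vertical_eq_sum_residue_series {κ : Type*} [Fintype κ] {q : κ → ℂ}
    {r : κ → ℕ → ℂ} {R : κ → ℂ} {G : ℂ → ℂ} {c e : ℝ} (he : e < 0)
    (hinj : Function.Injective fun p : κ × ℕ => q p.1 - p.2) (hq : ∀ i, (q i).re < c)
    (hne : ∀ i, ∀ n N : ℕ, (q i).re - n ≠ c - N)
    (hd : ∀ s : ℂ, s.re ≤ c → (∀ i, ∀ n : ℕ, s ≠ q i - n) → DifferentiableAt ℂ G s)
    (hres : ∀ i, ∀ n : ℕ,
      Tendsto (fun s => (s - (q i - n)) * G s) (𝓝[≠] (q i - n)) (𝓝 (r i n)))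
    (hg : StripGrowth e G)
    (hsmall : Tendsto (fun N : ℕ => ∫ t : ℝ, G ((c - N : ℝ) + t * I)) atTop (𝓝 0))
    (hsum : ∀ i, HasSum (r i) (R i)) :
    ∫ t : ℝ, G (c + t * I) = 2 * Real.pi * ∑ i, R i := by
  classical
  have hcont : ∀ N : ℕ, Continuous fun t : ℝ => G ((c - N : ℝ) + t * I) := by
    intro N
    refine continuous_iff_continuousAt.2 fun t => ?_
    refine ContinuousAt.comp (f := fun t : ℝ => ((c - N : ℝ) : ℂ) + t * I) (g := G)
      (hd _ (by simp) fun i n h => ?_).continuousAt (by fun_prop)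
    have := congrArg re h
    simp only [add_re, ofReal_re, mul_re, I_re, mul_zero, ofReal_im, I_im, mul_one, sub_self,
      add_zero, sub_re, natCast_re] at this
    exact hne i n N this.symm
  -- the poles between the lines `re s = c - N` and `re s = c`
  set T : κ → ℕ → Finset ℕ := fun i N =>
    (Finset.range N).filter fun n : ℕ => c - N < (q i).re - n with hT
  have step : ∀ N : ℕ, (∫ t : ℝ, G (c + t * I)) - ∫ t : ℝ, G ((c - N : ℝ) + t * I) =
      2 * Real.pi * ∑ i, ∑ n ∈ T i N, r i n := by
    intro N
    set P : Finset (κ × ℕ) := Finset.univ.sigma (T · N) |>.map (Equiv.sigmaEquivProd κ ℕ).toEmbedding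
      with hP
    have memP : ∀ i n, (i, n) ∈ P ↔ n < N ∧ c - N < (q i).re - n := by
      intro i n
      simp [hP, hT]
    have hS := integral_vertical_line_sub_eq_sum_residues (a := c - N) (b := c) (by simp)
      (P.image fun p : κ × ℕ => q p.1 - p.2)
      (fun z => limUnder (𝓝[≠] z) fun s => (s - z) * G s) (G := G) ?_ ?_ ?_
      (hg.decaysInStrip he _ _) (hg.integrable_vertical he (hcont N))
      (hg.integrable_vertical he (by simpa using hcont 0))
    · rw [hS, Finset.sum_image fun a _ b _ h => hinj h, hP, Finset.sum_map, Finset.sum_sigma]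
      congr 1
      refine Finset.sum_congr rfl fun i _ => Finset.sum_congr rfl fun n _ => ?_
      exact (hres i n).limUnder_eq
    · intro p hp
      obtain ⟨⟨i, n⟩, hin, rfl⟩ := Finset.mem_image.1 hp
      have := (memP i n).1 hin
      have hn : (0 : ℝ) ≤ n := n.cast_nonneg
      simp only [sub_re, natCast_re]
      exact ⟨this.2, by linarith [hq i]⟩
    · intro s h1 h2 h3
      refine hd s h2 fun i n h => h3 (Finset.mem_image.2 ⟨(i, n), (memP i n).2 ?_, h.symm⟩)
      have hre : s.re = (q i).re - n := by rw [h]; simp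
      have hlt : c - N < (q i).re - n := lt_of_le_of_ne (hre ▸ h1) (hne i n N).symm
      exact ⟨by have := hq i; exact_mod_cast (by linarith : (n : ℝ) < N), hlt⟩
    · intro p hp
      obtain ⟨⟨i, n⟩, -, rfl⟩ := Finset.mem_image.1 hp
      exact tendsto_nhds_limUnder ⟨_, hres i n⟩
  have lim1 : Tendsto (fun N : ℕ => ∑ i, ∑ n ∈ T i N, r i n) atTop (𝓝 (∑ i, R i)) := by
    refine tendsto_finsetSum _ fun i _ => (hsum i).comp ?_
    refine tendsto_atTop_finset_of_monotone (fun M N hMN n hn => ?_) fun n => ?_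
    · simp only [hT, Finset.mem_filter, Finset.mem_range] at hn ⊢
      have : (M : ℝ) ≤ N := by exact_mod_cast hMN
      exact ⟨by omega, by linarith [hn.2]⟩
    · obtain ⟨N, hN⟩ := exists_nat_gt (max (n : ℝ) (c - (q i).re + n))
      refine ⟨N, ?_⟩
      simp only [hT, Finset.mem_filter, Finset.mem_range]
      have h1 := (le_max_left _ _).trans_lt hN
      have h2 := (le_max_right _ _).trans_lt hN
      exact ⟨by exact_mod_cast h1, by linarith⟩
  have lim2 := tendsto_const_nhds (x := ∫ t : ℝ, G (c + t * I)) (f := (atTop : Filter ℕ)) |>.sub hsmall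
  rw [sub_zero] at lim2
  exact tendsto_nhds_unique lim2 ((lim1.const_mul (2 * (Real.pi : ℂ))).congr fun N => (step N).symm)

/-- A contraction between consecutive lines makes the integrals over the far left lines vanish. -/
lemma tendsto_integral_left_lines {G : ℂ → ℂ} {c K : ℝ}
    (hK : ∀ n : ℕ, ∀ t : ℝ, ‖G (((c - n : ℝ) : ℂ) + t * I - 1)‖ ≤
      K / (n + 1) * ‖G ((c - n : ℝ) + t * I)‖)
    (hi : Integrable fun t : ℝ => G (c + t * I)) (hK0 : 0 ≤ K) :
    Tendsto (fun N : ℕ => ∫ t : ℝ, G ((c - N : ℝ) + t * I)) atTop (𝓝 0) := by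
  have bound : ∀ N : ℕ, ∀ t : ℝ, ‖G ((c - N : ℝ) + t * I)‖ ≤
      K ^ N / N.factorial * ‖G (c + t * I)‖ := by
    intro N t
    induction N with
    | zero => simp
    | succ N ih =>
      have e : (((c - (N + 1 : ℕ) : ℝ) : ℂ) + t * I) = ((c - N : ℝ) : ℂ) + t * I - 1 := by
        push_cast; ring
      rw [e]
      refine (hK N t).trans ?_
      calc K / (N + 1) * ‖G ((c - N : ℝ) + t * I)‖
          ≤ K / (N + 1) * (K ^ N / N.factorial * ‖G (c + t * I)‖) := by gcongr
        _ = _ := by rw [Nat.factorial_succ, pow_succ]; push_cast; field_simp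
  refine squeeze_zero_norm (a := fun N : ℕ => K ^ N / N.factorial * ∫ t : ℝ, ‖G (c + t * I)‖)
    (fun N => ?_) ?_
  · rw [← integral_const_mul]
    exact norm_integral_le_of_norm_le (hi.norm.const_mul _) (Eventually.of_forall (bound N))
  · simpa using (FloorSemiring.tendsto_pow_div_factorial_atTop K).mul_const
      (∫ t : ℝ, ‖G (c + t * I)‖)

/-- The residue of `Γ` at `-n` is `(-1)^n / n!`. -/
lemma tendsto_mul_Gamma_neg_nat (n : ℕ) :
    Tendsto (fun z : ℂ => (z + n) * Gamma z) (𝓝[≠] (-n : ℂ)) (𝓝 ((-1) ^ n / n.factorial)) := by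
  induction n with
  | zero => simpa using tendsto_self_mul_Gamma_nhds_zero
  | succ n ih =>
    have hne : (-(n + 1 : ℕ) : ℂ) ≠ 0 := by
      exact neg_ne_zero.2 (Nat.cast_ne_zero.2 n.succ_ne_zero)
    have shift : Tendsto (fun z : ℂ => z + 1) (𝓝[≠] (-(n + 1 : ℕ) : ℂ)) (𝓝[≠] (-n : ℂ)) := by
      refine tendsto_nhdsWithin_of_tendsto_nhds_of_eventually_within _ ?_ ?_
      · refine tendsto_nhdsWithin_of_tendsto_nhds ?_
        have : ContinuousAt (fun z : ℂ => z + 1) (-(n + 1 : ℕ) : ℂ) := by fun_prop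
        simpa [ContinuousAt] using this
      · filter_upwards [self_mem_nhdsWithin] with z hz h
        apply hz
        simp only [mem_singleton_iff] at h ⊢
        push_cast
        linear_combination h
    have hinv : Tendsto (fun z : ℂ => z⁻¹) (𝓝[≠] (-(n + 1 : ℕ) : ℂ)) (𝓝 (-(n + 1 : ℕ) : ℂ)⁻¹) :=
      tendsto_nhdsWithin_of_tendsto_nhds (tendsto_inv₀ hne)
    have := (ih.comp shift).mul hinv
    have e : ((-1) ^ (n + 1) / ((n + 1).factorial : ℂ)) =
        (-1) ^ n / (n.factorial : ℂ) * (-(n + 1 : ℕ) : ℂ)⁻¹ := by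
      rw [Nat.factorial_succ, pow_succ]
      have h1 : (n.factorial : ℂ) ≠ 0 := by exact_mod_cast n.factorial_ne_zero
      have h2 : (n : ℂ) + 1 ≠ 0 := Nat.cast_add_one_ne_zero n
      push_cast
      have h3 : -1 + -(n : ℂ) ≠ 0 := by rw [← neg_add, add_comm]; exact neg_ne_zero.2 h2
      field_simp
    rw [e]
    refine this.congr' ?_
    filter_upwards [nhdsWithin_le_nhds (isOpen_ne.mem_nhds hne)] with z hz
    simp only [Function.comp]
    rw [Gamma_add_one z hz]
    push_cast
    field_simp
    ring

/-- The residue at `-w - n` of `Γ(s + w) H(s)`, for `H` continuous there. -/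
lemma tendsto_residue_Gamma_mul {H : ℂ → ℂ} (w : ℂ) (n : ℕ) (hH : ContinuousAt H (-w - n)) :
    Tendsto (fun s => (s - (-w - n)) * (Gamma (s + w) * H s)) (𝓝[≠] (-w - n))
      (𝓝 ((-1) ^ n / n.factorial * H (-w - n))) := by
  have shift : Tendsto (fun s : ℂ => s + w) (𝓝[≠] (-w - n)) (𝓝[≠] (-n : ℂ)) := by
    refine tendsto_nhdsWithin_of_tendsto_nhds_of_eventually_within _ ?_ ?_
    · refine tendsto_nhdsWithin_of_tendsto_nhds ?_
      have : ContinuousAt (fun z : ℂ => z + w) (-w - n) := by fun_prop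
      have e : -w - (n : ℂ) + w = -n := by ring
      simpa only [ContinuousAt, e] using this
    · filter_upwards [self_mem_nhdsWithin] with z hz h
      apply hz
      simp only [mem_singleton_iff] at h ⊢
      linear_combination h
  refine (((tendsto_mul_Gamma_neg_nat n).comp shift).mul
    (tendsto_nhdsWithin_of_tendsto_nhds hH.tendsto)).congr fun s => ?_
  simp only [Function.comp]
  ring

end ResidueSeries

/-! ### Mellin transforms of the kernels -/

section Kernels

open Complex

/-- The Mellin transform in `x` of `K_{iτ}(√x) [I_{iτ}(√x) + I_{-iτ}(√x)]`. -/
noncomputable def kiMellin (τ : ℝ) (s : ℂ) : ℂ :=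
  ((Real.cosh (Real.pi * τ) / Real.sqrt Real.pi : ℝ) : ℂ) *
    (Gamma (1 / 2 - s) * Gamma (s + I * τ) * Gamma (s - I * τ) * (Gamma (1 - s))⁻¹)

/-- The quotient of the Mellin transforms of the two kernels, up to the factor `π²`. -/
noncomputable def weberFactor (α : ℝ) (s : ℂ) : ℂ :=
  Gamma (1 - s) * Gamma (1 - s) * Gamma (s + α) * (Gamma (1 + α - s))⁻¹

/-- The Mellin transform in `x` of the Weber type kernel `W_α(x, τ)`. -/
noncomputable def weberMellin (α τ : ℝ) (s : ℂ) : ℂ :=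
  ((1 / Real.pi ^ 2 : ℝ) : ℂ) * (kiMellin τ s * weberFactor α s)

lemma stripGrowth_kiMellin (τ : ℝ) : StripGrowth (-Real.pi) (kiMellin τ) := by
  have h := (stripGrowth_const ((Real.cosh (Real.pi * τ) / Real.sqrt Real.pi : ℝ) : ℂ)).mul
    ((((stripGrowth_Gamma.comp_sub (1 / 2)).mul (stripGrowth_Gamma.comp_add (I * τ))).mul
      (stripGrowth_Gamma.comp_add (-(I * τ)))).mul (stripGrowth_Gamma_inv.comp_sub 1))
  convert h using 1
  · ring
  · funext s
    rw [kiMellin, sub_eq_add_neg s]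

lemma stripGrowth_weberFactor (α : ℝ) : StripGrowth (-Real.pi) (weberFactor α) := by
  have h := (((stripGrowth_Gamma.comp_sub 1).mul (stripGrowth_Gamma.comp_sub 1)).mul
    (stripGrowth_Gamma.comp_add α)).mul (stripGrowth_Gamma_inv.comp_sub (1 + α))
  convert h using 1
  · ring
  · rfl

lemma stripGrowth_weberMellin (α τ : ℝ) : StripGrowth (-(2 * Real.pi)) (weberMellin α τ) := by
  have h := (stripGrowth_const ((1 / Real.pi ^ 2 : ℝ) : ℂ)).mul
    ((stripGrowth_kiMellin τ).mul (stripGrowth_weberFactor α))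
  convert h using 1
  · ring
  · rfl

lemma differentiableAt_Gamma_of_re_pos {s : ℂ} (h : 0 < s.re) : DifferentiableAt ℂ Gamma s :=
  differentiableAt_Gamma _ fun m hm => by
    have : (0 : ℝ) ≤ m := m.cast_nonneg
    rw [hm] at h; simp at h; linarith

lemma differentiableAt_kiMellin {τ : ℝ} {s : ℂ} (h : s.re < 1 / 2)
    (h1 : ∀ n : ℕ, s ≠ -(I * τ) - n) (h2 : ∀ n : ℕ, s ≠ I * τ - n) :
    DifferentiableAt ℂ (kiMellin τ) s := by
  have d1 : DifferentiableAt ℂ Gamma (1 / 2 - s) :=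
    differentiableAt_Gamma_of_re_pos (by
      rw [sub_re, show ((1 : ℂ) / 2).re = 1 / 2 by norm_num]; linarith)
  have d2 : DifferentiableAt ℂ Gamma (s + I * τ) :=
    differentiableAt_Gamma _ fun m hm => h1 m (by linear_combination hm)
  have d3 : DifferentiableAt ℂ Gamma (s - I * τ) :=
    differentiableAt_Gamma _ fun m hm => h2 m (by linear_combination hm)
  have d4 : Differentiable ℂ fun s : ℂ => (Gamma (1 - s))⁻¹ :=
    differentiable_one_div_Gamma.comp (by fun_prop)
  refine DifferentiableAt.const_mul (((DifferentiableAt.mul ?_ ?_).mul ?_).mul (d4 s)) _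
  · exact d1.comp s (f := fun s => 1 / 2 - s) (by fun_prop)
  · exact d2.comp s (f := fun s => s + I * τ) (by fun_prop)
  · exact d3.comp s (f := fun s => s - I * τ) (by fun_prop)

lemma differentiableAt_weberFactor {α : ℝ} {s : ℂ} (h : s.re < 1)
    (h1 : ∀ n : ℕ, s ≠ -α - n) : DifferentiableAt ℂ (weberFactor α) s := by
  have d1 : DifferentiableAt ℂ Gamma (1 - s) :=
    differentiableAt_Gamma_of_re_pos (by rw [sub_re, one_re]; linarith)
  have d1' : DifferentiableAt ℂ (fun s => Gamma (1 - s)) s :=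
    d1.comp s (f := fun s => 1 - s) (by fun_prop)
  have d2 : DifferentiableAt ℂ Gamma (s + α) :=
    differentiableAt_Gamma _ fun m hm => h1 m (by linear_combination hm)
  have d4 : Differentiable ℂ fun s : ℂ => (Gamma (1 + α - s))⁻¹ :=
    differentiable_one_div_Gamma.comp (by fun_prop)
  exact ((d1'.mul d1').mul (d2.comp s (f := fun s : ℂ => s + α) (by fun_prop))).mul (d4 s)

lemma kiMellin_neg (τ : ℝ) (s : ℂ) : kiMellin (-τ) s = kiMellin τ s := by
  have e1 : s + I * ((-τ : ℝ) : ℂ) = s - I * τ := by push_cast; ring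
  have e2 : s - I * ((-τ : ℝ) : ℂ) = s + I * τ := by push_cast; ring
  rw [kiMellin, kiMellin, e1, e2, mul_neg, Real.cosh_neg]
  ring

/-- The functional equation that moves the line of integration one unit to the left. -/
lemma kiMellin_sub_one {τ : ℝ} {s : ℂ} (h : s.re < 1 / 2) (h1 : s - 1 + I * τ ≠ 0)
    (h2 : s - 1 - I * τ ≠ 0) : kiMellin τ (s - 1) =
      (1 / 2 - s) / ((s - 1 + I * τ) * (s - 1 - I * τ) * (1 - s)) * kiMellin τ s := by
  have h3 : (1 / 2 - s : ℂ) ≠ 0 := fun h0 => by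
    have := congrArg re h0
    rw [sub_re, show ((1 : ℂ) / 2).re = 1 / 2 by norm_num, zero_re] at this
    linarith
  have h4 : (1 - s : ℂ) ≠ 0 := fun h0 => by
    have := congrArg re h0
    rw [sub_re, one_re, zero_re] at this
    linarith
  have g1 := Gamma_add_one _ h1
  have g2 := Gamma_add_one _ h2
  have g3 := Gamma_add_one _ h3
  have g4 := Gamma_add_one _ h4
  rw [show s - 1 + I * τ + 1 = s + I * τ by ring] at g1
  rw [show s - 1 - I * τ + 1 = s - I * τ by ring] at g2
  rw [show 1 / 2 - s + 1 = 1 / 2 - (s - 1) by ring] at g3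
  rw [show 1 - s + 1 = 1 - (s - 1) by ring] at g4
  rw [kiMellin, kiMellin, g1, g2, g3, g4, mul_inv]
  field_simp

/-- The functional equation of `weberFactor`; its coefficient stays bounded far to the left. -/
lemma weberFactor_sub_one {α : ℝ} {s : ℂ} (h : s.re < 1) (h1 : s - 1 + α ≠ 0)
    (h2 : 1 + α - s ≠ 0) : weberFactor α (s - 1) =
      (1 - s) * (1 - s) / ((s - 1 + α) * (1 + α - s)) * weberFactor α s := by
  have h4 : (1 - s : ℂ) ≠ 0 := fun h0 => by
    have := congrArg re h0
    rw [sub_re, one_re, zero_re] at this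
    linarith
  have g1 := Gamma_add_one _ h1
  have g2 := Gamma_add_one _ h2
  have g4 := Gamma_add_one _ h4
  rw [show s - 1 + α + 1 = s + α by ring] at g1
  rw [show 1 + α - s + 1 = 1 + α - (s - 1) by ring] at g2
  rw [show 1 - s + 1 = 1 - (s - 1) by ring] at g4
  rw [weberFactor, weberFactor, g1, g2, g4, mul_inv]
  field_simp

end Kernels

/-! ### Residues of the modified Bessel kernel -/

section BesselResidues

open Complex

lemma cpow_sqrt_half {x : ℝ} (hx : 0 < x) {μ ν w : ℂ} {n : ℕ} (h : μ + ν + 2 * n = 2 * w) :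
    ((Real.sqrt x : ℂ) / 2) ^ μ * ((Real.sqrt x : ℂ) / 2) ^ ν * ((Real.sqrt x : ℂ) / 2) ^ (2 * n) =
      (x : ℂ) ^ w * 2 ^ (-(2 * w)) := by
  have hs : 0 < Real.sqrt x / 2 := by positivity
  have e : ((Real.sqrt x : ℂ) / 2) = ((Real.sqrt x / 2 : ℝ) : ℂ) := by push_cast; rfl
  have h0 : ((Real.sqrt x / 2 : ℝ) : ℂ) ≠ 0 := ofReal_ne_zero.2 hs.ne'
  rw [e, ← cpow_natCast, ← cpow_add _ _ h0, ← cpow_add _ _ h0]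
  rw [show μ + ν + ((2 * n : ℕ) : ℂ) = 2 * w by push_cast; exact h, cpow_def_of_ne_zero h0,
    cpow_def_of_ne_zero (ofReal_ne_zero.2 hx.ne'),
    cpow_def_of_ne_zero two_ne_zero, ← Complex.exp_add]
  have hl : Complex.log ((Real.sqrt x / 2 : ℝ) : ℂ) = Complex.log x / 2 - Complex.log 2 := by
    rw [← ofReal_log hs.le, Real.log_div (by positivity) two_ne_zero, Real.log_sqrt hx.le,
      ← ofReal_log hx.le, ← ofReal_ofNat 2, ← ofReal_log zero_le_two]
    push_cast; ring
  rw [hl]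
  congr 1
  ring

/-- The reflection formula along a chain of poles. -/
lemma Gamma_neg_sub_nat {u : ℂ} (hu : sin (Real.pi * u) ≠ 0) (n : ℕ) :
    Gamma (n + u + 1) ≠ 0 ∧ Gamma (-u - n) =
      -((-1) ^ n * Real.pi) / (sin (Real.pi * u) * Gamma (n + u + 1)) := by
  have h := Gamma_mul_Gamma_one_sub (-u - n)
  have e : sin (Real.pi * (-u - n)) = -((-1) ^ n * sin (Real.pi * u)) := by
    rw [show (Real.pi : ℂ) * (-u - n) = -(Real.pi * u + n * Real.pi) by ring, sin_neg,
      Complex.sin_antiperiodic.add_nat_mul_eq]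
  have hpm : ((-1 : ℂ)) ^ n ≠ 0 := pow_ne_zero _ (by norm_num)
  have hpi : (Real.pi : ℂ) ≠ 0 := ofReal_ne_zero.2 Real.pi_ne_zero
  rw [e, show 1 - (-u - n) = n + u + 1 by ring] at h
  have hne : Gamma (n + u + 1) ≠ 0 := by
    intro h0
    rw [h0, mul_zero, eq_comm, div_eq_zero_iff] at h
    rcases h with h | h
    · exact hpi h
    · exact neg_ne_zero.2 (mul_ne_zero hpm hu) h
  refine ⟨hne, ?_⟩
  have hsq : ((-1 : ℂ) ^ n) * (-1) ^ n = 1 := by rw [← mul_pow]; norm_num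
  rw [eq_div_iff (mul_ne_zero hu hne)]
  rw [eq_div_iff (neg_ne_zero.2 (mul_ne_zero hpm hu))] at h
  linear_combination (-(-1) ^ n) * h - Gamma (-u - n) * sin (Real.pi * u) * Gamma (n + u + 1) * hsq

lemma sin_pi_mul_ne_zero {w : ℂ} (hw : w.im ≠ 0) : sin (Real.pi * w) ≠ 0 := by
  rw [sin_ne_zero_iff]
  intro k hk
  have := congrArg im hk
  simp [Real.pi_ne_zero] at this
  exact hw this

/-- The residue at `-iτ - n` of the integrand of the inverse Mellin transform of `kiMellin τ`. -/
noncomputable def kiResidue (x τ : ℝ) (n : ℕ) : ℂ :=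
  -(Real.pi * Real.cosh (Real.pi * τ)) / sin (Real.pi * (I * τ + I * τ)) *
    (Gamma (I * τ + I * τ + 2 * n + 1) / ((n.factorial : ℂ) * Gamma (n + I * τ + 1) *
      Gamma (n + I * τ + 1) * Gamma (I * τ + I * τ + n + 1)) *
    ((x : ℂ) ^ (I * τ + n) * 2 ^ (-(2 * (I * τ + n)))))

lemma tendsto_kiResidue {x τ : ℝ} (hx : 0 < x) (hτ : τ ≠ 0) (n : ℕ) :
    Tendsto (fun s => (s - (-(I * τ) - n)) * ((x : ℂ) ^ (-s) * kiMellin τ s))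
      (𝓝[≠] (-(I * τ) - n)) (𝓝 (kiResidue x τ n)) := by
  have hx0 : (x : ℂ) ≠ 0 := ofReal_ne_zero.2 hx.ne'
  set p : ℂ := -(I * τ) - n with hp
  set H : ℂ → ℂ := fun s => (x : ℂ) ^ (-s) * (((Real.cosh (Real.pi * τ) / Real.sqrt Real.pi : ℝ) : ℂ)
    * (Gamma (1 / 2 - s) * Gamma (s - I * τ) * (Gamma (1 - s))⁻¹)) with hH
  have hpre : p.re = -n := by simp [hp]
  have hpim : p.im = -τ := by simp [hp]
  have hn : (0 : ℝ) ≤ n := n.cast_nonneg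
  have hHc : ContinuousAt H p := by
    have d0 : DifferentiableAt ℂ (fun s : ℂ => (x : ℂ) ^ (-s)) p :=
      DifferentiableAt.const_cpow (by fun_prop) (Or.inl hx0)
    have d1 : DifferentiableAt ℂ Gamma (1 / 2 - p) :=
      differentiableAt_Gamma_of_re_pos (by
        rw [sub_re, hpre, show ((1 : ℂ) / 2).re = 1 / 2 by norm_num]; linarith)
    have d3 : DifferentiableAt ℂ Gamma (p - I * τ) :=
      differentiableAt_Gamma _ fun m hm => by
        have := congrArg im hm
        simp [hpim] at this
        apply hτ; linarith
    have d4 : Differentiable ℂ fun s : ℂ => (Gamma (1 - s))⁻¹ :=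
      differentiable_one_div_Gamma.comp (by fun_prop)
    have := d0.mul (((d1.comp p (f := fun s => 1 / 2 - s) (by fun_prop)).mul
      (d3.comp p (f := fun s => s - I * τ) (by fun_prop))).mul (d4 p) |>.const_mul
        ((Real.cosh (Real.pi * τ) / Real.sqrt Real.pi : ℝ) : ℂ))
    exact this.continuousAt
  have hval : (-1) ^ n / (n.factorial : ℂ) * H p = kiResidue x τ n := by
    have him : (I * τ + I * τ : ℂ).im ≠ 0 := by
      simp; intro h; apply hτ; linarith
    have hsin := sin_pi_mul_ne_zero him
    obtain ⟨g1, g2⟩ := Gamma_neg_sub_nat hsin n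
    have dup := Gamma_mul_Gamma_add_half (I * τ + n + 1 / 2)
    have g3 : Gamma (n + I * τ + 1) ≠ 0 :=
      Gamma_ne_zero_of_re_pos (by simp; linarith)
    have hsqrt : ((Real.sqrt Real.pi : ℝ) : ℂ) ≠ 0 :=
      ofReal_ne_zero.2 (Real.sqrt_pos.2 Real.pi_pos).ne'
    have hsq : ((-1 : ℂ) ^ n) * (-1) ^ n = 1 := by rw [← mul_pow]; norm_num
    have hf : (n.factorial : ℂ) ≠ 0 := by exact_mod_cast n.factorial_ne_zero
    rw [show I * τ + n + 1 / 2 + 1 / 2 = n + I * τ + 1 by ring,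
      show 2 * (I * τ + n + 1 / 2) = I * τ + I * τ + 2 * n + 1 by ring,
      show 1 - (I * τ + I * τ + 2 * n + 1) = -(2 * (I * τ + n)) by ring] at dup
    have e1 : 1 / 2 - p = I * τ + n + 1 / 2 := by rw [hp]; ring
    have e2 : p - I * τ = -(I * τ + I * τ) - n := by rw [hp]; ring
    have e3 : 1 - p = n + I * τ + 1 := by rw [hp]; ring
    have e4 : -p = I * τ + n := by rw [hp]; ring
    simp only [hH, kiResidue]
    rw [e1, e2, e3, e4, g2, eq_div_of_mul_eq g3 dup]
    rw [show I * τ + I * τ + (n : ℂ) + 1 = n + (I * τ + I * τ) + 1 by ring]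
    push_cast
    refine (?_ : _ = ((-1 : ℂ) ^ n * (-1) ^ n) * _).trans (by rw [hsq, one_mul])
    field_simp
  rw [← hval]
  refine (tendsto_residue_Gamma_mul (I * τ) n hHc).congr fun s => ?_
  simp only [hH, kiMellin]
  ring

lemma Gamma_two_I_add_ne_zero (τ : ℝ) (n : ℕ) : Gamma (I * τ + I * τ + 2 * n + 1) ≠ 0 :=
  Gamma_ne_zero_of_re_pos (by
    have : (0 : ℝ) ≤ n := n.cast_nonneg
    simp; linarith)

lemma hasSum_kiResidue {x : ℝ} (hx : 0 < x) (τ : ℝ) :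
    HasSum (kiResidue x τ) (-(Real.pi * Real.cosh (Real.pi * τ)) /
      sin (Real.pi * (I * τ + I * τ)) *
      (besselI (I * τ) (Real.sqrt x) * besselI (I * τ) (Real.sqrt x))) := by
  have h := (hasSum_besselSeries_mul 1 (I * τ) (I * τ) (Real.sqrt x)
    (Gamma_two_I_add_ne_zero τ)).mul_left
    (-(Real.pi * Real.cosh (Real.pi * τ)) / sin (Real.pi * (I * τ + I * τ)))
  rw [← besselI_eq] at h
  refine (congrArg (fun f => HasSum f _) (funext fun n => ?_)).mpr h
  rw [kiResidue, one_pow, one_mul, cpow_sqrt_half hx (w := I * τ + n) (by ring)]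

/-- The two chains of poles `∓iτ - n` of `kiMellin τ`. -/
noncomputable def kiPole (τ : ℝ) (b : Bool) : ℂ := if b then -(I * τ) else I * τ

lemma kiPole_re (τ : ℝ) (b : Bool) : (kiPole τ b).re = 0 := by cases b <;> simp [kiPole]

lemma kiPole_im_injective {τ : ℝ} (hτ : τ ≠ 0) : Function.Injective fun b => (kiPole τ b).im := by
  intro b b' h
  cases b <;> cases b' <;> simp [kiPole] at h ⊢ <;> (apply hτ; linarith)

lemma kiPole_im_ne_zero {τ : ℝ} (hτ : τ ≠ 0) (b : Bool) : (kiPole τ b).im ≠ 0 := by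
  cases b <;> simpa [kiPole] using hτ

lemma injective_sub_natCast {κ : Type*} {q : κ → ℂ} (h : Function.Injective fun i => (q i).im) :
    Function.Injective fun p : κ × ℕ => q p.1 - p.2 := by
  rintro ⟨i, n⟩ ⟨j, m⟩ hij
  have h1 := congrArg im hij
  simp only [sub_im, natCast_im, sub_zero] at h1
  have h2 : i = j := h h1
  subst h2
  simp only [sub_right_inj, Nat.cast_inj] at hij
  rw [hij]

lemma tendsto_kiPole_residue {x τ : ℝ} (hx : 0 < x) (hτ : τ ≠ 0) (b : Bool) (n : ℕ) :
    Tendsto (fun s => (s - (kiPole τ b - n)) * ((x : ℂ) ^ (-s) * kiMellin τ s))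
      (𝓝[≠] (kiPole τ b - n)) (𝓝 (kiResidue x (if b then τ else -τ) n)) := by
  cases b with
  | true => exact tendsto_kiResidue hx hτ n
  | false =>
    have := tendsto_kiResidue hx (neg_ne_zero.2 hτ) n
    simp only [kiMellin_neg] at this
    simpa [kiPole] using this

lemma natCast_ne_of_mem_Ioo {c : ℝ} (h0 : 0 < c) (h1 : c < 1) (n N : ℕ) : (0 : ℝ) - n ≠ c - N := by
  intro h
  have e : c = ((N - n : ℤ) : ℝ) := by push_cast; linarith
  rw [e] at h0 h1
  have a : (0 : ℤ) < N - n := by exact_mod_cast h0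
  have b : (N - n : ℤ) < 1 := by exact_mod_cast h1
  omega

lemma norm_ki_ratio_le {τ : ℝ} {s : ℂ} {n : ℕ} (h : s.re ≤ 1 / 2 - n) :
    ‖(1 / 2 - s) / ((s - 1 + I * τ) * (s - 1 - I * τ) * (1 - s))‖ ≤ 4 / (n + 1) := by
  have hn : (0 : ℝ) ≤ n := n.cast_nonneg
  have h1 : ‖(1 / 2 : ℂ) - s‖ ≤ ‖1 - s‖ := by
    rw [Complex.norm_def, Complex.norm_def]
    refine Real.sqrt_le_sqrt ?_
    rw [normSq_apply, normSq_apply]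
    have e1 : ((1 / 2 : ℂ) - s).re = 1 / 2 - s.re := by
      rw [sub_re, show ((1 : ℂ) / 2).re = 1 / 2 by norm_num]
    have e2 : ((1 / 2 : ℂ) - s).im = - s.im := by
      rw [sub_im, show ((1 : ℂ) / 2).im = 0 by norm_num]; ring
    rw [e1, e2]
    simp only [sub_re, one_re, sub_im, one_im]
    nlinarith
  have low : ∀ z : ℂ, z.re = s.re - 1 → ((n : ℝ) + 1) / 2 ≤ ‖z‖ := by
    intro z hz
    have := abs_re_le_norm z
    rw [hz, abs_of_nonpos (by linarith)] at this
    linarith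
  have l1 := low (s - 1 + I * τ) (by simp)
  have l2 := low (s - 1 - I * τ) (by simp)
  have l3 : ((n : ℝ) + 1) / 2 ≤ ‖1 - s‖ := by
    rw [norm_sub_rev]; exact low (s - 1) (by simp)
  have l3' : 0 < ‖1 - s‖ := by linarith
  rw [norm_div, norm_mul, norm_mul]
  calc ‖(1 / 2 : ℂ) - s‖ / (‖s - 1 + I * τ‖ * ‖s - 1 - I * τ‖ * ‖1 - s‖)
      ≤ ‖1 - s‖ / ((((n : ℝ) + 1) / 2) * (((n : ℝ) + 1) / 2) * ‖1 - s‖) := by gcongr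
    _ = 4 / (n + 1) * (1 / (n + 1)) := by field_simp; norm_num
    _ ≤ 4 / (n + 1) * 1 := by
        gcongr
        rw [div_le_one (by positivity)]; linarith
    _ = _ := mul_one _

lemma cpow_neg_sub_one {x : ℝ} (hx : 0 < x) (s : ℂ) :
    (x : ℂ) ^ (-(s - 1)) = x * (x : ℂ) ^ (-s) := by
  rw [show -(s - 1) = 1 + -s by ring, cpow_add _ _ (ofReal_ne_zero.2 hx.ne'), cpow_one]

lemma ki_poles_ne_zero {τ : ℝ} {s : ℂ} (h : s.re < 1) :
    s - 1 + I * τ ≠ 0 ∧ s - 1 - I * τ ≠ 0 := by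
  constructor <;> intro h0 <;> have := congrArg re h0 <;> simp at this <;> linarith

lemma norm_kiIntegrand_sub_one_le {x τ : ℝ} (hx : 0 < x) {s : ℂ} {n : ℕ} (h : s.re < 1 / 2 - n) :
    ‖(x : ℂ) ^ (-(s - 1)) * kiMellin τ (s - 1)‖ ≤
      4 * x / (n + 1) * ‖(x : ℂ) ^ (-s) * kiMellin τ s‖ := by
  have hn : (0 : ℝ) ≤ n := n.cast_nonneg
  obtain ⟨p1, p2⟩ := ki_poles_ne_zero (τ := τ) (s := s) (by linarith)
  rw [kiMellin_sub_one (by linarith) p1 p2, cpow_neg_sub_one hx]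
  calc _ = x * ‖(1 / 2 - s) / ((s - 1 + I * τ) * (s - 1 - I * τ) * (1 - s))‖ *
        ‖(x : ℂ) ^ (-s) * kiMellin τ s‖ := by
        simp only [norm_mul, norm_real, Real.norm_of_nonneg hx.le]; ring
    _ ≤ x * (4 / (n + 1)) * ‖(x : ℂ) ^ (-s) * kiMellin τ s‖ := by
        gcongr; exact norm_ki_ratio_le h.le
    _ = _ := by ring

lemma sin_pi_mul_two_I (τ : ℝ) : sin (Real.pi * (I * τ + I * τ)) =
    2 * Real.sinh (Real.pi * τ) * Real.cosh (Real.pi * τ) * I := by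
  rw [show (Real.pi : ℂ) * (I * τ + I * τ) = ((2 * (Real.pi * τ) : ℝ) : ℂ) * I by push_cast; ring,
    sin_mul_I, ← ofReal_sinh, Real.sinh_two_mul]
  push_cast; ring

lemma sin_pi_mul_I (τ : ℝ) : sin (I * τ * Real.pi) = Real.sinh (Real.pi * τ) * I := by
  rw [show I * (τ : ℂ) * Real.pi = ((Real.pi * τ : ℝ) : ℂ) * I by push_cast; ring, sin_mul_I,
    ← ofReal_sinh]

lemma not_int_of_im_ne_zero {ν : ℂ} (h : ν.im ≠ 0) : ¬ ∃ n : ℤ, ν = n := by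
  rintro ⟨n, rfl⟩; simp at h

lemma kiMellin_differentiableAt_of_kiPole {τ : ℝ} {s : ℂ} (h : s.re < 1 / 2)
    (hs : ∀ b, ∀ n : ℕ, s ≠ kiPole τ b - n) : DifferentiableAt ℂ (kiMellin τ) s :=
  differentiableAt_kiMellin h (fun n => by simpa [kiPole] using hs true n)
    (fun n => by simpa [kiPole] using hs false n)

lemma differentiableAt_kiMellin_strip {τ : ℝ} {s : ℂ} (h0 : 0 < s.re) (h : s.re < 1 / 2) :
    DifferentiableAt ℂ (kiMellin τ) s := by
  refine kiMellin_differentiableAt_of_kiPole h fun b n hs => ?_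
  have := congrArg re hs
  rw [sub_re, kiPole_re, natCast_re] at this
  have : (0 : ℝ) ≤ n := n.cast_nonneg
  linarith

lemma differentiableAt_weberMellin_strip {α τ : ℝ} {s : ℂ} (h0 : max (-α) 0 < s.re)
    (h : s.re < 1 / 2) : DifferentiableAt ℂ (weberMellin α τ) s := by
  refine ((differentiableAt_kiMellin_strip ((le_max_right _ _).trans_lt h0) h).mul
    (differentiableAt_weberFactor (by linarith) fun n hs => ?_)).const_mul _
  have := congrArg re hs
  simp at this
  have : (0 : ℝ) ≤ n := n.cast_nonneg
  have := (le_max_left (-α) 0).trans_lt h0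
  linarith

lemma stripGrowth_kiIntegrand {x : ℝ} (hx : 0 < x) (τ : ℝ) :
    StripGrowth (-Real.pi) fun s => (x : ℂ) ^ (-s) * kiMellin τ s := by
  simpa using (stripGrowth_cpow hx).mul (stripGrowth_kiMellin τ)

/-- The sum of the residues is the product in the kernel: `a`, `b` stand for `I_{iτ}`, `I_{-iτ}`,
and `C`, `S` for `cosh (πτ)`, `sinh (πτ)`. -/
lemma ki_residue_algebra {p C S : ℂ} (hp : p ≠ 0) (hC : C ≠ 0) (hS : S ≠ 0) (a b : ℂ) :
    p / 2 * (b - a) / (S * I) * (a + b) =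
      1 / (2 * p) * (2 * p * (-(p * C) / (2 * S * C * I) * (a * a) +
        -(p * C) / (2 * -S * C * I) * (b * b))) := by
  field_simp
  ring

/-- The inverse Mellin transform of `kiMellin τ` is `K_{iτ}(√x) [I_{iτ}(√x) + I_{-iτ}(√x)]`. -/
theorem KIKernel_eq_mellinInv_of_ne_zero {γ x τ : ℝ} (h0 : 0 < γ) (h1 : γ < 1 / 2) (hx : 0 < x)
    (hτ : τ ≠ 0) : KIKernel x τ = mellinInv γ (kiMellin τ) x := by
  have hx0 : (x : ℂ) ≠ 0 := ofReal_ne_zero.2 hx.ne'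
  have hdc : ∀ s : ℂ, DifferentiableAt ℂ (fun s : ℂ => (x : ℂ) ^ (-s)) s := fun s =>
    DifferentiableAt.const_cpow (by fun_prop) (Or.inl hx0)
  have hg := stripGrowth_kiIntegrand hx τ
  have hpi := Real.pi_pos
  have hline : Integrable fun t : ℝ =>
      (x : ℂ) ^ (-((γ : ℂ) + t * I)) * kiMellin τ ((γ : ℂ) + t * I) :=
    hg.integrable_vertical (by linarith) (continuous_vertical
      (Ψ := fun s => (x : ℂ) ^ (-s) * kiMellin τ s) (a := 0) (b := 1 / 2)
      (fun s hs hs' => (hdc s).mul (differentiableAt_kiMellin_strip hs hs')) h0 h1)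
  have hleft : Tendsto (fun N : ℕ => ∫ t : ℝ, (x : ℂ) ^ (-(((γ - N : ℝ) : ℂ) + t * I)) *
      kiMellin τ (((γ - N : ℝ) : ℂ) + t * I)) atTop (𝓝 0) := by
    refine tendsto_integral_left_lines (G := fun s => (x : ℂ) ^ (-s) * kiMellin τ s) (K := 4 * x)
      (fun n t => norm_kiIntegrand_sub_one_le hx ?_) hline (by positivity)
    simpa using h1
  have main := integral_vertical_eq_sum_residue_series (q := kiPole τ)
    (r := fun b => kiResidue x (if b then τ else -τ)) (c := γ)
    (G := fun s => (x : ℂ) ^ (-s) * kiMellin τ s) (neg_lt_zero.2 hpi)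
    (injective_sub_natCast (kiPole_im_injective hτ)) (fun b => by rw [kiPole_re]; exact h0)
    (fun b n N => by rw [kiPole_re]; exact natCast_ne_of_mem_Ioo h0 (by linarith) n N)
    (fun s hs hs' => (hdc s).mul (kiMellin_differentiableAt_of_kiPole (hs.trans_lt h1) hs'))
    (fun b n => tendsto_kiPole_residue hx hτ b n) hg hleft (fun b => hasSum_kiResidue hx _)
  have hsh : ((Real.sinh (Real.pi * τ) : ℝ) : ℂ) ≠ 0 :=
    ofReal_ne_zero.2 (Real.sinh_ne_zero.2 (mul_ne_zero hpi.ne' hτ))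
  have hch : ((Real.cosh (Real.pi * τ) : ℝ) : ℂ) ≠ 0 := ofReal_ne_zero.2 (Real.cosh_pos _).ne'
  have hpi0 : (Real.pi : ℂ) ≠ 0 := ofReal_ne_zero.2 hpi.ne'
  have main' : ∫ t : ℝ, (x : ℂ) ^ (-((γ : ℂ) + t * I)) * kiMellin τ (γ + t * I) = _ := main
  rw [Fintype.sum_bool, if_pos rfl, if_neg Bool.false_ne_true, sin_pi_mul_two_I, sin_pi_mul_two_I,
    mul_neg Real.pi τ, Real.sinh_neg, Real.cosh_neg,
    show I * ((-τ : ℝ) : ℂ) = -(I * τ) by push_cast; ring, ofReal_neg] at main'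
  rw [mellinInv]
  simp only [smul_eq_mul]
  rw [main', KIKernel, besselK, if_neg (not_int_of_im_ne_zero (by simpa using hτ)), besselKAux,
    sin_pi_mul_I, real_smul]
  push_cast [-ofReal_sinh, -ofReal_cosh]
  exact ki_residue_algebra hpi0 hch hsh _ _

end BesselResidues

/-! ### Residues of the Weber type kernel -/

section WeberResidues

open Complex

/-- The value of `weberFactor α` at the pole `-iτ - n` of `kiMellin τ`, by the reflection
formula. -/
lemma weberFactor_chain {α τ : ℝ} (hα : -(1 / 2) < α) (hτ : τ ≠ 0) (n : ℕ) :
    weberFactor α (-(I * τ) - n) = Gamma (n + I * τ + 1) * Gamma (n + I * τ + 1) *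
      ((-1) ^ n * Real.pi / (sin (Real.pi * (α - I * τ)) * Gamma (n + -(α - I * τ) + 1))) *
      (Gamma (n + (α + I * τ) + 1))⁻¹ ∧ Gamma (n + -((α : ℂ) - I * τ) + 1) ≠ 0 ∧
      Gamma (n + ((α : ℂ) + I * τ) + 1) ≠ 0 := by
  have hn : (0 : ℝ) ≤ n := n.cast_nonneg
  have hs := sin_pi_mul_ne_zero (w := -((α : ℂ) - I * τ)) (by simpa using hτ)
  obtain ⟨g1, g2⟩ := Gamma_neg_sub_nat hs n
  refine ⟨?_, g1, Gamma_ne_zero_of_re_pos (by simp; linarith)⟩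
  rw [mul_neg, sin_neg] at g2
  rw [weberFactor, show 1 - (-(I * (τ : ℂ)) - n) = n + I * τ + 1 by ring,
    show -(I * (τ : ℂ)) - n + α = -(-(α - I * τ)) - n by ring,
    show 1 + (α : ℂ) - (-(I * τ) - n) = n + (α + I * τ) + 1 by ring, g2, neg_mul, neg_div_neg_eq]

/-- Along the poles `-iτ - n` the factor `weberFactor α` turns the coefficients of `I_{iτ}²` into
those of `J_{α+iτ} J_{-(α-iτ)}`. -/
lemma hasSum_weber_ki_chain {α x τ : ℝ} (hα : -(1 / 2) < α) (hx : 0 < x) (hτ : τ ≠ 0) :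
    HasSum (fun n : ℕ => kiResidue x τ n *
        (((1 / Real.pi ^ 2 : ℝ) : ℂ) * weberFactor α (-(I * τ) - n)))
      (-Real.cosh (Real.pi * τ) / (sin (Real.pi * (I * τ + I * τ)) * sin (Real.pi * (α - I * τ))) *
        (besselJ (α + I * τ) (Real.sqrt x) * besselJ (-(α - I * τ)) (Real.sqrt x))) := by
  have e0 : (α : ℂ) + I * τ + -(α - I * τ) = I * τ + I * τ := by ring
  have h := (hasSum_besselSeries_mul (-1) (α + I * τ) (-(α - I * τ)) (Real.sqrt x)
    (fun n => by rw [e0]; exact Gamma_two_I_add_ne_zero τ n)).mul_left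
    (-Real.cosh (Real.pi * τ) / (sin (Real.pi * (I * τ + I * τ)) * sin (Real.pi * (α - I * τ))))
  rw [← besselJ_eq, ← besselJ_eq] at h
  refine (congrArg (fun f => HasSum f _) (funext fun n => ?_)).mpr h
  obtain ⟨w1, w2, w3⟩ := weberFactor_chain hα hτ n
  have hn : (0 : ℝ) ≤ n := n.cast_nonneg
  have g3 : Gamma (n + I * τ + 1) ≠ 0 := Gamma_ne_zero_of_re_pos (by simp; linarith)
  have g4 : Gamma (I * τ + I * τ + n + 1) ≠ 0 := Gamma_ne_zero_of_re_pos (by simp; linarith)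
  have s1 := sin_pi_mul_ne_zero (w := (α : ℂ) - I * τ) (by simpa using hτ)
  have s2 := sin_pi_mul_ne_zero (w := I * (τ : ℂ) + I * τ) (by
    simp; intro h; apply hτ; linarith)
  have hf : (n.factorial : ℂ) ≠ 0 := by exact_mod_cast n.factorial_ne_zero
  have hpi0 : (Real.pi : ℂ) ≠ 0 := ofReal_ne_zero.2 Real.pi_ne_zero
  rw [cpow_sqrt_half hx (w := I * τ + n) (by ring), w1, e0, kiResidue]
  push_cast
  generalize (x : ℂ) ^ (I * τ + n) * 2 ^ (-(2 * (I * τ + n))) = P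
  generalize Gamma ((n : ℂ) + I * τ + 1) = A at *
  generalize Gamma (I * τ + I * τ + (n : ℂ) + 1) = B at *
  generalize sin (Real.pi * (I * τ + I * τ)) = S at *
  field_simp

/-- The residue at `-α - n` of the integrand of the inverse Mellin transform of
`weberMellin α τ`. -/
noncomputable def weberResidue (α x τ : ℝ) (n : ℕ) : ℂ :=
  Real.cosh (Real.pi * τ) / (sin (Real.pi * (α + I * τ)) * sin (Real.pi * (α - I * τ))) *
    ((-1) ^ n * Gamma (α + I * τ + (α - I * τ) + 2 * n + 1) / ((n.factorial : ℂ) *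
      Gamma (n + (α + I * τ) + 1) * Gamma (n + (α - I * τ) + 1) *
      Gamma (α + I * τ + (α - I * τ) + n + 1)) *
    ((x : ℂ) ^ ((α : ℂ) + n) * 2 ^ (-(2 * ((α : ℂ) + n)))))

lemma hasSum_weberResidue {α x : ℝ} (hα : -(1 / 2) < α) (hx : 0 < x) (τ : ℝ) :
    HasSum (weberResidue α x τ) (Real.cosh (Real.pi * τ) /
      (sin (Real.pi * (α + I * τ)) * sin (Real.pi * (α - I * τ))) *
        (besselJ (α + I * τ) (Real.sqrt x) * besselJ (α - I * τ) (Real.sqrt x))) := by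
  have h := (hasSum_besselSeries_mul (-1) (α + I * τ) (α - I * τ) (Real.sqrt x)
    (fun n => Gamma_ne_zero_of_re_pos (by
      have hn : (0 : ℝ) ≤ n := n.cast_nonneg
      simp; linarith))).mul_left
    (Real.cosh (Real.pi * τ) / (sin (Real.pi * (α + I * τ)) * sin (Real.pi * (α - I * τ))) : ℂ)
  rw [← besselJ_eq, ← besselJ_eq] at h
  refine (congrArg (fun f => HasSum f _) (funext fun n => ?_)).mpr h
  rw [weberResidue, cpow_sqrt_half hx (w := (α : ℂ) + n) (by ring)]

lemma tendsto_weberResidue {α x τ : ℝ} (hα : -(1 / 2) < α) (hx : 0 < x) (hτ : τ ≠ 0) (n : ℕ) :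
    Tendsto (fun s => (s - (-(α : ℂ) - n)) * ((x : ℂ) ^ (-s) * weberMellin α τ s))
      (𝓝[≠] (-(α : ℂ) - n)) (𝓝 (weberResidue α x τ n)) := by
  have hx0 : (x : ℂ) ≠ 0 := ofReal_ne_zero.2 hx.ne'
  have hn : (0 : ℝ) ≤ n := n.cast_nonneg
  set p : ℂ := -(α : ℂ) - n with hp
  have hpre : p.re = -α - n := by simp [hp]
  have hpim : p.im = 0 := by simp [hp]
  set H : ℂ → ℂ := fun s => (x : ℂ) ^ (-s) * (((1 / Real.pi ^ 2 : ℝ) : ℂ) *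
    (kiMellin τ s * (Gamma (1 - s) * Gamma (1 - s) * (Gamma (1 + α - s))⁻¹))) with hH
  have hHc : ContinuousAt H p := by
    have d0 : DifferentiableAt ℂ (fun s : ℂ => (x : ℂ) ^ (-s)) p :=
      DifferentiableAt.const_cpow (by fun_prop) (Or.inl hx0)
    have d1 : DifferentiableAt ℂ Gamma (1 - p) :=
      differentiableAt_Gamma_of_re_pos (by rw [sub_re, hpre, one_re]; linarith)
    have d1' : DifferentiableAt ℂ (fun s => Gamma (1 - s)) p :=
      d1.comp p (f := fun s => 1 - s) (by fun_prop)
    have d4 : Differentiable ℂ fun s : ℂ => (Gamma (1 + α - s))⁻¹ :=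
      differentiable_one_div_Gamma.comp (by fun_prop)
    have d5 : DifferentiableAt ℂ (kiMellin τ) p :=
      kiMellin_differentiableAt_of_kiPole (by rw [hpre]; linarith) fun b m hm => by
        have := congrArg im hm
        rw [hpim, sub_im, natCast_im, sub_zero] at this
        exact kiPole_im_ne_zero hτ b this.symm
    exact (d0.mul ((d5.mul ((d1'.mul d1').mul (d4 p))).const_mul _)).continuousAt
  have hval : (-1) ^ n / (n.factorial : ℂ) * H p = weberResidue α x τ n := by
    have s1 := sin_pi_mul_ne_zero (w := (α : ℂ) + I * τ) (by simpa using hτ)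
    have s2 := sin_pi_mul_ne_zero (w := (α : ℂ) - I * τ) (by simpa using hτ)
    obtain ⟨g1, g2⟩ := Gamma_neg_sub_nat s1 n
    obtain ⟨g1', g2'⟩ := Gamma_neg_sub_nat s2 n
    have dup := Gamma_mul_Gamma_add_half ((α : ℂ) + n + 1 / 2)
    have g3 : Gamma ((n : ℂ) + α + 1) ≠ 0 :=
      Gamma_ne_zero_of_re_pos (by simp; linarith)
    have g4 : Gamma ((α : ℂ) + I * τ + (α - I * τ) + n + 1) ≠ 0 :=
      Gamma_ne_zero_of_re_pos (by simp; linarith)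
    have hsqrt : ((Real.sqrt Real.pi : ℝ) : ℂ) ≠ 0 :=
      ofReal_ne_zero.2 (Real.sqrt_pos.2 Real.pi_pos).ne'
    have hpi0 : (Real.pi : ℂ) ≠ 0 := ofReal_ne_zero.2 Real.pi_ne_zero
    have hsq : ((-1 : ℂ) ^ n) * (-1) ^ n = 1 := by rw [← mul_pow]; norm_num
    have hf : (n.factorial : ℂ) ≠ 0 := by exact_mod_cast n.factorial_ne_zero
    rw [show (α : ℂ) + n + 1 / 2 + 1 / 2 = n + α + 1 by ring,
      show 2 * ((α : ℂ) + n + 1 / 2) = α + I * τ + (α - I * τ) + 2 * n + 1 by ring,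
      show 1 - ((α : ℂ) + I * τ + (α - I * τ) + 2 * n + 1) = -(2 * ((α : ℂ) + n)) by ring] at dup
    have e1 : 1 / 2 - p = (α : ℂ) + n + 1 / 2 := by rw [hp]; ring
    have e2 : p - I * τ = -((α : ℂ) + I * τ) - n := by rw [hp]; ring
    have e2' : p + I * τ = -((α : ℂ) - I * τ) - n := by rw [hp]; ring
    have e3 : 1 - p = (n : ℂ) + α + 1 := by rw [hp]; ring
    have e4 : -p = (α : ℂ) + n := by rw [hp]; ring
    have e5 : 1 + (α : ℂ) - p = α + I * τ + (α - I * τ) + n + 1 := by rw [hp]; ring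
    simp only [hH, weberResidue, kiMellin]
    rw [e1, e2, e2', e3, e4, e5, g2, g2', eq_div_of_mul_eq g3 dup]
    push_cast
    generalize Gamma ((n : ℂ) + (α + I * τ) + 1) = A at *
    generalize Gamma ((n : ℂ) + (α - I * τ) + 1) = B at *
    generalize Gamma ((α : ℂ) + I * τ + (α - I * τ) + n + 1) = C at *
    generalize Gamma ((α : ℂ) + I * τ + (α - I * τ) + 2 * n + 1) = D at *
    generalize sin (Real.pi * ((α : ℂ) + I * τ)) = S at *
    generalize sin (Real.pi * ((α : ℂ) - I * τ)) = S' at *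
    generalize (2 : ℂ) ^ (-(2 * ((α : ℂ) + n))) = P at *
    generalize (x : ℂ) ^ ((α : ℂ) + n) = Q at *
    refine (?_ : _ = ((-1 : ℂ) ^ n * (-1) ^ n) * _).trans (by rw [hsq, one_mul])
    field_simp
  rw [← hval]
  refine (tendsto_residue_Gamma_mul (α : ℂ) n hHc).congr fun s => ?_
  simp only [hH, weberMellin, weberFactor]
  ring

lemma norm_weberFactor_sub_one_le {α δ : ℝ} (hδ : 0 < δ) {s : ℂ} (h : s.re < 1)
    (h1 : δ ≤ |s.re - 1 + α|) (h2 : δ ≤ |1 + α - s.re|) :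
    ‖weberFactor α (s - 1)‖ ≤ (1 + |α| / δ) * (1 + |α| / δ) * ‖weberFactor α s‖ := by
  have n1 : δ ≤ ‖s - 1 + α‖ := h1.trans (by simpa using abs_re_le_norm (s - 1 + α))
  have n2 : δ ≤ ‖1 + α - s‖ := h2.trans (by simpa using abs_re_le_norm (1 + α - s))
  have ratio : ∀ z : ℂ, δ ≤ ‖z‖ → ‖1 - s‖ ≤ ‖z‖ + |α| → ‖1 - s‖ / ‖z‖ ≤ 1 + |α| / δ := by
    intro z hz hle
    have hz0 : 0 < ‖z‖ := hδ.trans_le hz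
    calc ‖1 - s‖ / ‖z‖ ≤ (‖z‖ + |α|) / ‖z‖ := by gcongr
      _ = 1 + |α| / ‖z‖ := by field_simp
      _ ≤ _ := by gcongr
  have r1 := ratio _ n1 (by
    have := norm_sub_le (α : ℂ) (s - 1 + α)
    rw [show (α : ℂ) - (s - 1 + α) = 1 - s by ring, norm_real, Real.norm_eq_abs] at this
    linarith)
  have r2 := ratio _ n2 (by
    have := norm_sub_le (1 + α - s) (α : ℂ)
    rw [show (1 + α - s) - (α : ℂ) = 1 - s by ring, norm_real, Real.norm_eq_abs] at this
    linarith)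
  rw [weberFactor_sub_one h (norm_pos_iff.1 (hδ.trans_le n1)) (norm_pos_iff.1 (hδ.trans_le n2)),
    norm_mul, norm_div, norm_mul, norm_mul, mul_div_mul_comm]
  gcongr

/-- The pole chains of `weberMellin α τ`: those of `kiMellin τ` and `-α - n`. -/
noncomputable def weberPole (α τ : ℝ) : Option Bool → ℂ
  | none => -α
  | some b => kiPole τ b

lemma weberPole_im_injective (α : ℝ) {τ : ℝ} (hτ : τ ≠ 0) :
    Function.Injective fun i => (weberPole α τ i).im := by
  rintro (_ | b) (_ | b') h
  · rfl
  · exact absurd (by simpa [weberPole] using h.symm) (kiPole_im_ne_zero hτ b')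
  · exact absurd (by simpa [weberPole] using h) (kiPole_im_ne_zero hτ b)
  · exact congrArg some (kiPole_im_injective hτ h)

lemma stripGrowth_weberIntegrand (α : ℝ) {x : ℝ} (hx : 0 < x) (τ : ℝ) :
    StripGrowth (-(2 * Real.pi)) fun s => (x : ℂ) ^ (-s) * weberMellin α τ s := by
  simpa using (stripGrowth_cpow hx).mul (stripGrowth_weberMellin α τ)

lemma weber_integrand_eq (α x τ : ℝ) (s : ℂ) : (x : ℂ) ^ (-s) * weberMellin α τ s =
    (x : ℂ) ^ (-s) * kiMellin τ s * (((1 / Real.pi ^ 2 : ℝ) : ℂ) * weberFactor α s) := by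
  rw [weberMellin]; ring

lemma differentiableAt_weberMellin_of_weberPole {α τ : ℝ} {s : ℂ} (h : s.re < 1 / 2)
    (hs : ∀ i, ∀ n : ℕ, s ≠ weberPole α τ i - n) : DifferentiableAt ℂ (weberMellin α τ) s :=
  ((kiMellin_differentiableAt_of_kiPole h fun b n => hs (some b) n).mul
    (differentiableAt_weberFactor (by linarith) fun n => hs none n)).const_mul _

/-- The residues of the integrand of the inverse Mellin transform of `weberMellin α τ`. -/
noncomputable def weberChainResidue (α x τ : ℝ) : Option Bool → ℕ → ℂ
  | none, n => weberResidue α x τ n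
  | some b, n => kiResidue x (if b then τ else -τ) n *
      (((1 / Real.pi ^ 2 : ℝ) : ℂ) * weberFactor α (-(I * (if b then τ else -τ : ℝ)) - n))

lemma tendsto_weberChainResidue {α x τ : ℝ} (hα : -(1 / 2) < α) (hx : 0 < x) (hτ : τ ≠ 0)
    (i : Option Bool) (n : ℕ) :
    Tendsto (fun s => (s - (weberPole α τ i - n)) * ((x : ℂ) ^ (-s) * weberMellin α τ s))
      (𝓝[≠] (weberPole α τ i - n)) (𝓝 (weberChainResidue α x τ i n)) := by
  cases i with
  | none => exact tendsto_weberResidue hα hx hτ n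
  | some b =>
    have e : -(I * ((if b then τ else -τ : ℝ) : ℂ)) - n = kiPole τ b - n := by
      cases b <;> simp [kiPole]
    have hc : ContinuousAt (weberFactor α) (kiPole τ b - n) := by
      refine (differentiableAt_weberFactor ?_ fun m hm => ?_).continuousAt
      · have hn : (0 : ℝ) ≤ n := n.cast_nonneg
        rw [sub_re, kiPole_re, natCast_re]; linarith
      · have := congrArg im hm
        simp only [sub_im, natCast_im, sub_zero, neg_im, ofReal_im, neg_zero] at this
        exact kiPole_im_ne_zero hτ b this
    simp only [weberPole, weberChainResidue, e]
    refine ((tendsto_kiPole_residue hx hτ b n).mul (tendsto_nhdsWithin_of_tendsto_nhds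
      (hc.tendsto.const_mul ((1 / Real.pi ^ 2 : ℝ) : ℂ)))).congr fun s => ?_
    rw [weber_integrand_eq]
    ring

/-- The sums of the residues of the integrand along the pole chains, as products of Bessel
functions. -/
noncomputable def weberChainSum (α x τ : ℝ) : Option Bool → ℂ
  | none => Real.cosh (Real.pi * τ) /
      (sin (Real.pi * (α + I * τ)) * sin (Real.pi * (α - I * τ))) *
        (besselJ (α + I * τ) (Real.sqrt x) * besselJ (α - I * τ) (Real.sqrt x))
  | some true => -Real.cosh (Real.pi * τ) /
      (sin (Real.pi * (I * τ + I * τ)) * sin (Real.pi * (α - I * τ))) *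
        (besselJ (α + I * τ) (Real.sqrt x) * besselJ (-(α - I * τ)) (Real.sqrt x))
  | some false => Real.cosh (Real.pi * τ) /
      (sin (Real.pi * (I * τ + I * τ)) * sin (Real.pi * (α + I * τ))) *
        (besselJ (α - I * τ) (Real.sqrt x) * besselJ (-(α + I * τ)) (Real.sqrt x))

lemma hasSum_weberChainResidue {α x τ : ℝ} (hα : -(1 / 2) < α) (hx : 0 < x) (hτ : τ ≠ 0)
    (i : Option Bool) : HasSum (weberChainResidue α x τ i) (weberChainSum α x τ i) := by
  match i with
  | none => exact hasSum_weberResidue hα hx τ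
  | some true => exact hasSum_weber_ki_chain hα hx hτ
  | some false =>
    have h := hasSum_weber_ki_chain hα hx (neg_ne_zero.2 hτ)
    have e : -((Real.cosh (Real.pi * -τ) : ℝ) : ℂ) /
        (sin (Real.pi * (I * ((-τ : ℝ) : ℂ) + I * ((-τ : ℝ) : ℂ))) *
          sin (Real.pi * (α - I * ((-τ : ℝ) : ℂ)))) *
        (besselJ (α + I * ((-τ : ℝ) : ℂ)) (Real.sqrt x) *
          besselJ (-(α - I * ((-τ : ℝ) : ℂ))) (Real.sqrt x)) = weberChainSum α x τ (some false) := by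
      have a1 : (α : ℂ) - I * ((-τ : ℝ) : ℂ) = α + I * τ := by push_cast; ring
      have a2 : (α : ℂ) + I * ((-τ : ℝ) : ℂ) = α - I * τ := by push_cast; ring
      have a3 : (Real.pi : ℂ) * (I * ((-τ : ℝ) : ℂ) + I * ((-τ : ℝ) : ℂ)) =
          -(Real.pi * (I * τ + I * τ)) := by push_cast; ring
      rw [a1, a2, a3, sin_neg, mul_neg, Real.cosh_neg, neg_mul, neg_div_neg_eq]
      rfl
    rw [e] at h
    exact h

/-- The inverse Mellin transform of `weberMellin α τ` as a combination of products of Bessel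
functions. The line of integration is such that its translates by integers avoid the poles
`-α - n`. -/
lemma integral_weberIntegrand {α c x τ : ℝ} (hc : max (-α) 0 < c) (hc' : c < 1 / 2)
    (hcα : ∀ k : ℤ, c + α ≠ k) (hx : 0 < x) (hτ : τ ≠ 0) :
    ∫ t : ℝ, (x : ℂ) ^ (-((c : ℂ) + t * I)) * weberMellin α τ (c + t * I) =
      2 * Real.pi * ∑ i, weberChainSum α x τ i := by
  have hx0 : (x : ℂ) ≠ 0 := ofReal_ne_zero.2 hx.ne'
  have h0 : 0 < c := (le_max_right _ _).trans_lt hc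
  have hαc : -α < c := (le_max_left _ _).trans_lt hc
  have hα : -(1 / 2) < α := by linarith
  have hdc : ∀ s : ℂ, DifferentiableAt ℂ (fun s : ℂ => (x : ℂ) ^ (-s)) s := fun s =>
    DifferentiableAt.const_cpow (by fun_prop) (Or.inl hx0)
  have hg := stripGrowth_weberIntegrand α hx τ
  have he : -(2 * Real.pi) < 0 := by have := Real.pi_pos; linarith
  have hline : Integrable fun t : ℝ =>
      (x : ℂ) ^ (-((c : ℂ) + t * I)) * weberMellin α τ ((c : ℂ) + t * I) :=
    hg.integrable_vertical he (continuous_vertical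
      (Ψ := fun s => (x : ℂ) ^ (-s) * weberMellin α τ s) (a := max (-α) 0) (b := 1 / 2)
      (fun s hs hs' => (hdc s).mul (differentiableAt_weberMellin_strip hs hs')) hc hc')
  -- `δ` separates the translates of the line from the poles `-α - n` and from the zeros `1 + α + n`
  -- of `1 / Γ(1 + α - s)`, uniformly in the translation
  obtain ⟨δ, hδ, hδ1, hδ2⟩ : ∃ δ : ℝ, 0 < δ ∧ δ ≤ 1 + α - c ∧ ∀ k : ℤ, δ ≤ |c + α - k| := by
    have hr : 0 < |c + α - round (c + α)| := abs_pos.2 (sub_ne_zero.2 (hcα _))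
    exact ⟨min (1 + α - c) |c + α - round (c + α)|, lt_min (by linarith) hr, min_le_left _ _,
      fun k => (min_le_right _ _).trans (round_le _ k)⟩
  have hleft : Tendsto (fun N : ℕ => ∫ t : ℝ, (x : ℂ) ^ (-(((c - N : ℝ) : ℂ) + t * I)) *
      weberMellin α τ (((c - N : ℝ) : ℂ) + t * I)) atTop (𝓝 0) := by
    refine tendsto_integral_left_lines (G := fun s => (x : ℂ) ^ (-s) * weberMellin α τ s)
      (K := 4 * x * ((1 + |α| / δ) * (1 + |α| / δ))) (fun n t => ?_) hline (by positivity)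
    have hn : (0 : ℝ) ≤ n := n.cast_nonneg
    have hre : (((c - n : ℝ) : ℂ) + t * I).re = c - n := by simp
    set s : ℂ := ((c - n : ℝ) : ℂ) + t * I
    have b1 := norm_kiIntegrand_sub_one_le (τ := τ) hx (s := s) (n := n) (by rw [hre]; linarith)
    have b2 := norm_weberFactor_sub_one_le (α := α) hδ (s := s) (by rw [hre]; linarith)
      (by
        have := hδ2 (n + 1)
        rw [hre]
        convert this using 2
        push_cast; ring)
      (by rw [hre, abs_of_pos (by linarith)]; linarith)
    simp only [weber_integrand_eq]
    rw [norm_mul (_ * kiMellin τ (s - 1)), norm_mul (_ * kiMellin τ s),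
      norm_mul _ (weberFactor α (s - 1)), norm_mul _ (weberFactor α s)]
    calc _ ≤ (4 * x / (n + 1) * ‖(x : ℂ) ^ (-s) * kiMellin τ s‖) * (‖((1 / Real.pi ^ 2 : ℝ) : ℂ)‖ *
          ((1 + |α| / δ) * (1 + |α| / δ) * ‖weberFactor α s‖)) := by gcongr
      _ = _ := by ring
  refine integral_vertical_eq_sum_residue_series (q := weberPole α τ) (c := c)
    (r := weberChainResidue α x τ) (G := fun s => (x : ℂ) ^ (-s) * weberMellin α τ s) he
    (injective_sub_natCast (weberPole_im_injective α hτ)) ?_ ?_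
    (fun s hs hs' => (hdc s).mul (differentiableAt_weberMellin_of_weberPole (hs.trans_lt hc') hs'))
    (tendsto_weberChainResidue hα hx hτ) hg hleft (hasSum_weberChainResidue hα hx hτ)
  · rintro (_ | b)
    · simpa [weberPole] using hαc
    · simpa only [weberPole, kiPole_re] using h0
  · rintro (_ | b) n N h
    · refine hcα (N - n) ?_
      simp only [weberPole, neg_re, ofReal_re] at h
      push_cast; linarith
    · simp only [weberPole, kiPole_re] at h
      exact natCast_ne_of_mem_Ioo h0 (by linarith) n N h

end WeberResidues

/-! ### The kernels as inverse Mellin transforms -/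

section KernelRepresentation

open Complex

/-- The imaginary part of `J_{α+iτ} Y_{α-iτ}` is the sum of the residues: `A`, `B`, `D`, `E` stand
for `J_{α+iτ}`, `J_{α-iτ}`, `J_{-(α-iτ)}`, `J_{-(α+iτ)}`, the pairs `s`, `c` and `s'`, `c'` for sine
and cosine of `π(α + iτ)` and `π(α - iτ)`, and `C`, `S` for `cosh (πτ)`, `sinh (πτ)`. -/
lemma weber_residue_algebra {p C S A B D E s s' c c' : ℂ} (hp : p ≠ 0) (hC : C ≠ 0) (hS : S ≠ 0)
    (hs : s ≠ 0) (hs' : s' ≠ 0) (h : s * c' - c * s' = 2 * S * C * I) :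
    (A * ((B * c' - D) / s') - B * ((A * c - E) / s)) / (2 * I) / S =
      1 / (2 * p) * (2 * p * (C / (s * s') * (A * B) +
        (-C / (2 * S * C * I * s') * (A * D) + C / (2 * S * C * I * s) * (B * E)))) := by
  field_simp
  linear_combination (A * B) * h

/-- Away from `τ = 0` the kernel is the inverse Mellin transform of `weberMellin α τ`. -/
theorem weberQuotient_eq_mellinInv {α γ x τ : ℝ} (hγ : max (-α) 0 < γ) (hγ' : γ < 1 / 2)
    (hx : 0 < x) (hτ : τ ≠ 0) :
    ((weberQuotient α x τ : ℝ) : ℂ) = mellinInv γ (weberMellin α τ) x := by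
  -- the residue series needs a line whose translates by integers miss the poles `-α - n`; all but
  -- countably many lines in the strip qualify
  obtain ⟨c, hc, hcα⟩ : ∃ c ∈ Ioo (max (-α) 0) (1 / 2), ∀ k : ℤ, c + α ≠ k := by
    have hcount : (range fun k : ℤ => (k : ℝ) - α).Countable := countable_range _
    obtain ⟨c, hc, hc'⟩ := (hcount.dense_compl ℝ).exists_mem_open isOpen_Ioo
      (nonempty_Ioo.2 (hγ.trans hγ'))
    exact ⟨c, hc', fun k hk => hc ⟨k, by simp only; linarith⟩⟩
  have he : -(2 * Real.pi) < 0 := by have := Real.pi_pos; linarith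
  have hcγ : mellinInv γ (weberMellin α τ) x = mellinInv c (weberMellin α τ) x := by
    rcases le_total γ c with h | h
    · exact mellinInv_eq_of_strip he (stripGrowth_weberMellin α τ)
        (fun s => differentiableAt_weberMellin_strip) hγ h hc.2 hx
    · exact (mellinInv_eq_of_strip he (stripGrowth_weberMellin α τ)
        (fun s => differentiableAt_weberMellin_strip) hc.1 h hγ' hx).symm
  have hpi0 : (Real.pi : ℂ) ≠ 0 := ofReal_ne_zero.2 Real.pi_ne_zero
  have hsh : ((Real.sinh (Real.pi * τ) : ℝ) : ℂ) ≠ 0 :=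
    ofReal_ne_zero.2 (Real.sinh_ne_zero.2 (mul_ne_zero Real.pi_ne_zero hτ))
  have hch : ((Real.cosh (Real.pi * τ) : ℝ) : ℂ) ≠ 0 := ofReal_ne_zero.2 (Real.cosh_pos _).ne'
  have s1 := sin_pi_mul_ne_zero (w := (α : ℂ) + I * τ) (by simpa using hτ)
  have s2 := sin_pi_mul_ne_zero (w := (α : ℂ) - I * τ) (by simpa using hτ)
  have hxs : 0 < Real.sqrt x := Real.sqrt_pos.2 hx
  have c1 : (starRingEnd ℂ) ((α : ℂ) + I * τ) = α - I * τ := by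
    simp [sub_eq_add_neg]
  have c2 : (starRingEnd ℂ) ((α : ℂ) - I * τ) = α + I * τ := by
    rw [← c1, conj_conj]
  have hY : besselY (α - I * τ) (Real.sqrt x) =
      (besselJ (α - I * τ) (Real.sqrt x) * cos (Real.pi * (α - I * τ)) -
        besselJ (-(α - I * τ)) (Real.sqrt x)) / sin (Real.pi * (α - I * τ)) := by
    rw [besselY, if_neg (not_int_of_im_ne_zero (by simpa using hτ)), besselYAux,
      mul_comm (_ - _) (Real.pi : ℂ)]
  have hconj : (starRingEnd ℂ) (besselJ (α + I * τ) (Real.sqrt x) *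
      besselY (α - I * τ) (Real.sqrt x)) = besselJ (α - I * τ) (Real.sqrt x) *
      ((besselJ (α + I * τ) (Real.sqrt x) * cos (Real.pi * (α + I * τ)) -
        besselJ (-(α + I * τ)) (Real.sqrt x)) / sin (Real.pi * (α + I * τ))) := by
    rw [hY, map_mul, map_div₀, map_sub, map_mul, conj_besselJ _ hxs, conj_besselJ _ hxs,
      conj_besselJ _ hxs, ← cos_conj, ← sin_conj, map_neg, map_mul, conj_ofReal, c1, c2]
  have hsin : sin (Real.pi * ((α : ℂ) + I * τ)) * cos (Real.pi * ((α : ℂ) - I * τ)) -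
      cos (Real.pi * ((α : ℂ) + I * τ)) * sin (Real.pi * ((α : ℂ) - I * τ)) =
      2 * (Real.sinh (Real.pi * τ) : ℝ) * (Real.cosh (Real.pi * τ) : ℝ) * I := by
    rw [← sin_sub, ← sin_pi_mul_two_I]
    congr 1; ring
  rw [hcγ, mellinInv, weberQuotient, ofReal_div, im_eq_sub_conj, hconj, hY]
  simp only [smul_eq_mul]
  rw [integral_weberIntegrand hc.1 hc.2 hcα hx hτ, Fintype.sum_option, Fintype.sum_bool]
  simp only [weberChainSum]
  rw [sin_pi_mul_two_I, real_smul]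
  push_cast [-ofReal_sinh, -ofReal_cosh]
  exact weber_residue_algebra hpi0 hch hsh s1 s2 hsin

lemma norm_Gamma_mul_Gamma_le_beta {s : ℂ} (hs : 0 < s.re) (τ : ℝ) :
    ‖Gamma (s + I * τ) * Gamma (s - I * τ)‖ ≤
      ProbabilityTheory.beta s.re s.re * ‖Gamma (2 * s)‖ := by
  have h1 : (s + I * τ).re = s.re := by simp
  have h2 : (s - I * τ).re = s.re := by simp
  have hb := norm_betaIntegral_le (u := s + I * τ) (v := s - I * τ) (h1 ▸ hs) (h2 ▸ hs)
  rw [Gamma_mul_Gamma_eq_betaIntegral (h1 ▸ hs) (h2 ▸ hs),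
    show s + I * τ + (s - I * τ) = 2 * s by ring, norm_mul, mul_comm]
  rw [h1, h2] at hb
  gcongr

/-- The bound by the value of the beta function, uniform in `τ` after division by `cosh (πτ)`. -/
lemma norm_kiMellin_le {s : ℂ} (hs : 0 < s.re) (τ : ℝ) : ‖kiMellin τ s‖ ≤
    Real.cosh (Real.pi * τ) * (ProbabilityTheory.beta s.re s.re *
      ‖((1 / Real.sqrt Real.pi : ℝ) : ℂ) *
        (Gamma (1 / 2 - s) * Gamma (2 * s) * (Gamma (1 - s))⁻¹)‖) := by
  have hch := Real.cosh_pos (Real.pi * τ)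
  have hpi := Real.sqrt_pos.2 Real.pi_pos
  have h := norm_Gamma_mul_Gamma_le_beta hs τ
  rw [norm_mul] at h
  rw [kiMellin]
  simp only [norm_mul, norm_real]
  rw [Real.norm_of_nonneg (by positivity), Real.norm_of_nonneg (by positivity)]
  calc Real.cosh (Real.pi * τ) / Real.sqrt Real.pi * (‖Gamma (1 / 2 - s)‖ * ‖Gamma (s + I * τ)‖ *
        ‖Gamma (s - I * τ)‖ * ‖(Gamma (1 - s))⁻¹‖)
      = Real.cosh (Real.pi * τ) / Real.sqrt Real.pi * ‖Gamma (1 / 2 - s)‖ * ‖(Gamma (1 - s))⁻¹‖ *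
        (‖Gamma (s + I * τ)‖ * ‖Gamma (s - I * τ)‖) := by ring
    _ ≤ Real.cosh (Real.pi * τ) / Real.sqrt Real.pi * ‖Gamma (1 / 2 - s)‖ * ‖(Gamma (1 - s))⁻¹‖ *
        (ProbabilityTheory.beta s.re s.re * ‖Gamma (2 * s)‖) := by gcongr
    _ = _ := by ring

/-- The pointwise bound behind the constant `C_γ`: the duplication formula at `1/2 - s` and the
reflection formula at `2s` combine the Gamma factors into `1 / sin (2πs)`. -/
lemma norm_weberMellin_le {α : ℝ} {s : ℂ} (hs : 0 < s.re) (hs' : s.re < 1 / 2) (τ : ℝ) :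
    ‖weberMellin α τ s‖ ≤ Real.cosh (Real.pi * τ) *
      (2 ^ (2 * s.re) / Real.pi * ProbabilityTheory.beta s.re s.re * normIntegrand α s) := by
  have hpi := Real.pi_pos
  have h1 : Gamma (1 - s) ≠ 0 := Gamma_ne_zero_of_re_pos (by rw [sub_re, one_re]; linarith)
  have dup := congrArg norm (Gamma_mul_Gamma_add_half (1 / 2 - s))
  have hrefl := congrArg norm (Gamma_mul_Gamma_one_sub (2 * s))
  rw [show 1 / 2 - s + 1 / 2 = 1 - s by ring, show 2 * (1 / 2 - s) = 1 - 2 * s by ring,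
    show 1 - (1 - 2 * s) = 2 * s by ring] at dup
  have h2 : ‖(2 : ℂ) ^ (2 * s)‖ = 2 ^ (2 * s.re) := by
    rw [← ofReal_ofNat, norm_cpow_eq_rpow_re_of_pos two_pos]; simp
  rw [norm_mul, norm_mul, norm_mul, h2, norm_real,
    Real.norm_of_nonneg (Real.sqrt_nonneg _)] at dup
  rw [norm_mul, norm_div, norm_real, Real.norm_of_nonneg hpi.le,
    show (Real.pi : ℂ) * (2 * s) = 2 * Real.pi * s by ring] at hrefl
  rw [weberMellin, norm_mul, norm_mul, norm_real, Real.norm_of_nonneg (by positivity)]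
  have hk := norm_kiMellin_le hs τ
  have hq := Real.sqrt_pos.2 hpi
  calc _ ≤ 1 / Real.pi ^ 2 * ((Real.cosh (Real.pi * τ) * (ProbabilityTheory.beta s.re s.re *
      ‖((1 / Real.sqrt Real.pi : ℝ) : ℂ) *
        (Gamma (1 / 2 - s) * Gamma (2 * s) * (Gamma (1 - s))⁻¹)‖)) * ‖weberFactor α s‖) := by gcongr
    _ = _ := by
      rw [weberFactor, normIntegrand]
      simp only [norm_mul, norm_inv, norm_real]
      rw [Real.norm_of_nonneg (by positivity)]
      have h1' := norm_ne_zero_iff.2 h1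
      have e : ‖Gamma (1 / 2 - s)‖ * ‖Gamma (1 - s)‖ * ‖Gamma (2 * s)‖ =
          2 ^ (2 * s.re) * Real.sqrt Real.pi * (Real.pi / ‖sin (2 * Real.pi * s)‖) := by
        rw [dup, ← hrefl]; ring
      calc _ = Real.cosh (Real.pi * τ) * ProbabilityTheory.beta s.re s.re *
            (‖Gamma (1 / 2 - s)‖ * ‖Gamma (1 - s)‖ * ‖Gamma (2 * s)‖) *
            (‖Gamma (s + α)‖ * ‖Gamma (1 + α - s)‖⁻¹) / (Real.pi ^ 2 * Real.sqrt Real.pi) := by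
            field_simp
        _ = _ := by
            rw [e]
            field_simp

/-- The reciprocal of `sin (2πs)` as a product of Gamma functions. -/
lemma inv_sin_two_pi (s : ℂ) : (sin (2 * Real.pi * s))⁻¹ =
    ((1 / (2 * Real.pi ^ 2) : ℝ) : ℂ) *
      (Gamma s * Gamma (1 - s) * (Gamma (s + 1 / 2) * Gamma (1 / 2 - s))) := by
  have h1 := Gamma_mul_Gamma_one_sub s
  have h2 := Gamma_mul_Gamma_one_sub (s + 1 / 2)
  rw [show 1 - (s + 1 / 2) = 1 / 2 - s by ring,
    show (Real.pi : ℂ) * (s + 1 / 2) = Real.pi * s + Real.pi / 2 by ring, sin_add_pi_div_two] at h2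
  have hpi0 : (Real.pi : ℂ) ≠ 0 := ofReal_ne_zero.2 Real.pi_ne_zero
  rw [h1, h2, show 2 * (Real.pi : ℂ) * s = 2 * (Real.pi * s) by ring, sin_two_mul]
  push_cast
  rw [mul_inv, mul_inv]
  field_simp

lemma continuous_Gamma_vertical {σ : ℝ} {g : ℂ → ℂ} (hg : Continuous g)
    (h : ∀ s : ℂ, s.re = σ → 0 < (g s).re) : Continuous fun t : ℝ => Gamma (g (σ + t * I)) :=
  continuous_iff_continuousAt.2 fun t => ContinuousAt.comp (g := Gamma)
    (f := fun t : ℝ => g (σ + t * I))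
    (differentiableAt_Gamma_of_re_pos (h _ (by simp))).continuousAt (by fun_prop)

lemma continuous_Gamma_inv_vertical {σ : ℝ} {g : ℂ → ℂ} (hg : Continuous g) :
    Continuous fun t : ℝ => (Gamma (g (σ + t * I)))⁻¹ :=
  differentiable_one_div_Gamma.continuous.comp (by fun_prop)

theorem integrable_normIntegrand {α γ : ℝ} (hγ : max (-α) 0 < γ) (hγ' : γ < 1 / 2) :
    Integrable fun t : ℝ => normIntegrand α (γ + t * I) := by
  have h0 : 0 < γ := (le_max_right _ _).trans_lt hγ
  have hαγ : -α < γ := (le_max_left _ _).trans_lt hγ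
  have hpi := Real.pi_pos
  set f : ℂ → ℂ := fun s => (Gamma (s + α) * (Gamma (1 + α - s))⁻¹) *
    (((1 / (2 * Real.pi ^ 2) : ℝ) : ℂ) *
      (Gamma s * Gamma (1 - s) * (Gamma (s + 1 / 2) * Gamma (1 / 2 - s)))) with hf
  have hfn : ∀ s, normIntegrand α s = ‖f s‖ := by
    intro s
    rw [normIntegrand, hf]
    simp only
    rw [← inv_sin_two_pi]
    simp only [norm_mul, norm_inv]
    rw [div_eq_mul_inv, mul_inv]
    ring
  have hg : StripGrowth (-(2 * Real.pi)) f := by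
    have := ((stripGrowth_Gamma.comp_add α).mul (stripGrowth_Gamma_inv.comp_sub (1 + α))).mul
      ((stripGrowth_const ((1 / (2 * Real.pi ^ 2) : ℝ) : ℂ)).mul
        ((stripGrowth_Gamma.mul (stripGrowth_Gamma.comp_sub 1)).mul
          ((stripGrowth_Gamma.comp_add (1 / 2)).mul (stripGrowth_Gamma.comp_sub (1 / 2)))))
    convert this using 1
    ring
  have hhalf : ((1 : ℂ) / 2).re = 1 / 2 := by norm_num
  have hc : Continuous fun t : ℝ => f (γ + t * I) := by
    refine ((continuous_Gamma_vertical (g := fun s => s + α) (by fun_prop) fun s hs => ?_).mul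
      (continuous_Gamma_inv_vertical (g := fun s => 1 + α - s) (by fun_prop))).mul
      (continuous_const.mul
      (((continuous_Gamma_vertical (g := fun s => s) (by fun_prop) fun s hs => ?_).mul
        (continuous_Gamma_vertical (g := fun s => 1 - s) (by fun_prop) fun s hs => ?_)).mul
      ((continuous_Gamma_vertical (g := fun s => s + 1 / 2) (by fun_prop) fun s hs => ?_).mul
        (continuous_Gamma_vertical (g := fun s => 1 / 2 - s) (by fun_prop) fun s hs => ?_))))
    · rw [add_re, ofReal_re, hs]; linarith
    · rw [hs]; exact h0
    · rw [sub_re, one_re, hs]; linarith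
    · rw [add_re, hhalf, hs]; linarith
    · rw [sub_re, hhalf, hs]; linarith
  simp_rw [hfn]
  exact (hg.integrable_vertical (by linarith) hc).norm

lemma mellinInv_real_mul (c : ℝ) (Ψ : ℂ → ℂ) (σ x : ℝ) :
    mellinInv σ (fun s => (c : ℂ) * Ψ s) x = (c : ℂ) * mellinInv σ Ψ x := by
  simp only [mellinInv, smul_eq_mul, real_smul]
  simp_rw [mul_left_comm _ (c : ℂ)]
  rw [integral_const_mul]
  ring

/-- Continuity in `τ` of an inverse Mellin transform dominated by `cosh (πτ)`. -/
lemma continuous_mellinInv_param {Ψ : ℝ → ℂ → ℂ} {σ x : ℝ} (hx : 0 < x) {b : ℝ → ℝ}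
    (hb : Integrable b) (hle : ∀ τ t : ℝ, ‖Ψ τ (σ + t * I)‖ ≤ Real.cosh (Real.pi * τ) * b t)
    (hm : ∀ τ : ℝ, Continuous fun t : ℝ => Ψ τ (σ + t * I))
    (hc : ∀ t : ℝ, Continuous fun τ : ℝ => Ψ τ (σ + t * I)) :
    Continuous fun τ : ℝ => mellinInv σ (Ψ τ) x := by
  have hch : ∀ τ : ℝ, 0 < Real.cosh (Real.pi * τ) := fun τ => Real.cosh_pos _
  have hx0 : (x : ℂ) ≠ 0 := ofReal_ne_zero.2 hx.ne'
  have hcosh : Continuous fun τ : ℝ => (((Real.cosh (Real.pi * τ))⁻¹ : ℝ) : ℂ) :=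
    continuous_ofReal.comp ((Real.continuous_cosh.comp (by fun_prop)).inv₀ fun τ => (hch τ).ne')
  have h1 : Continuous fun τ : ℝ =>
      mellinInv σ (fun s => (((Real.cosh (Real.pi * τ))⁻¹ : ℝ) : ℂ) * Ψ τ s) x := by
    simp only [mellinInv]
    refine Continuous.const_smul ?_ _
    refine continuous_of_dominated (bound := fun t => x ^ (-σ) * b t) (fun τ => ?_) (fun τ => ?_)
      (hb.const_mul _) (Eventually.of_forall fun t => ?_)
    · refine Continuous.aestronglyMeasurable ?_
      exact (Continuous.const_cpow (by fun_prop) (Or.inl hx0)).smul (continuous_const.mul (hm τ))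
    · refine Eventually.of_forall fun t => ?_
      rw [norm_smul, norm_cpow_eq_rpow_re_of_pos hx, norm_mul, norm_real,
        Real.norm_of_nonneg (inv_pos.2 (hch τ)).le]
      have e : (-((σ : ℂ) + t * I)).re = -σ := by simp
      rw [e]
      gcongr
      rw [inv_mul_le_iff₀ (hch τ)]
      exact hle τ t
    · simp only [smul_eq_mul]
      exact continuous_const.mul (hcosh.mul (hc t))
  have h2 : (fun τ : ℝ => mellinInv σ (Ψ τ) x) = fun τ : ℝ => ((Real.cosh (Real.pi * τ) : ℝ) : ℂ) *
      mellinInv σ (fun s => (((Real.cosh (Real.pi * τ))⁻¹ : ℝ) : ℂ) * Ψ τ s) x := by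
    funext τ
    rw [mellinInv_real_mul, ← mul_assoc, ← ofReal_mul, mul_inv_cancel₀ (hch τ).ne', ofReal_one,
      one_mul]
  rw [h2]
  exact (continuous_ofReal.comp (Real.continuous_cosh.comp (by fun_prop))).mul h1

lemma continuous_kiMellin_param {s : ℂ} (hs : 0 < s.re) : Continuous fun τ : ℝ => kiMellin τ s := by
  have g1 : Continuous fun τ : ℝ => Gamma (s + I * τ) :=
    continuous_iff_continuousAt.2 fun τ => ContinuousAt.comp (g := Gamma)
      (f := fun τ : ℝ => s + I * τ)
      (differentiableAt_Gamma_of_re_pos (by simpa using hs)).continuousAt (by fun_prop)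
  have g2 : Continuous fun τ : ℝ => Gamma (s - I * τ) :=
    continuous_iff_continuousAt.2 fun τ => ContinuousAt.comp (g := Gamma)
      (f := fun τ : ℝ => s - I * τ)
      (differentiableAt_Gamma_of_re_pos (by simpa using hs)).continuousAt (by fun_prop)
  have g3 : Continuous fun τ : ℝ => ((Real.cosh (Real.pi * τ) / Real.sqrt Real.pi : ℝ) : ℂ) :=
    continuous_ofReal.comp ((Real.continuous_cosh.comp (by fun_prop)).div_const _)
  exact g3.mul (((continuous_const.mul g1).mul g2).mul continuous_const)

lemma continuous_mellinInv_weberMellin {α γ x : ℝ} (hγ : max (-α) 0 < γ) (hγ' : γ < 1 / 2)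
    (hx : 0 < x) : Continuous fun τ : ℝ => mellinInv γ (weberMellin α τ) x := by
  have h0 : 0 < γ := (le_max_right _ _).trans_lt hγ
  refine continuous_mellinInv_param hx
    (b := fun t => 2 ^ (2 * γ) / Real.pi * ProbabilityTheory.beta γ γ *
      normIntegrand α (γ + t * I))
    ((integrable_normIntegrand hγ hγ').const_mul _) (fun τ t => ?_) (fun τ => ?_) fun t => ?_
  · have e : ((γ : ℂ) + t * I).re = γ := by simp
    have := norm_weberMellin_le (α := α) (s := γ + t * I) (by rw [e]; exact h0)
      (by rw [e]; exact hγ') τ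
    rwa [e] at this
  · exact continuous_vertical (fun s => differentiableAt_weberMellin_strip) hγ hγ'
  · exact continuous_const.mul ((continuous_kiMellin_param (by simpa using h0)).mul
      continuous_const)

lemma continuous_mellinInv_kiMellin {γ x : ℝ} (h0 : 0 < γ) (h1 : γ < 1 / 2)
    (hx : 0 < x) : Continuous fun τ : ℝ => mellinInv γ (kiMellin τ) x := by
  have hhalf : ((1 : ℂ) / 2).re = 1 / 2 := by norm_num
  have hpi := Real.pi_pos
  -- `Γ(2s)` is replaced by a product of Gamma functions with unit coefficient of `s`
  have dup : ∀ s : ℂ, Gamma (2 * s) = ((1 / (2 * Real.sqrt Real.pi) : ℝ) : ℂ) *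
      (Gamma s * Gamma (s + 1 / 2)) * ((2 : ℝ) : ℂ) ^ (2 * s) := by
    intro s
    have hq : ((Real.sqrt Real.pi : ℝ) : ℂ) ≠ 0 := ofReal_ne_zero.2 (Real.sqrt_pos.2 hpi).ne'
    have h2 : (2 : ℂ) ^ (2 * s) ≠ 0 := by simp [cpow_eq_zero_iff]
    rw [Gamma_mul_Gamma_add_half, cpow_sub _ _ two_ne_zero, cpow_one]
    push_cast
    field_simp
  have hn : ∀ s : ℂ, ‖((2 : ℝ) : ℂ) ^ (2 * s)‖ = 2 ^ (2 * s.re) := fun s => by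
    rw [norm_cpow_eq_rpow_re_of_pos two_pos]; simp
  set f : ℂ → ℂ := fun s => Gamma (1 / 2 - s) * (Gamma s * Gamma (s + 1 / 2)) * (Gamma (1 - s))⁻¹
    with hf
  have hg : StripGrowth (-Real.pi) f := by
    have := ((stripGrowth_Gamma.comp_sub (1 / 2)).mul
      (stripGrowth_Gamma.mul (stripGrowth_Gamma.comp_add (1 / 2)))).mul
        (stripGrowth_Gamma_inv.comp_sub 1)
    convert this using 1
    ring
  have hc : Continuous fun t : ℝ => f (γ + t * I) := by
    refine ((continuous_Gamma_vertical (g := fun s => 1 / 2 - s) (by fun_prop) fun s hs => ?_).mul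
      ((continuous_Gamma_vertical (g := fun s => s) (by fun_prop) fun s hs => ?_).mul
        (continuous_Gamma_vertical (g := fun s => s + 1 / 2) (by fun_prop) fun s hs => ?_))).mul
      (continuous_Gamma_inv_vertical (g := fun s => 1 - s) (by fun_prop))
    · rw [sub_re, hhalf, hs]; linarith
    · rw [hs]; exact h0
    · rw [add_re, hhalf, hs]; linarith
  refine continuous_mellinInv_param hx
    (b := fun t => ProbabilityTheory.beta γ γ * (1 / Real.sqrt Real.pi *
      (1 / (2 * Real.sqrt Real.pi)) * 2 ^ (2 * γ)) * ‖f (γ + t * I)‖)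
    ((hg.integrable_vertical (by linarith) hc).norm.const_mul _) (fun τ t => ?_)
    (fun τ => ?_) fun t => ?_
  · have e : ((γ : ℂ) + t * I).re = γ := by simp
    have := norm_kiMellin_le (s := γ + t * I) (by rw [e]; exact h0) τ
    rw [dup, e] at this
    refine this.trans (le_of_eq ?_)
    simp only [hf, norm_mul, hn, e, norm_real]
    rw [Real.norm_of_nonneg (by positivity), Real.norm_of_nonneg (by positivity)]
    ring
  · exact continuous_vertical (fun s => differentiableAt_kiMellin_strip) h0 h1
  · exact continuous_kiMellin_param (by simpa using h0)

/-- The representation of the kernel `W_α`, including its value at `τ = 0`. -/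
theorem weberKernel_eq_mellinInv {α γ x : ℝ} (hγ : max (-α) 0 < γ) (hγ' : γ < 1 / 2)
    (hx : 0 < x) (τ : ℝ) : (weberKernel α x τ : ℂ) = mellinInv γ (weberMellin α τ) x := by
  by_cases hτ : τ = 0
  · subst hτ
    have hc := (continuous_mellinInv_weberMellin hγ hγ' hx).continuousAt (x := 0)
    have hq : Tendsto (fun t : ℝ => ((weberQuotient α x t : ℝ) : ℂ)) (𝓝[≠] 0)
        (𝓝 (mellinInv γ (weberMellin α 0) x)) := by
      refine (tendsto_nhdsWithin_of_tendsto_nhds hc).congr' ?_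
      filter_upwards [self_mem_nhdsWithin] with t ht
      exact (weberQuotient_eq_mellinInv hγ hγ' hx ht).symm
    have hre := (continuous_re.tendsto _).comp hq
    have him := (continuous_im.tendsto _).comp hq
    have h0 : (mellinInv γ (weberMellin α 0) x).im = 0 := by
      refine tendsto_nhds_unique him ?_
      simp [Function.comp_def]
    have hlim : weberKernel α x 0 = (mellinInv γ (weberMellin α 0) x).re := by
      rw [weberKernel, if_pos rfl]
      exact Tendsto.limUnder_eq (by simpa [Function.comp_def] using hre)
    rw [hlim]
    exact Complex.ext (by simp) (by simp [h0])
  · rw [weberKernel, if_neg hτ]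
    exact weberQuotient_eq_mellinInv hγ hγ' hx hτ

lemma continuous_weberKernel {α γ x : ℝ} (hγ : max (-α) 0 < γ) (hγ' : γ < 1 / 2)
    (hx : 0 < x) : Continuous fun τ : ℝ => weberKernel α x τ := by
  have h := continuous_re.comp (continuous_mellinInv_weberMellin hγ hγ' hx)
  refine h.congr fun τ => ?_
  simp only [Function.comp]
  rw [← weberKernel_eq_mellinInv hγ hγ' hx, ofReal_re]

lemma norm_weberKernel_le {α γ x : ℝ} (hγ : max (-α) 0 < γ) (hγ' : γ < 1 / 2)
    (hx : 0 < x) (τ : ℝ) :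
    ‖(weberKernel α x τ : ℂ)‖ ≤ Real.cosh (Real.pi * τ) * (normConst α γ * x ^ (-γ)) := by
  have h0 : 0 < γ := (le_max_right _ _).trans_lt hγ
  have hpi := Real.pi_pos
  rw [weberKernel_eq_mellinInv hγ hγ' hx]
  refine (norm_mellinInv_le _ _ hx).trans ?_
  have hint : ∫ t : ℝ, ‖weberMellin α τ (γ + t * I)‖ ≤ Real.cosh (Real.pi * τ) *
      (2 ^ (2 * γ) / Real.pi * ProbabilityTheory.beta γ γ *
        ∫ t : ℝ, normIntegrand α (γ + t * I)) := by
    rw [← integral_const_mul, ← integral_const_mul]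
    refine integral_mono_of_nonneg (Eventually.of_forall fun t => norm_nonneg _)
      (((integrable_normIntegrand hγ hγ').const_mul _).const_mul _)
      (Eventually.of_forall fun t => ?_)
    have e : ((γ : ℂ) + t * I).re = γ := by simp
    have := norm_weberMellin_le (α := α) (s := γ + t * I) (by rw [e]; exact h0)
      (by rw [e]; exact hγ') τ
    rwa [e] at this
  calc _ ≤ 1 / (2 * Real.pi) * (Real.cosh (Real.pi * τ) *
      (2 ^ (2 * γ) / Real.pi * ProbabilityTheory.beta γ γ *
        ∫ t : ℝ, normIntegrand α (γ + t * I))) * x ^ (-γ) := by gcongr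
    _ = _ := by
      rw [normConst, Real.rpow_sub two_pos, Real.rpow_one]
      generalize ∫ t : ℝ, normIntegrand α (γ + t * I) = N
      field_simp

/-- The limit that defines `K_0` exists, as the quotient of the derivatives at order zero. -/
lemma tendsto_besselKAux_zero {z : ℂ} (hz : z ≠ 0) :
    ∃ L : ℂ, Tendsto (fun ν => besselKAux ν z) (𝓝[≠] 0) (𝓝 L) := by
  have hI : Differentiable ℂ fun ν => besselI ν z := by
    simp_rw [besselI_eq]; exact differentiable_besselSeries 1 hz
  have hd : Differentiable ℂ fun ν => besselI (-ν) z - besselI ν z :=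
    (hI.comp differentiable_neg).sub hI
  have h1 := (hd 0).hasDerivAt.tendsto_slope
  have h2 := ((hasDerivAt_mul_const (Real.pi : ℂ)).csin (x := 0)).tendsto_slope
  simp only [zero_mul, cos_zero, one_mul] at h2
  have hpi0 : (Real.pi : ℂ) ≠ 0 := ofReal_ne_zero.2 Real.pi_ne_zero
  refine ⟨_, ((h1.div h2 hpi0).const_mul ((Real.pi : ℂ) / 2)).congr' ?_⟩
  filter_upwards [self_mem_nhdsWithin] with ν hν
  have hν' : ν ≠ 0 := hν
  simp only [Pi.div_apply, slope_def_field, besselKAux, neg_zero, sub_self, sub_zero, zero_mul,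
    sin_zero]
  rw [div_div_div_cancel_right₀ hν']
  ring

/-- The representation of the kernel `K_{iτ}(I_{iτ} + I_{-iτ})`, including its value at `τ = 0`. -/
theorem KIKernel_eq_mellinInv {γ x : ℝ} (h0 : 0 < γ) (h1 : γ < 1 / 2) (hx : 0 < x) (τ : ℝ) :
    KIKernel x τ = mellinInv γ (kiMellin τ) x := by
  by_cases hτ : τ = 0
  · subst hτ
    have hz : ((Real.sqrt x : ℝ) : ℂ) ≠ 0 := ofReal_ne_zero.2 (Real.sqrt_pos.2 hx).ne'
    have hI : Continuous fun ν => besselI ν (Real.sqrt x) := by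
      simp_rw [besselI_eq]; exact (differentiable_besselSeries 1 hz).continuous
    obtain ⟨L, hL⟩ := tendsto_besselKAux_zero hz
    have hK0 : besselK 0 (Real.sqrt x) = L := by
      rw [besselK, if_pos ⟨0, by simp⟩]
      exact hL.limUnder_eq
    have himag : Tendsto (fun t : ℝ => I * (t : ℂ)) (𝓝[≠] 0) (𝓝[≠] 0) := by
      refine tendsto_nhdsWithin_of_tendsto_nhds_of_eventually_within _ ?_ ?_
      · refine tendsto_nhdsWithin_of_tendsto_nhds ?_
        have : ContinuousAt (fun t : ℝ => I * (t : ℂ)) 0 := by fun_prop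
        simpa [ContinuousAt] using this
      · filter_upwards [self_mem_nhdsWithin] with t ht
        simpa using ht
    have hsum : Tendsto (fun t : ℝ => besselI (I * t) (Real.sqrt x) +
        besselI (-(I * t)) (Real.sqrt x)) (𝓝[≠] 0)
        (𝓝 (besselI (I * (0 : ℝ)) (Real.sqrt x) + besselI (-(I * (0 : ℝ))) (Real.sqrt x))) := by
      refine tendsto_nhdsWithin_of_tendsto_nhds (ContinuousAt.tendsto ?_)
      exact ((hI.comp (by fun_prop : Continuous fun t : ℝ => I * (t : ℂ))).add
        (hI.comp (by fun_prop : Continuous fun t : ℝ => -(I * (t : ℂ))))).continuousAt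
    have hlim := (hL.comp himag).mul hsum
    have hc := tendsto_nhdsWithin_of_tendsto_nhds (s := {0}ᶜ)
      ((continuous_mellinInv_kiMellin h0 h1 hx).tendsto 0)
    have heq : KIKernel x 0 = L * (besselI (I * (0 : ℝ)) (Real.sqrt x) +
        besselI (-(I * (0 : ℝ))) (Real.sqrt x)) := by
      rw [KIKernel, ofReal_zero, mul_zero, hK0]
    rw [heq]
    refine tendsto_nhds_unique hlim (hc.congr' ?_)
    filter_upwards [self_mem_nhdsWithin] with t ht
    have ht' : t ≠ 0 := ht
    rw [← KIKernel_eq_mellinInv_of_ne_zero h0 h1 hx ht', KIKernel, besselK,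
      if_neg (not_int_of_im_ne_zero (by simpa using ht'))]
    rfl
  · exact KIKernel_eq_mellinInv_of_ne_zero h0 h1 hx hτ

end KernelRepresentation

/-! ### The index transform -/

section IndexTransform

open Complex

lemma weightedL1_integrableOn {γ : ℝ} {f : ℝ → ℂ} (hf : f ∈ weightedL1 (1 - γ)) :
    IntegrableOn (fun x : ℝ => ((x ^ (-γ) : ℝ) : ℂ) * f x) (Ioi 0) := by
  have : IntegrableOn (fun x : ℝ => ((x ^ ((1 - γ) - 1) : ℝ) : ℂ) * f x) (Ioi 0) := hf
  rwa [show (1 - γ) - 1 = -γ by ring] at this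

lemma norm_rpow_mul {γ x : ℝ} (hx : 0 < x) (z : ℂ) :
    ‖((x ^ (-γ) : ℝ) : ℂ) * z‖ = ‖z‖ * x ^ ((1 - γ) - 1) := by
  rw [norm_mul, norm_real, Real.norm_of_nonneg (by positivity), mul_comm,
    show (1 - γ) - 1 = -γ by ring]

/-- The index transform as an integral over the line of integration in the Mellin plane. -/
lemma weberTransform_eq {α γ : ℝ} (hγ : max (-α) 0 < γ) (hγ' : γ < 1 / 2) {f : ℝ → ℂ}
    (hf : f ∈ weightedL1 (1 - γ)) (τ : ℝ) :
    IntegrableOn (fun x : ℝ => (weberKernel α x τ : ℂ) * f x) (Ioi 0) ∧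
      weberTransform α f τ = (1 / (2 * Real.pi) : ℝ) *
        ∫ t : ℝ, weberMellin α τ (γ + t * I) * mellin f (1 - (γ + t * I)) := by
  have hpi := Real.pi_pos
  have hΨ : Integrable fun t : ℝ => weberMellin α τ (γ + t * I) :=
    (stripGrowth_weberMellin α τ).integrable_vertical (by linarith)
      (continuous_vertical (fun s => differentiableAt_weberMellin_strip) hγ hγ')
  obtain ⟨h1, h2⟩ := integral_mul_mellinInv (weightedL1_integrableOn hf) hΨ
  have heq : ∀ x ∈ Ioi (0 : ℝ), f x * mellinInv γ (weberMellin α τ) x =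
      (weberKernel α x τ : ℂ) * f x := fun x hx => by
    rw [weberKernel_eq_mellinInv hγ hγ' hx, mul_comm]
  refine ⟨h1.congr_fun heq measurableSet_Ioi, ?_⟩
  rw [weberTransform, ← setIntegral_congr_fun measurableSet_Ioi heq, h2]

lemma norm_weberTransform_integrand_le {α γ : ℝ} (hγ : max (-α) 0 < γ) (hγ' : γ < 1 / 2)
    (f : ℝ → ℂ) (τ : ℝ) {x : ℝ} (hx : 0 < x) : ‖(weberKernel α x τ : ℂ) * f x‖ ≤
      Real.cosh (Real.pi * τ) * (normConst α γ * ‖((x ^ (-γ) : ℝ) : ℂ) * f x‖) := by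
  have hp : 0 ≤ x ^ (-γ) := by positivity
  rw [norm_mul, norm_mul (((x ^ (-γ) : ℝ) : ℂ)), norm_real (x ^ (-γ)), Real.norm_of_nonneg hp]
  calc _ ≤ Real.cosh (Real.pi * τ) * (normConst α γ * x ^ (-γ)) * ‖f x‖ := by
        gcongr; exact norm_weberKernel_le hγ hγ' hx τ
    _ = _ := by ring

lemma norm_weberTransform_div_cosh_le {α γ : ℝ} (hγ : max (-α) 0 < γ) (hγ' : γ < 1 / 2)
    {f : ℝ → ℂ} (hf : f ∈ weightedL1 (1 - γ)) (τ : ℝ) :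
    ‖weberTransform α f τ‖ / Real.cosh (Real.pi * τ) ≤
      normConst α γ * weightedL1Norm (1 - γ) f := by
  rw [div_le_iff₀ (Real.cosh_pos _), weightedL1Norm, mul_comm, ← integral_const_mul,
    ← integral_const_mul]
  have hi := ((weightedL1_integrableOn hf).norm.const_mul (normConst α γ)).const_mul
    (Real.cosh (Real.pi * τ))
  have hae : ∀ᵐ x ∂volume.restrict (Ioi (0 : ℝ)), ‖(weberKernel α x τ : ℂ) * f x‖ ≤
      Real.cosh (Real.pi * τ) * (normConst α γ * ‖((x ^ (-γ) : ℝ) : ℂ) * f x‖) :=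
    (ae_restrict_iff' measurableSet_Ioi).2 (Eventually.of_forall fun x hx =>
      norm_weberTransform_integrand_le hγ hγ' f τ hx)
  refine (norm_integral_le_of_norm_le hi hae).trans (le_of_eq ?_)
  refine setIntegral_congr_fun measurableSet_Ioi fun x hx => ?_
  rw [norm_rpow_mul hx]

lemma continuous_weberTransform_div_cosh {α γ : ℝ} (hγ : max (-α) 0 < γ) (hγ' : γ < 1 / 2)
    {f : ℝ → ℂ} (hf : f ∈ weightedL1 (1 - γ)) :
    Continuous fun τ : ℝ => weberTransform α f τ / (Real.cosh (Real.pi * τ) : ℂ) := by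
  have hch : ∀ τ : ℝ, 0 < Real.cosh (Real.pi * τ) := fun τ => Real.cosh_pos _
  have hcosh : Continuous fun τ : ℝ => ((Real.cosh (Real.pi * τ) : ℝ) : ℂ) :=
    continuous_ofReal.comp (Real.continuous_cosh.comp (by fun_prop))
  have e : (fun τ : ℝ => weberTransform α f τ / (Real.cosh (Real.pi * τ) : ℂ)) = fun τ : ℝ =>
      ∫ x in Ioi (0 : ℝ), (weberKernel α x τ : ℂ) * f x / ((Real.cosh (Real.pi * τ) : ℝ) : ℂ) := by
    funext τ
    rw [weberTransform, integral_div]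
  rw [e]
  refine continuous_of_dominated
    (bound := fun x => normConst α γ * ‖((x ^ (-γ) : ℝ) : ℂ) * f x‖) (fun τ => ?_) (fun τ => ?_)
    ((weightedL1_integrableOn hf).norm.const_mul _) ?_
  · exact ((weberTransform_eq hγ hγ' hf τ).1.div_const _).aestronglyMeasurable
  · refine (ae_restrict_iff' measurableSet_Ioi).2 (Eventually.of_forall fun x hx => ?_)
    rw [norm_div, norm_real, Real.norm_of_nonneg (hch τ).le, div_le_iff₀' (hch τ)]
    exact norm_weberTransform_integrand_le hγ hγ' f τ hx
  · refine (ae_restrict_iff' measurableSet_Ioi).2 (Eventually.of_forall fun x hx => ?_)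
    exact ((continuous_ofReal.comp (continuous_weberKernel hγ hγ' hx)).mul continuous_const).div
      hcosh fun τ => ofReal_ne_zero.2 (hch τ).ne'

lemma weberTransform_mem_weightedCb {α γ : ℝ} (hγ : max (-α) 0 < γ) (hγ' : γ < 1 / 2)
    {f : ℝ → ℂ} (hf : f ∈ weightedL1 (1 - γ)) : weberTransform α f ∈ weightedCb :=
  ⟨continuous_weberTransform_div_cosh hγ hγ' hf, _, norm_weberTransform_div_cosh_le hγ hγ' hf⟩

/-- The index transform as a linear map. -/
noncomputable def weberTransformLinear (α γ : ℝ) (hγ : max (-α) 0 < γ) (hγ' : γ < 1 / 2) :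
    weightedL1 (1 - γ) →ₗ[ℂ] weightedCb where
  toFun f := ⟨weberTransform α f, weberTransform_mem_weightedCb hγ hγ' f.2⟩
  map_add' f g := by
    ext τ
    simp only [weberTransform, Submodule.coe_add, Pi.add_apply, mul_add]
    exact integral_add (weberTransform_eq hγ hγ' f.2 τ).1 (weberTransform_eq hγ hγ' g.2 τ).1
  map_smul' c f := by
    ext τ
    simp only [weberTransform, Submodule.coe_smul, Pi.smul_apply, smul_eq_mul, RingHom.id_apply,
      mul_left_comm _ c]
    exact integral_const_mul _ _

/-- The Mellin transform of `f` is continuous and bounded on the line `re s = 1 - γ`. -/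
lemma continuous_mellin_vertical {γ : ℝ} {f : ℝ → ℂ} (hf : f ∈ weightedL1 (1 - γ)) :
    Continuous (fun t : ℝ => mellin f (((1 - γ : ℝ) : ℂ) + t * I)) ∧
      ∀ t : ℝ, ‖mellin f (((1 - γ : ℝ) : ℂ) + t * I)‖ ≤
        ∫ x in Ioi (0 : ℝ), ‖((x ^ (-γ) : ℝ) : ℂ) * f x‖ := by
  have hi := weightedL1_integrableOn hf
  have e : ∀ t : ℝ, mellin f (((1 - γ : ℝ) : ℂ) + t * I) = ∫ x in Ioi (0 : ℝ),
      exp ((-(-t * Real.log x) : ℝ) * I) * (((x ^ (-γ) : ℝ) : ℂ) * f x) := by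
    intro t
    rw [mellin]
    refine setIntegral_congr_fun measurableSet_Ioi fun x hx => ?_
    have e1 : ((1 - γ : ℝ) : ℂ) + t * I - 1 = -((γ : ℂ) + ((-t : ℝ) : ℂ) * I) := by
      push_cast; ring
    rw [e1, cpow_neg_vertical hx, smul_eq_mul]
    ring
  constructor
  · simp_rw [e]
    refine continuous_of_dominated (fun t => ?_) (fun t => ?_) hi.norm
      (Eventually.of_forall fun x => by fun_prop)
    · refine AEStronglyMeasurable.mul (Measurable.aestronglyMeasurable ?_) hi.aestronglyMeasurable
      have : Measurable fun x : ℝ => -(-t * Real.log x) := by fun_prop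
      fun_prop
    · refine Eventually.of_forall fun x => ?_
      rw [norm_mul, norm_exp_ofReal_mul_I, one_mul]
  · intro t
    rw [e]
    refine (norm_integral_le_integral_norm _).trans (le_of_eq ?_)
    simp_rw [norm_mul (exp _), norm_exp_ofReal_mul_I, one_mul]

lemma integrable_phiMellin {α γ : ℝ} (hγ : max (-α) 0 < γ) (hγ' : γ < 1 / 2) {f : ℝ → ℂ}
    (hf : f ∈ weightedL1 (1 - γ)) :
    Integrable fun t : ℝ => phiMellin α f (((1 - γ : ℝ) : ℂ) + t * I) := by
  have h0 : 0 < γ := (le_max_right _ _).trans_lt hγ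
  have hαγ : -α < γ := (le_max_left _ _).trans_lt hγ
  have hpi := Real.pi_pos
  set F : ℂ → ℂ := fun s =>
    Gamma (1 + α - s) * (Gamma s * Gamma s) * (Gamma (s + α))⁻¹ with hF
  have hg : StripGrowth (-Real.pi) F := by
    have := ((stripGrowth_Gamma.comp_sub (1 + α)).mul (stripGrowth_Gamma.mul stripGrowth_Gamma)).mul
      (stripGrowth_Gamma_inv.comp_add α)
    convert this using 1
    ring
  have hc : Continuous fun t : ℝ => F (((1 - γ : ℝ) : ℂ) + t * I) := by
    refine ((continuous_Gamma_vertical (g := fun s => 1 + α - s) (by fun_prop) fun s hs => ?_).mul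
      ((continuous_Gamma_vertical (g := fun s => s) (by fun_prop) fun s hs => ?_).mul
        (continuous_Gamma_vertical (g := fun s => s) (by fun_prop) fun s hs => ?_))).mul
      (continuous_Gamma_inv_vertical (g := fun s => s + α) (by fun_prop))
    · rw [sub_re, add_re, ofReal_re, one_re, hs]; linarith
    all_goals rw [hs]; linarith
  obtain ⟨m1, m2⟩ := continuous_mellin_vertical hf
  have := (hg.integrable_vertical (by linarith) hc).mul_bdd m1.aestronglyMeasurable
    (Eventually.of_forall m2)
  refine this.congr (Eventually.of_forall fun t => ?_)
  simp only [hF, phiMellin]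
  rw [show 1 - ((((1 - γ : ℝ) : ℂ)) + t * I) + α = 1 + α - (((1 - γ : ℝ) : ℂ) + t * I) by ring,
    sq, div_eq_mul_inv]

lemma integrable_cpow_mul_phiMellin {α γ : ℝ} (hγ : max (-α) 0 < γ) (hγ' : γ < 1 / 2) {f : ℝ → ℂ}
    (hf : f ∈ weightedL1 (1 - γ)) {x : ℝ} (hx : 0 < x) :
    Integrable fun t : ℝ => (x : ℂ) ^ (-(((1 - γ : ℝ) : ℂ) + t * I)) *
      phiMellin α f (((1 - γ : ℝ) : ℂ) + t * I) := by
  refine (integrable_phiMellin hγ hγ' hf).bdd_mul (c := x ^ (-(1 - γ))) ?_ ?_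
  · exact (Continuous.const_cpow (by fun_prop)
      (Or.inl (ofReal_ne_zero.2 hx.ne'))).aestronglyMeasurable
  · refine Eventually.of_forall fun t => ?_
    rw [norm_cpow_eq_rpow_re_of_pos hx]
    simp

/-- The Mellin transform of `K_{iτ}(√x) [I_{iτ}(√x) + I_{-iτ}(√x)]` on the line `re s = γ`. -/
lemma mellin_KIKernel {γ : ℝ} (h0 : 0 < γ) (h1 : γ < 1 / 2) (τ : ℝ) :
    IntegrableOn (fun x : ℝ => ((x ^ (-(1 - γ)) : ℝ) : ℂ) * KIKernel x τ) (Ioi 0) ∧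
      ∀ t : ℝ, mellin (fun x => KIKernel x τ) (γ + t * I) = kiMellin τ (γ + t * I) := by
  have hpi := Real.pi_pos
  have hd : ∀ s : ℂ, 0 < s.re → s.re < 1 / 2 → DifferentiableAt ℂ (kiMellin τ) s :=
    fun s => differentiableAt_kiMellin_strip
  have hconv := mellinConvergent_mellinInv (by linarith) (stripGrowth_kiMellin τ) hd h0 h1
  have hc := continuous_vertical hd h0 h1
  have hi := (stripGrowth_kiMellin τ).integrable_vertical (by linarith) hc
  constructor
  · refine IntegrableOn.congr_fun hconv (fun x hx => ?_) measurableSet_Ioi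
    have e : ((γ : ℂ) - 1) = ((-(1 - γ) : ℝ) : ℂ) := by push_cast; ring
    rw [KIKernel_eq_mellinInv h0 h1 hx, smul_eq_mul, e, ofReal_cpow (le_of_lt hx)]
  · intro t
    rw [← mellin_mellinInv hc hi hconv t, mellin, mellin]
    refine setIntegral_congr_fun measurableSet_Ioi fun x hx => ?_
    rw [KIKernel_eq_mellinInv h0 h1 hx]

/-- The identity between the Mellin transforms that links the two index integrals. -/
lemma weberMellin_mul_mellin (α τ : ℝ) (f : ℝ → ℂ) (s : ℂ) :
    weberMellin α τ s * mellin f (1 - s) =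
      ((1 / Real.pi ^ 2 : ℝ) : ℂ) * (phiMellin α f (1 - s) * kiMellin τ s) := by
  rw [weberMellin, weberFactor, phiMellin, show 1 - (1 - s) + (α : ℂ) = s + α by ring,
    show 1 - s + (α : ℂ) = 1 + α - s by ring, div_eq_mul_inv]
  ring

/-- The representation of the index transform through `φ_α`: both sides are the same integral in the
Mellin plane, up to the reflection `s ↦ 1 - s` of the line of integration. -/
theorem weberTransform_eq_integral_KIKernel {α γ : ℝ} (hγ : max (-α) 0 < γ) (hγ' : γ < 1 / 2)
    {f : ℝ → ℂ} (hf : f ∈ weightedL1 (1 - γ)) (τ : ℝ) :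
    IntegrableOn (fun x : ℝ => KIKernel x τ * phi α γ f x) (Ioi 0) ∧
      weberTransform α f τ = 1 / (Real.pi : ℂ) ^ 2 *
        ∫ x in Ioi (0 : ℝ), KIKernel x τ * phi α γ f x := by
  have h0 : 0 < γ := (le_max_right _ _).trans_lt hγ
  obtain ⟨k1, k2⟩ := mellin_KIKernel h0 hγ' τ
  obtain ⟨p1, p2⟩ := integral_mul_mellinInv k1 (integrable_phiMellin hγ hγ' hf)
  refine ⟨p1, ?_⟩
  have e : ∫ x in Ioi (0 : ℝ), KIKernel x τ * phi α γ f x = _ := p2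
  rw [e, (weberTransform_eq hγ hγ' hf τ).2,
    ← integral_neg_eq_self (fun t : ℝ => phiMellin α f (((1 - γ : ℝ) : ℂ) + t * I) *
      mellin (fun x => KIKernel x τ) (1 - (((1 - γ : ℝ) : ℂ) + t * I))) volume]
  have e2 : ∀ t : ℝ, weberMellin α τ (γ + t * I) * mellin f (1 - (γ + t * I)) =
      ((1 / Real.pi ^ 2 : ℝ) : ℂ) *
        (phiMellin α f (((1 - γ : ℝ) : ℂ) + ((-t : ℝ) : ℂ) * I) *
          mellin (fun x => KIKernel x τ) (1 - (((1 - γ : ℝ) : ℂ) + ((-t : ℝ) : ℂ) * I))) := by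
    intro t
    rw [weberMellin_mul_mellin, ← k2 t]
    have a1 : 1 - ((γ : ℂ) + t * I) = ((1 - γ : ℝ) : ℂ) + ((-t : ℝ) : ℂ) * I := by
      push_cast; ring
    have a2 : (γ : ℂ) + t * I = 1 - (((1 - γ : ℝ) : ℂ) + ((-t : ℝ) : ℂ) * I) := by
      push_cast; ring
    rw [a1, ← a2]
  simp_rw [e2]
  rw [integral_const_mul]
  push_cast
  ring

end IndexTransform

end WeberIndex

theorem theorem2 (α γ : ℝ) (hγ : max (-α) 0 < γ) (hγ' : γ < 1 / 2) :
    -- the kernel has a limit at `τ = 0`, and the integrals of the transform and of the constant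
    -- converge absolutely
    (∀ x : ℝ, 0 < x → ContinuousAt (fun τ : ℝ => WeberIndex.weberKernel α x τ) 0) ∧
    (∀ f ∈ WeberIndex.weightedL1 (1 - γ), ∀ τ : ℝ,
      IntegrableOn (fun x : ℝ => (WeberIndex.weberKernel α x τ : ℂ) * f x) (Ioi 0)) ∧
    Integrable (fun t : ℝ => WeberIndex.normIntegrand α (γ + t * Complex.I)) ∧
    -- the transform is a bounded linear operator, with the explicit constant
    (∃ T : WeberIndex.weightedL1 (1 - γ) →ₗ[ℂ] WeberIndex.weightedCb,
      (∀ (f : WeberIndex.weightedL1 (1 - γ)) (τ : ℝ),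
        (T f : ℝ → ℂ) τ = WeberIndex.weberTransform α (f : ℝ → ℂ) τ) ∧
      ∀ f : WeberIndex.weightedL1 (1 - γ),
        WeberIndex.weightedCbNorm (T f : ℝ → ℂ) ≤
          WeberIndex.normConst α γ * WeberIndex.weightedL1Norm (1 - γ) (f : ℝ → ℂ)) ∧
    -- the integral representation, with absolute convergence of both integrals
    (∀ f ∈ WeberIndex.weightedL1 (1 - γ),
      (∀ x : ℝ, 0 < x → Integrable (fun t : ℝ =>
        (x : ℂ) ^ (-(((1 - γ : ℝ) : ℂ) + t * Complex.I)) *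
          WeberIndex.phiMellin α f (((1 - γ : ℝ) : ℂ) + t * Complex.I))) ∧
      ∀ τ : ℝ,
        IntegrableOn (fun x : ℝ => WeberIndex.KIKernel x τ * WeberIndex.phi α γ f x) (Ioi 0) ∧
        WeberIndex.weberTransform α f τ =
          1 / (Real.pi : ℂ) ^ 2 *
            ∫ x in Ioi (0 : ℝ), WeberIndex.KIKernel x τ * WeberIndex.phi α γ f x) := by
  refine ⟨fun x hx => (WeberIndex.continuous_weberKernel hγ hγ' hx).continuousAt,
    fun f hf τ => (WeberIndex.weberTransform_eq hγ hγ' hf τ).1,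
    WeberIndex.integrable_normIntegrand hγ hγ',
    ⟨WeberIndex.weberTransformLinear α γ hγ hγ', fun f τ => rfl, fun f =>
      ciSup_le fun τ => WeberIndex.norm_weberTransform_div_cosh_le hγ hγ' f.2 τ⟩,
    fun f hf => ⟨fun x hx => WeberIndex.integrable_cpow_mul_phiMellin hγ hγ' hf hx,
      fun τ => WeberIndex.weberTransform_eq_integral_KIKernel hγ hγ' hf τ⟩⟩
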